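/- **Notation.** Let $L=\mathbb Z^2$. For $x=(x_1,x_2)$ put $x^\perp=(x_2,-x_1)$; for $0\ne w\in L$ let $\gcd(w)$ be the greatest common divisor of its components and $\bar w=w/\gcd(w)$. Let $F$ be a real $2\times2$ matrix with $\det F>0$ and $\varphi:(0,\infty)\to\mathbb R$. For bounded $\Omega\subset\mathbb R^2$ the energy of the homogeneous deformation $y(x)=Fx$ is $$E\{\Omega,y\}=\frac12\sum_{x\in\Omega\cap L}\ \sum_{\substack{w\in L\setminus\{0\}\\ x+w\in\Omega\cap L}}\varphi(|Fw|).$$ For $0\neq\bar m\in L$ and unit vectors $n,m\in\mathbb R^2$ define $$W(F)=\frac12\sum_{w\in L\setminus\{0\}}\varphi(|Fw|),\qquad \gamma_\diamond(F,\bar m)=-\frac14\sum_{w\in L\setminus\{0\}}\frac1{|\bar m|}\bigl(|w\cdot\bar m|-1\bigr)\varphi(|Fw|),$$ $$\tau(F,n,m)=\frac12\sum_{w\in L\setminus\{0\}}\Bigl\{\Bigl[H_{n,m}(w)-\frac{\theta(n,m)}{2\pi}\Bigr](\gcd(w)-1)+H_{n,m}(w)\,N_T(w,n,m)\Bigr\}\varphi(|Fw|),$$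 where $\theta(n,m)\in[0,\pi]$ is the angle between $n$ and $m$; $H_{n,m}(w)=1$ if $(w\cdot n)(w\cdot m)<0$ and $H_{n,m}(w)=0$ otherwise; and, when $(w\cdot n)(w\cdot m)<0$ and $n\ne -m$, $$N_T(w,n,m)=s\bigl(q\cdot\bar w^\perp,\;q\cdot u^\perp,\;\gcd(w)\bigr),\qquad q=\frac{m\cdot w}{m\cdot n^\perp}\,n^\perp,$$ with $u\in L$ any vector such that $\bar w\cdot u^\perp=1$ (the value does not depend on the choice), $s(0,\beta,k)=0$ and, for $\alpha\neq0$, $$s(\alpha,\beta,k)=(\lceil|\alpha|\rceil-1)(k-1)+\sum_{j=1}^{\lceil|\alpha|\rceil-1}\left(\left\lceil\frac{\beta-k}{|\alpha|}\,j\right\rceil-\left\lfloor\frac{\beta}{|\alpha|}\,j\right\rfloor\right).$$ ($N_T(w,n,m)$ is the number of lattice points interior to the triangle with vertices $0,w,q$.) **Proposition 2.** Let $\Omega=\operatorname{conv}\{v_1,\dots,v_N\}$, $N\ge3$, be a nondegenerate convex lattice polygon with vertices $v_i\in L$ in counterclockwise order (indices mod $N$), facets $S_i=\operatorname{conv}\{v_i,v_{i+1}\}$,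 outward Miller normals $\bar n_i=\bigl((v_{i+1}-v_i)/\gcd(v_{i+1}-v_i)\bigr)^\perp$ and outward unit normals $n_i=\bar n_i/|\bar n_i|$, and let $\bar n=\bar n_i$ on $S_i$. Suppose that for some $d>2$ and every $r_0>0$ there is a constant $C=C(r_0)$ with $$|\varphi(r)|<C\,r^{-(2+d)}\qquad\text{for all } r\in[r_0,\infty).$$ Then the series defining $W(F)$, $\gamma_\diamond(F,\bar n_i)$ and $\tau(F,n_i,n_{i-1})$ converge absolutely for $i=1,\dots,N$, and as $k\to\infty$, $k\in\mathbb Z_+$, $$E\{k\Omega,y\}=k^2\int_\Omega W(F)\,dx+k\int_{\partial\Omega}\gamma_\diamond(F,\bar n)\,ds+\sum_{i=1}^N\tau(F,n_i,n_{i-1})+O(k^{2-d}).$$ -/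

import Mathlib

open scoped Pointwise

noncomputable section

namespace LatticeCrystal

/-- The Euclidean plane. -/
abbrev Plane : Type := EuclideanSpace ℝ (Fin 2)

/-- The lattice `L = ℤ²`. -/
abbrev Lat : Type := Fin 2 → ℤ

/-- The inclusion of the lattice in the plane. -/
def toPlane (w : Lat) : Plane := !₂[(w 0 : ℝ), (w 1 : ℝ)]

/-- `x^⊥ = (x₂, -x₁)` in the plane (rotation by a right angle, clockwise). -/
def perp (x : Plane) : Plane := !₂[x 1, -x 0]

/-- `x^⊥ = (x₂, -x₁)` in the lattice. -/
def latPerp (w : Lat) : Lat := ![w 1, -w 0]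

/-- The greatest common divisor of the components of a lattice vector. -/
def latGcd (w : Lat) : ℕ := Int.gcd (w 0) (w 1)

/-- The primitive vector `w̄ = w / gcd w`. -/
def prim (w : Lat) : Lat := ![w 0 / (latGcd w : ℤ), w 1 / (latGcd w : ℤ)]

/-- The bond range `R = L \ {0}`. -/
abbrev Bond : Type := {w : Lat // w ≠ 0}

/-- The length `|F w|` of the deformed bond vector. -/
def bondLength (F : Matrix (Fin 2) (Fin 2) ℝ) (w : Lat) : ℝ :=
  ‖Matrix.toEuclideanLin F (toPlane w)‖

/-- The energy `E{Ω, y}` of the homogeneous deformation `y(x) = F x`: half the sum of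
`φ(|F w|)` over lattice points `x ∈ Ω` and bond vectors `w ≠ 0` with `x + w ∈ Ω`.
(The sums are finite for bounded `Ω`.) -/
def energy (φ : ℝ → ℝ) (F : Matrix (Fin 2) (Fin 2) ℝ) (Ω : Set Plane) : ℝ :=
  (1 / 2) * ∑' x : {x : Lat // toPlane x ∈ Ω},
    ∑' w : {w : Lat // w ≠ 0 ∧ toPlane (x.1 + w) ∈ Ω}, φ (bondLength F w.1)

/-- The summand of the stored energy function. -/
def bulkTerm (φ : ℝ → ℝ) (F : Matrix (Fin 2) (Fin 2) ℝ) (w : Bond) : ℝ :=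
  φ (bondLength F w.1)

/-- The stored energy function `W(F)`. -/
def storedEnergy (φ : ℝ → ℝ) (F : Matrix (Fin 2) (Fin 2) ℝ) : ℝ :=
  (1 / 2) * ∑' w : Bond, bulkTerm φ F w

/-- The summand of the surface energy density. -/
def surfaceTerm (φ : ℝ → ℝ) (F : Matrix (Fin 2) (Fin 2) ℝ) (m : Lat) (w : Bond) : ℝ :=
  1 / ‖toPlane m‖ * (|inner ℝ (toPlane w.1) (toPlane m)| - 1) * φ (bondLength F w.1)

/-- The surface energy density `γ_⋄(F, m̄)`, for a lattice vector `m̄`. -/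
def surfaceDensity (φ : ℝ → ℝ) (F : Matrix (Fin 2) (Fin 2) ℝ) (m : Lat) : ℝ :=
  -(1 / 4) * ∑' w : Bond, surfaceTerm φ F m w

/-- The function `s(α, β, k)`: for `α ≠ 0` it is the number of lattice points interior to the
triangle with vertices `(0, 0)`, `(0, k)`, `(|α|, β)`, counted column by column. -/
def triangleSum (α β : ℝ) (k : ℤ) : ℤ :=
  if α = 0 then 0
  else (⌈|α|⌉ - 1) * (k - 1) +
    ∑ j ∈ Finset.Icc (1 : ℤ) (⌈|α|⌉ - 1), (⌈(β - k) / |α| * j⌉ - ⌊β / |α| * j⌋)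

/-- A lattice vector `u` that completes `w̄` to a lattice basis, oriented so that
`w̄ · u^⊥ = 1`; see `prim_complement`. -/
def complement (w : Lat) : Lat := ![-Int.gcdB (w 0) (w 1), Int.gcdA (w 0) (w 1)]

theorem prim_complement (w : Lat) (hw : w ≠ 0) :
    prim w ⬝ᵥ latPerp (complement w) = 1 := by
  have hg : (Int.gcd (w 0) (w 1) : ℤ) ≠ 0 := by
    intro h
    have h' : Int.gcd (w 0) (w 1) = 0 := by exact_mod_cast h
    rw [Int.gcd_eq_zero_iff] at h'
    apply hw
    funext i
    fin_cases i
    · exact h'.1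
    · exact h'.2
  have hb := Int.gcd_eq_gcd_ab (w 0) (w 1)
  have h0 : (Int.gcd (w 0) (w 1) : ℤ) * (w 0 / (Int.gcd (w 0) (w 1) : ℤ)) = w 0 :=
    Int.mul_ediv_cancel' (Int.gcd_dvd_left (w 0) (w 1))
  have h1 : (Int.gcd (w 0) (w 1) : ℤ) * (w 1 / (Int.gcd (w 0) (w 1) : ℤ)) = w 1 :=
    Int.mul_ediv_cancel' (Int.gcd_dvd_right (w 0) (w 1))
  simp only [prim, latPerp, complement, latGcd, dotProduct, Fin.sum_univ_two,
    Matrix.cons_val_zero, Matrix.cons_val_one, neg_neg]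
  apply mul_left_cancel₀ hg
  rw [mul_add, ← mul_assoc, ← mul_assoc, h0, h1, mul_one]
  exact hb.symm

/-- The apex `q = (m · w) / (m · n^⊥) n^⊥` of the triangle with base `[0, w]` whose sides through
`0` and `w` are normal to `n` and `m`. -/
def apex (w : Lat) (n m : Plane) : Plane :=
  (inner ℝ m (toPlane w) / inner ℝ m (perp n)) • perp n

/-- The number `N_T(w, n, m) = s(q · w̄^⊥, q · u^⊥, gcd w)`. -/
def cornerCount (w : Lat) (n m : Plane) : ℤ :=
  triangleSum (inner ℝ (apex w n m) (toPlane (latPerp (prim w))))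
    (inner ℝ (apex w n m) (toPlane (latPerp (complement w)))) (latGcd w)

open Classical in
/-- The sector step function `H_{n,m}(w)`. -/
def sectorStep (n m : Plane) (w : Lat) : ℝ :=
  if inner ℝ (toPlane w) n * inner ℝ (toPlane w) m < 0 then 1 else 0

/-- The summand of the vertex energy function. -/
def cornerTerm (φ : ℝ → ℝ) (F : Matrix (Fin 2) (Fin 2) ℝ) (n m : Plane) (w : Bond) : ℝ :=
  ((sectorStep n m w.1 - 1 / (2 * Real.pi) * InnerProductGeometry.angle n m) *
      ((latGcd w.1 : ℝ) - 1) +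
    sectorStep n m w.1 * (cornerCount w.1 n m : ℝ)) * φ (bondLength F w.1)

/-- The vertex energy function `τ(F, n, m)`. -/
def vertexEnergy (φ : ℝ → ℝ) (F : Matrix (Fin 2) (Fin 2) ℝ) (n m : Plane) : ℝ :=
  (1 / 2) * ∑' w : Bond, cornerTerm φ F n m w

/-- `v₀, …, v_{N-1}` are the vertices, in counterclockwise order (indices mod `N`), of a
nondegenerate convex lattice polygon: there are at least three of them, and every vertex other
than `v_i`, `v_{i+1}` lies strictly to the left of the line from `v_i` to `v_{i+1}`. -/
structure IsConvexLatticePolygon {N : ℕ} [NeZero N] (v : Fin N → Lat) : Prop where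
  three_le : 3 ≤ N
  left_of_edge : ∀ i j : Fin N, j ≠ i → j ≠ i + 1 →
    0 < (v (i + 1) 0 - v i 0) * (v j 1 - v i 1) - (v (i + 1) 1 - v i 1) * (v j 0 - v i 0)

/-- The polygon `Ω`, the convex hull of its vertices. -/
def polygon {N : ℕ} (v : Fin N → Lat) : Set Plane :=
  convexHull ℝ (Set.range fun i => toPlane (v i))

/-- The outward Miller normal `n̄_i` of the facet `S_i = [v_i, v_{i+1}]`. -/
def millerNormal {N : ℕ} [NeZero N] (v : Fin N → Lat) (i : Fin N) : Lat :=
  latPerp (prim (v (i + 1) - v i))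

/-- The outward unit normal `n_i = n̄_i / |n̄_i|` of the facet `S_i`. -/
def unitNormal {N : ℕ} [NeZero N] (v : Fin N → Lat) (i : Fin N) : Plane :=
  (‖toPlane (millerNormal v i)‖⁻¹ : ℝ) • toPlane (millerNormal v i)

open Classical in
/-- The Miller normal as a function on the boundary: `n̄ = n̄_i` on the facet `S_i` without its
endpoints (and `0` at the vertices, which form a null set). -/
def boundaryNormal {N : ℕ} [NeZero N] (v : Fin N → Lat) (x : Plane) : Lat :=
  if h : ∃ i, x ∈ openSegment ℝ (toPlane (v i)) (toPlane (v (i + 1))) then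
    millerNormal v h.choose
  else 0

end LatticeCrystal

end

/-!
Grouping the energy by bond vectors gives `E{kΩ, y} = ½ ∑_w G_k(w) φ(|F w|)`, where `G_k(w)` is the
number of lattice points `x` with `x` and `x + w` both in `kΩ` (`energy_eq`). The theorem follows
from an exact formula for `G_k(w)`, valid when `w` is short compared with `k`, and from a bound of
order `|w|²` on the discrepancy for the remaining bonds.

For the formula (`bondCount_vertical`, `bondCount_smul`), a unimodular change of coordinates makes `w`
vertical, `w = (0, g)` with `g = gcd w`. A column with `n` lattice points carries `max(0, n - g)`
bonds. Summing `n - g` over all columns gives the number of lattice points minus `g` times the number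
of columns; by Pick's theorem (`pick`) and the width formula (`two_mul_width`) this is the area term,
the boundary term `½ ∑_i (gcd E_i - |E_i × w|)` in the edge vectors `E_i`, and `1 - g`. The columns
with `n < g` must be corrected by `g - n`. They occur only near a vertex that is strictly leftmost or
strictly rightmost, that is, one where `H(w) = 1` for the two adjacent normals. There `g - n` summed
over the columns is `g - 1` plus the number of interior lattice points of the triangle erected over
the bond in the vertex cone (`sum_deficit_left`), which is the term `N_T`. The exterior angles of the
polygon add up to `2π` (`sum_angle`), so the terms `-θ/(2π) (gcd w - 1)` add up to `1 - g`, and the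
formula is precisely the coefficient of `φ(|F w|)` in the three leading terms.

The area and the boundary integral are identified with their lattice expressions in `volume_polygon`
(the area is the limit of the number of lattice points in `kΩ` over `k²`) and `integral_frontier`.
Finally, the decay of `φ` bounds the contribution of the bonds with `|w| ≳ k` by a multiple of
`∑_{|w| ≳ k} |w|^(-d)`, which is `O(k^(2-d))` (`exists_tail_bound`).
-/

noncomputable section

namespace LatticeCrystal

/-! ### Convex lattice polygons as intersections of half-planes -/

/-- The cross product (determinant) of two lattice vectors. -/
def crs (x y : Lat) : ℤ := x 0 * y 1 - x 1 * y 0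

/-- The value at a lattice vector of the linear functional with coefficients `p`, `q`. -/
def lin (p q : ℝ) (x : Lat) : ℝ := p * x 0 + q * x 1

section Polygon

variable {N : ℕ} [NeZero N] {V : Fin N → Lat}

/-- The edge vector from the `i`-th vertex to the next one. -/
def edge (V : Fin N → Lat) (i : Fin N) : Lat := V (i + 1) - V i

/-- The lattice point `x` lies weakly to the left of every edge line. -/
def Inside (V : Fin N → Lat) (x : Lat) : Prop := ∀ i, 0 ≤ crs (edge V i) (x - V i)

/-- The affine function that vanishes on the line of the `i`-th edge and is nonnegative on the
polygon; its value at a lattice point is `crs (edge V i) (x - V i)`. -/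
def side (V : Fin N → Lat) (i : Fin N) (x y : ℝ) : ℝ :=
  (edge V i 0 : ℝ) * (y - V i 1) - (edge V i 1 : ℝ) * (x - V i 0)

theorem side_lattice (V : Fin N → Lat) (i : Fin N) (x : Lat) :
    side V i (x 0) (x 1) = (crs (edge V i) (x - V i) : ℝ) := by
  simp only [side, crs, Pi.sub_apply]; push_cast; ring

theorem edge_pred (V : Fin N → Lat) (i : Fin N) : edge V (i - 1) = V i - V (i - 1) := by
  simp [edge]

namespace IsConvexLatticePolygon

theorem crs_pos (hV : IsConvexLatticePolygon V) {i j : Fin N} (h1 : j ≠ i) (h2 : j ≠ i + 1) :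
    0 < crs (edge V i) (V j - V i) := hV.left_of_edge i j h1 h2

theorem one_ne_zero (hV : IsConvexLatticePolygon V) : (1 : Fin N) ≠ 0 := by
  have := hV.three_le
  intro h
  have := congrArg Fin.val h
  rw [Fin.val_one', Fin.val_zero, Nat.mod_eq_of_lt (by omega)] at this
  omega

theorem two_ne_zero (hV : IsConvexLatticePolygon V) : (1 + 1 : Fin N) ≠ 0 := by
  have := hV.three_le
  intro h
  have := congrArg Fin.val h
  rw [Fin.val_add, Fin.val_one', Fin.val_zero, Nat.mod_eq_of_lt (a := 1) (by omega),
    Nat.mod_eq_of_lt (by omega)] at this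
  omega

theorem succ_ne (hV : IsConvexLatticePolygon V) (i : Fin N) : i + 1 ≠ i := by
  simpa using hV.one_ne_zero

theorem succ_ne_pred (hV : IsConvexLatticePolygon V) (i : Fin N) : i + 1 ≠ i - 1 := by
  intro h
  apply hV.two_ne_zero
  have h' := congrArg (fun x => x - i + 1) h
  simpa [sub_eq_add_neg, add_comm, add_left_comm, add_assoc] using h'

theorem crs_nonneg (hV : IsConvexLatticePolygon V) (i j : Fin N) :
    0 ≤ crs (edge V i) (V j - V i) := by
  by_cases h1 : j = i
  · subst h1; simp [crs]
  by_cases h2 : j = i + 1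
  · subst h2; simp only [crs, edge]; apply le_of_eq; ring
  exact (hV.crs_pos h1 h2).le

theorem inside_vertex (hV : IsConvexLatticePolygon V) (j : Fin N) : Inside V (V j) :=
  fun i => hV.crs_nonneg i j

theorem eq_of_crs_eq_zero (hV : IsConvexLatticePolygon V) {i j : Fin N}
    (h : crs (edge V i) (V j - V i) = 0) : j = i ∨ j = i + 1 := by
  by_contra! hc
  exact (hV.crs_pos hc.1 hc.2).ne' h

/-- Consecutive edges turn to the left. -/
theorem turn_pos (hV : IsConvexLatticePolygon V) (i : Fin N) :
    0 < crs (edge V (i - 1)) (edge V i) := by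
  have h := hV.crs_pos (hV.succ_ne_pred i) (j := i + 1) (i := i - 1)
    (by simpa using hV.succ_ne i)
  have e : crs (edge V (i - 1)) (edge V i) = crs (edge V (i - 1)) (V (i + 1) - V (i - 1)) := by
    rw [edge_pred, edge]; simp only [crs, Pi.sub_apply]; ring
  rwa [e]

theorem side_vertex_nonneg (hV : IsConvexLatticePolygon V) (i j : Fin N) :
    0 ≤ side V i (V j 0) (V j 1) := by
  rw [side_lattice]; exact_mod_cast hV.crs_nonneg i j

theorem edge_ne_zero (hV : IsConvexLatticePolygon V) (i : Fin N) : edge V i ≠ 0 := by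
  intro h
  have := hV.turn_pos i
  simp [h, crs] at this

end IsConvexLatticePolygon

/-- Expansion of `x - V i` in the two edges at the vertex `V i`, evaluated on a linear functional:
the coefficients are, up to the positive factor on the left, the distances to the two edge
lines. -/
theorem turn_mul_lin (V : Fin N → Lat) (i : Fin N) (p q x y : ℝ) :
    (crs (edge V (i - 1)) (edge V i) : ℝ) * (p * (x - V i 0) + q * (y - V i 1)) =
      side V (i - 1) x y * lin p q (edge V i) - side V i x y * lin p q (edge V (i - 1)) := by
  rw [edge_pred]
  simp only [side, crs, lin, edge, Pi.sub_apply, sub_add_cancel]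
  push_cast; ring

/-- A vertex at which the functional does not decrease along the outgoing edge or against the
incoming one is a minimum on the intersection of the half-planes. -/
theorem lin_vertex_le (hV : IsConvexLatticePolygon V) {i : Fin N} {p q : ℝ}
    (h1 : lin p q (edge V (i - 1)) ≤ 0) (h2 : 0 ≤ lin p q (edge V i)) {x y : ℝ}
    (hxy : ∀ j, 0 ≤ side V j x y) : lin p q (V i) ≤ p * x + q * y := by
  have hD : (0 : ℝ) < crs (edge V (i - 1)) (edge V i) := by exact_mod_cast hV.turn_pos i
  have h := turn_mul_lin V i p q x y
  have h3 := mul_nonneg (hxy (i - 1)) h2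
  have h4 := mul_nonneg (hxy i) (neg_nonneg.2 h1)
  have h5 : 0 ≤ p * (x - V i 0) + q * (y - V i 1) := by
    by_contra! hc
    nlinarith
  simp only [lin]; linarith

theorem lin_edge (p q : ℝ) (V : Fin N → Lat) (i : Fin N) :
    lin p q (edge V i) = lin p q (V (i + 1)) - lin p q (V i) := by
  simp only [lin, edge, Pi.sub_apply]; push_cast; ring

/-- Cyclic induction on `Fin N`. -/
theorem cyclic_induction {P : Fin N → Prop} {i₀ : Fin N} (h0 : P i₀)
    (hs : ∀ i, P i → P (i + 1)) (i : Fin N) : P i := by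
  have key : ∀ n : ℕ, P (i₀ + Fin.ofNat N n) := by
    intro n
    induction n with
    | zero =>
      have : Fin.ofNat N 0 = 0 := rfl
      simpa [this] using h0
    | succ n ih =>
      have : Fin.ofNat N (n + 1) = Fin.ofNat N n + 1 := by
        ext; simp [Fin.val_add]
      rw [this, ← add_assoc]
      exact hs _ ih
  have h := key (i - i₀).val
  rw [Fin.ofNat_val_eq_self] at h
  simpa using h

theorem exists_min_lin (V : Fin N → Lat) (p q : ℝ) : ∃ i, ∀ j, lin p q (V i) ≤ lin p q (V j) :=
  Finite.exists_min fun i => lin p q (V i)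

/-- Exactly one vertex is entered by a strictly decreasing edge and left by a nondecreasing
one. -/
theorem existsUnique_lower (hV : IsConvexLatticePolygon V) {p q : ℝ} (hpq : p ≠ 0 ∨ q ≠ 0) :
    ∃! i, lin p q (edge V (i - 1)) < 0 ∧ 0 ≤ lin p q (edge V i) := by
  obtain ⟨i₀, hi₀⟩ := exists_min_lin V p q
  have hex : ∃ i, lin p q (edge V (i - 1)) < 0 ∧ 0 ≤ lin p q (edge V i) := by
    by_contra! hc
    -- otherwise the functional is minimal at every vertex, going backwards from `i₀`
    have hall : ∀ i : Fin N, lin p q (V (-i)) = lin p q (V i₀) := by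
      intro i
      refine cyclic_induction (P := fun i => lin p q (V (-i)) = lin p q (V i₀))
        (i₀ := -i₀) (by simp) ?_ i
      intro i hi
      have h1 := hc (-i)
      rw [lin_edge, lin_edge, sub_add_cancel] at h1
      have h2 := hi₀ (-i + 1)
      have h3 := hi₀ (-i - 1)
      have e : -(i + 1) = -i - 1 := by abel
      rw [e]
      by_contra hne
      have := h1 (by rw [hi]; exact sub_neg.2 (lt_of_le_of_ne h3 (Ne.symm hne)))
      linarith
    have hz : ∀ i, lin p q (edge V i) = 0 := by
      intro i
      have h1 := hall (-i)
      have h2 := hall (-(i + 1))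
      rw [neg_neg] at h1 h2
      rw [lin_edge, h1, h2, sub_self]
    have hD : (0 : ℝ) < crs (edge V (i₀ - 1)) (edge V i₀) := by exact_mod_cast hV.turn_pos i₀
    have e1 := hz (i₀ - 1)
    have e2 := hz i₀
    simp only [lin, crs] at e1 e2 hD
    push_cast at hD
    rcases hpq with h | h
    · apply hD.ne'
      apply mul_left_cancel₀ h
      linear_combination (edge V i₀ 1 : ℝ) * e1 - (edge V (i₀ - 1) 1 : ℝ) * e2
    · apply hD.ne'
      apply mul_left_cancel₀ h
      linear_combination (edge V (i₀ - 1) 0 : ℝ) * e2 - (edge V i₀ 0 : ℝ) * e1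
  obtain ⟨i, hi⟩ := hex
  refine ⟨i, hi, ?_⟩
  intro k hk
  by_contra hne
  have hi_min := lin_vertex_le hV hi.1.le hi.2 (fun j => hV.side_vertex_nonneg j k)
  have hk_min := lin_vertex_le hV hk.1.le hk.2 (fun j => hV.side_vertex_nonneg j i)
  have heq : lin p q (V k) = lin p q (V i) := by simp only [lin] at *; linarith
  have h := turn_mul_lin V i p q (V k 0) (V k 1)
  have h0 : p * ((V k 0 : ℝ) - V i 0) + q * (V k 1 - V i 1) = 0 := by
    simp only [lin] at heq; linarith
  rw [h0, mul_zero] at h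
  have h3 := mul_nonneg (hV.side_vertex_nonneg (i - 1) k) hi.2
  have h4 := hV.side_vertex_nonneg i k
  have h5 : side V i (V k 0) (V k 1) = 0 := by
    rcases h4.eq_or_lt with h4 | h4
    · exact h4.symm
    · have := mul_neg_of_pos_of_neg h4 hi.1
      linarith
  rw [side_lattice] at h5
  rcases hV.eq_of_crs_eq_zero (by exact_mod_cast h5) with h6 | h6
  · exact hne h6
  · have h7 := hk.1
    rw [h6, add_sub_cancel_right] at h7
    linarith [hi.2]

/-- Exactly one vertex is entered by a nondecreasing edge and left by a strictly decreasing
one. -/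
theorem existsUnique_upper (hV : IsConvexLatticePolygon V) {p q : ℝ} (hpq : p ≠ 0 ∨ q ≠ 0) :
    ∃! i, 0 ≤ lin p q (edge V (i - 1)) ∧ lin p q (edge V i) < 0 := by
  classical
  -- the numbers of sign changes of the two kinds agree
  set A : Finset (Fin N) :=
    Finset.univ.filter fun i => lin p q (edge V (i - 1)) < 0 ∧ 0 ≤ lin p q (edge V i) with hA
  set B : Finset (Fin N) :=
    Finset.univ.filter fun i => 0 ≤ lin p q (edge V (i - 1)) ∧ lin p q (edge V i) < 0 with hB
  have hA1 : A.card = 1 := by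
    rw [Finset.card_eq_one]
    obtain ⟨i, hi, hu⟩ := existsUnique_lower hV hpq
    refine ⟨i, ?_⟩
    ext j
    simp only [hA, Finset.mem_filter, Finset.mem_univ, true_and, Finset.mem_singleton]
    exact ⟨hu j, fun h => h ▸ hi⟩
  have hAB : (A.card : ℤ) = B.card := by
    rw [hA, hB, Finset.card_filter, Finset.card_filter]
    push_cast
    rw [← sub_eq_zero, ← Finset.sum_sub_distrib]
    have : ∀ i : Fin N,
        ((if lin p q (edge V (i - 1)) < 0 ∧ 0 ≤ lin p q (edge V i) then (1 : ℤ) else 0) -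
          if 0 ≤ lin p q (edge V (i - 1)) ∧ lin p q (edge V i) < 0 then 1 else 0) =
        (if 0 ≤ lin p q (edge V i) then (1 : ℤ) else 0) -
          (if 0 ≤ lin p q (edge V (i - 1)) then 1 else 0) := by
      intro i
      by_cases h1 : 0 ≤ lin p q (edge V (i - 1)) <;> by_cases h2 : 0 ≤ lin p q (edge V i) <;>
        simp [h1, h2, not_lt.2, lt_of_not_ge]
    rw [Finset.sum_congr rfl fun i _ => this i, Finset.sum_sub_distrib, sub_eq_zero]
    exact (Equiv.sum_comp (Equiv.subRight (1 : Fin N))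
      fun i => if 0 ≤ lin p q (edge V i) then (1 : ℤ) else 0).symm
  have hB1 : B.card = 1 := by omega
  rw [Finset.card_eq_one] at hB1
  obtain ⟨i, hi⟩ := hB1
  have hmem : ∀ j, (0 ≤ lin p q (edge V (j - 1)) ∧ lin p q (edge V j) < 0) ↔ j = i := by
    intro j
    have : j ∈ B ↔ j = i := by rw [hi, Finset.mem_singleton]
    rw [← this, hB]; simp
  exact ⟨i, (hmem i).2 rfl, fun j hj => (hmem j).1 hj⟩

end Polygon

/-! ### Columns of a lattice polygon -/

section Columns

variable {N : ℕ} [NeZero N] {V : Fin N → Lat}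

theorem edge_mul_crs (V : Fin N → Lat) (i k : Fin N) (x : Lat) :
    edge V i 0 * crs (edge V k) (x - V k) =
      crs (edge V k) (V i - V k) * (V (i + 1) 0 - x 0) +
        crs (edge V k) (V (i + 1) - V k) * (x 0 - V i 0) +
        edge V k 0 * crs (edge V i) (x - V i) := by
  simp only [crs, edge, Pi.sub_apply]; ring

theorem edge_zero (V : Fin N → Lat) (i : Fin N) : edge V i 0 = V (i + 1) 0 - V i 0 := rfl

/-- A cyclic sequence of integers that starts at most `a` and exceeds `a` somewhere crosses `a`
upwards. -/
theorem exists_up {a : ℤ} (h1 : ∃ i, V i 0 ≤ a) (h2 : ∃ i, a < V i 0) :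
    ∃ i, a ∈ Finset.Ico (V i 0) (V (i + 1) 0) := by
  by_contra! hc
  obtain ⟨i, hi⟩ := h1
  obtain ⟨j, hj⟩ := h2
  refine absurd (cyclic_induction (P := fun i => V i 0 ≤ a) hi ?_ j) (not_le.2 hj)
  intro k hk
  by_contra hk'
  exact hc k (Finset.mem_Ico.2 ⟨hk, not_le.1 hk'⟩)

theorem exists_down {a : ℤ} (h1 : ∃ i, V i 0 ≤ a) (h2 : ∃ i, a < V i 0) :
    ∃ i, a ∈ Finset.Ico (V (i + 1) 0) (V i 0) := by
  by_contra! hc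
  obtain ⟨i, hi⟩ := h1
  obtain ⟨j, hj⟩ := h2
  refine absurd (cyclic_induction (P := fun i => a < V i 0) hj ?_ i) (not_lt.2 hi)
  intro k hk
  by_contra hk'
  exact hc k (Finset.mem_Ico.2 ⟨not_lt.1 hk', hk⟩)

theorem up_unique (hV : IsConvexLatticePolygon V) {a : ℤ} {i k : Fin N}
    (hi : a ∈ Finset.Ico (V i 0) (V (i + 1) 0)) (hk : a ∈ Finset.Ico (V k 0) (V (k + 1) 0)) :
    i = k := by
  rw [Finset.mem_Ico] at hi hk
  have e1 := edge_mul_crs V i k ![a, 0]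
  have e2 := edge_mul_crs V k i ![a, 0]
  simp only [Matrix.cons_val_zero] at e1 e2
  have a1 := mul_nonneg (hV.crs_nonneg k i) (sub_nonneg.2 hi.2.le)
  have a2 := mul_nonneg (hV.crs_nonneg k (i + 1)) (sub_nonneg.2 hi.1)
  have b1 := mul_nonneg (hV.crs_nonneg i k) (sub_nonneg.2 hk.2.le)
  have b2 := mul_nonneg (hV.crs_nonneg i (k + 1)) (sub_nonneg.2 hk.1)
  have c1 : crs (edge V k) (V i - V k) = 0 :=
    (mul_eq_zero.1 (by linarith)).resolve_right (sub_pos.2 hi.2).ne'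
  have c2 : crs (edge V i) (V k - V i) = 0 :=
    (mul_eq_zero.1 (by linarith)).resolve_right (sub_pos.2 hk.2).ne'
  rcases hV.eq_of_crs_eq_zero c1 with h | h
  · exact h
  rcases hV.eq_of_crs_eq_zero c2 with h' | h'
  · exact h'.symm
  · exfalso
    apply hV.two_ne_zero
    rw [h', add_assoc] at h
    simpa using h

theorem down_unique (hV : IsConvexLatticePolygon V) {a : ℤ} {i k : Fin N}
    (hi : a ∈ Finset.Ico (V (i + 1) 0) (V i 0)) (hk : a ∈ Finset.Ico (V (k + 1) 0) (V k 0)) :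
    i = k := by
  rw [Finset.mem_Ico] at hi hk
  have e1 := edge_mul_crs V i k ![a, 0]
  have e2 := edge_mul_crs V k i ![a, 0]
  simp only [Matrix.cons_val_zero] at e1 e2
  have a1 := mul_nonneg (hV.crs_nonneg k i) (sub_nonneg.2 hi.1)
  have a2 := mul_nonneg (hV.crs_nonneg k (i + 1)) (sub_nonneg.2 hi.2.le)
  have b1 := mul_nonneg (hV.crs_nonneg i k) (sub_nonneg.2 hk.1)
  have b2 := mul_nonneg (hV.crs_nonneg i (k + 1)) (sub_nonneg.2 hk.2.le)
  have c1 : crs (edge V k) (V (i + 1) - V k) = 0 :=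
    (mul_eq_zero.1 (by linarith)).resolve_right (sub_pos.2 hi.2).ne'
  have c2 : crs (edge V i) (V (k + 1) - V i) = 0 :=
    (mul_eq_zero.1 (by linarith)).resolve_right (sub_pos.2 hk.2).ne'
  rcases hV.eq_of_crs_eq_zero c1 with h | h
  · rcases hV.eq_of_crs_eq_zero c2 with h' | h'
    · exfalso
      apply hV.two_ne_zero
      rw [← h, add_assoc] at h'
      simpa using h'
    · exact (add_right_cancel h').symm
  · exact add_right_cancel h

theorem inside_iff_of_column (hV : IsConvexLatticePolygon V) {i j : Fin N} {x : Lat}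
    (hi : V i 0 < V (i + 1) 0) (hj : V (j + 1) 0 < V j 0)
    (hxi : x 0 ∈ Finset.Icc (V i 0) (V (i + 1) 0))
    (hxj : x 0 ∈ Finset.Icc (V (j + 1) 0) (V j 0)) :
    Inside V x ↔ 0 ≤ crs (edge V i) (x - V i) ∧ 0 ≤ crs (edge V j) (x - V j) := by
  rw [Finset.mem_Icc] at hxi hxj
  refine ⟨fun h => ⟨h i, h j⟩, fun ⟨h1, h2⟩ k => ?_⟩
  rcases le_total 0 (edge V k 0) with hk | hk
  · have e := edge_mul_crs V i k x
    have a1 := mul_nonneg (hV.crs_nonneg k i) (sub_nonneg.2 hxi.2)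
    have a2 := mul_nonneg (hV.crs_nonneg k (i + 1)) (sub_nonneg.2 hxi.1)
    have a3 := mul_nonneg hk h1
    have : 0 < edge V i 0 := sub_pos.2 hi
    by_contra! hc
    have := mul_neg_of_pos_of_neg this hc
    linarith
  · have e := edge_mul_crs V j k x
    have a1 := mul_nonneg (hV.crs_nonneg k j) (sub_nonneg.2 hxj.1)
    have a2 := mul_nonneg (hV.crs_nonneg k (j + 1)) (sub_nonneg.2 hxj.2)
    have a3 := mul_nonneg (neg_nonneg.2 hk) h2
    have : edge V j 0 < 0 := sub_neg.2 hj
    by_contra! hc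
    have := mul_pos_of_neg_of_neg this hc
    linarith

/-- The ordinates of the lattice points of the polygon in the column of abscissa `a`. -/
def column (V : Fin N → Lat) (a : ℤ) : Set ℤ := {b | Inside V ![a, b]}

/-- The ordinate of the lowest lattice point of the column `a` above an edge running to the
right. -/
def colBot (V : Fin N → Lat) (i : Fin N) (a : ℤ) : ℤ :=
  V i 1 - (-edge V i 1 * (a - V i 0)) / edge V i 0

/-- The ordinate of the highest lattice point of the column `a` below an edge running to the
left. -/
def colTop (V : Fin N → Lat) (j : Fin N) (a : ℤ) : ℤ :=
  V (j + 1) 1 + (-edge V j 1 * (a - V (j + 1) 0)) / (-edge V j 0)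

theorem colBot_le_iff {i : Fin N} {a b : ℤ} (hi : V i 0 < V (i + 1) 0) :
    colBot V i a ≤ b ↔ 0 ≤ crs (edge V i) (![a, b] - V i) := by
  have h : 0 < edge V i 0 := sub_pos.2 hi
  have h1 : colBot V i a ≤ b ↔ V i 1 - b ≤ (-edge V i 1 * (a - V i 0)) / edge V i 0 := by
    rw [colBot, sub_le_comm]
  rw [h1, Int.le_ediv_iff_mul_le h]
  simp only [crs, Pi.sub_apply, Matrix.cons_val_zero, Matrix.cons_val_one]
  constructor <;> intro h <;> linarith

theorem le_colTop_iff {j : Fin N} {a b : ℤ} (hj : V (j + 1) 0 < V j 0) :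
    b ≤ colTop V j a ↔ 0 ≤ crs (edge V j) (![a, b] - V j) := by
  have h : 0 < -edge V j 0 := neg_pos.2 (sub_neg.2 hj)
  have h1 : b ≤ colTop V j a ↔
      b - V (j + 1) 1 ≤ (-edge V j 1 * (a - V (j + 1) 0)) / (-edge V j 0) := by
    rw [colTop, sub_le_iff_le_add']
  rw [h1, Int.le_ediv_iff_mul_le h]
  simp only [crs, Pi.sub_apply, Matrix.cons_val_zero, Matrix.cons_val_one, edge]
  constructor <;> intro h <;> linarith

theorem column_eq (hV : IsConvexLatticePolygon V) {i j : Fin N} {a : ℤ}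
    (hi : V i 0 < V (i + 1) 0) (hj : V (j + 1) 0 < V j 0)
    (hxi : a ∈ Finset.Icc (V i 0) (V (i + 1) 0)) (hxj : a ∈ Finset.Icc (V (j + 1) 0) (V j 0)) :
    column V a = Set.Icc (colBot V i a) (colTop V j a) := by
  ext b
  rw [column, Set.mem_ofPred_eq, Set.mem_Icc, colBot_le_iff hi, le_colTop_iff hj,
    inside_iff_of_column hV hi hj (by simpa using hxi) (by simpa using hxj)]

theorem colBot_le_colTop_add_one (hV : IsConvexLatticePolygon V) {i j : Fin N} {a : ℤ}
    (hi : V i 0 < V (i + 1) 0) (hj : V (j + 1) 0 < V j 0)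
    (hxi : a ∈ Finset.Icc (V i 0) (V (i + 1) 0)) :
    colBot V i a ≤ colTop V j a + 1 := by
  by_contra hc
  rw [Finset.mem_Icc] at hxi
  have h1 : crs (edge V i) (![a, colTop V j a + 1] - V i) < 0 := by
    rw [← not_le, ← colBot_le_iff hi]; exact hc
  have h2 : crs (edge V j) (![a, colTop V j a + 1] - V j) < 0 := by
    rw [← not_le, ← le_colTop_iff hj]; omega
  have e := edge_mul_crs V i j ![a, colTop V j a + 1]
  simp only [Matrix.cons_val_zero] at e
  have a1 := mul_nonneg (hV.crs_nonneg j i) (sub_nonneg.2 hxi.2)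
  have a2 := mul_nonneg (hV.crs_nonneg j (i + 1)) (sub_nonneg.2 hxi.1)
  have a3 := mul_pos_of_neg_of_neg (show edge V j 0 < 0 from sub_neg.2 hj) h1
  have a4 := mul_neg_of_pos_of_neg (show 0 < edge V i 0 from sub_pos.2 hi) h2
  linarith

/-- The number of lattice points in the column of abscissa `a`. -/
def colCount (V : Fin N → Lat) (a : ℤ) : ℕ := (column V a).ncard

theorem ncard_Icc_int (l u : ℤ) : (Set.Icc l u).ncard = (u + 1 - l).toNat := by
  rw [← Finset.coe_Icc, Set.ncard_coe_finset, Int.card_Icc]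

theorem colCount_eq (hV : IsConvexLatticePolygon V) {i j : Fin N} {a : ℤ}
    (hi : V i 0 < V (i + 1) 0) (hj : V (j + 1) 0 < V j 0)
    (hxi : a ∈ Finset.Icc (V i 0) (V (i + 1) 0)) (hxj : a ∈ Finset.Icc (V (j + 1) 0) (V j 0)) :
    (colCount V a : ℤ) = colTop V j a + 1 - colBot V i a := by
  rw [colCount, column_eq hV hi hj hxi hxj, ncard_Icc_int, Int.toNat_of_nonneg]
  have := colBot_le_colTop_add_one hV hi hj hxi
  omega

theorem inside_side {x : Lat} (h : Inside V x) (i : Fin N) : 0 ≤ side V i (x 0) (x 1) := by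
  rw [side_lattice]; exact_mod_cast h i

theorem exists_lin_le (hV : IsConvexLatticePolygon V) (p q : ℝ) {x y : ℝ}
    (h : ∀ i, 0 ≤ side V i x y) : ∃ i, lin p q (V i) ≤ p * x + q * y := by
  by_cases hpq : p ≠ 0 ∨ q ≠ 0
  · obtain ⟨i, hi, -⟩ := existsUnique_lower hV hpq
    exact ⟨i, lin_vertex_le hV hi.1.le hi.2 h⟩
  · push Not at hpq
    exact ⟨0, by simp [lin, hpq.1, hpq.2]⟩

theorem exists_le_abscissa (hV : IsConvexLatticePolygon V) {x : Lat} (h : Inside V x) :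
    ∃ i, V i 0 ≤ x 0 := by
  obtain ⟨i, hi⟩ := exists_lin_le hV 1 0 (inside_side h)
  exact ⟨i, by simpa [lin] using hi⟩

theorem exists_abscissa_le (hV : IsConvexLatticePolygon V) {x : Lat} (h : Inside V x) :
    ∃ i, x 0 ≤ V i 0 := by
  obtain ⟨i, hi⟩ := exists_lin_le hV (-1) 0 (inside_side h)
  exact ⟨i, by simpa [lin] using hi⟩

theorem inside_finite (hV : IsConvexLatticePolygon V) : {x | Inside V x}.Finite := by
  obtain ⟨m, hm⟩ : ∃ m : ℤ, ∀ i k, |V i k| ≤ m := by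
    obtain ⟨p, hp⟩ := Finite.exists_max fun p : Fin N × Fin 2 => |V p.1 p.2|
    exact ⟨_, fun i k => hp (i, k)⟩
  refine (Set.finite_Icc (fun _ : Fin 2 => -m) (fun _ => m)).subset fun x hx => ?_
  have b0 := fun i => abs_le.1 (hm i 0)
  have b1 := fun i => abs_le.1 (hm i 1)
  obtain ⟨i, hi⟩ := exists_le_abscissa hV hx
  obtain ⟨j, hj⟩ := exists_abscissa_le hV hx
  obtain ⟨k, hk⟩ := exists_lin_le hV 0 1 (inside_side hx)
  obtain ⟨l, hl⟩ := exists_lin_le hV 0 (-1) (inside_side hx)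
  have hk' : V k 1 ≤ x 1 := by simpa [lin] using hk
  have hl' : x 1 ≤ V l 1 := by simpa [lin] using hl
  have := b0 i; have := b0 j; have := b1 k; have := b1 l
  constructor <;> intro t <;> fin_cases t <;> simp only [Fin.zero_eta, Fin.mk_one] <;> omega

theorem column_finite (hV : IsConvexLatticePolygon V) (a : ℤ) : (column V a).Finite := by
  refine Set.Finite.preimage (f := fun b : ℤ => (![a, b] : Lat)) ?_ (inside_finite hV)
  intro b _ c _ h
  simpa using congrFun h 1

/-- Counting the points of a finite planar set column by column. -/
theorem ncard_eq_sum_column {S : Set Lat} (hS : S.Finite) {A : Finset ℤ}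
    (hA : ∀ x ∈ S, x 0 ∈ A) : S.ncard = ∑ a ∈ A, {b : ℤ | ![a, b] ∈ S}.ncard := by
  classical
  rw [Set.ncard_eq_toFinset_card S hS,
    Finset.card_eq_sum_card_fiberwise (f := fun x : Lat => x 0) (t := A)
      (fun x hx => hA x (by simpa using hx))]
  refine Finset.sum_congr rfl fun a _ => ?_
  rw [← Set.ncard_coe_finset]
  have : ((hS.toFinset.filter fun x : Lat => x 0 = a : Finset Lat) : Set Lat) =
      (fun b : ℤ => (![a, b] : Lat)) '' {b : ℤ | ![a, b] ∈ S} := by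
    ext x
    simp only [Finset.coe_filter, Set.Finite.mem_toFinset, Set.mem_ofPred_eq, Set.mem_image]
    constructor
    · rintro ⟨h1, h2⟩
      have hx : ![a, x 1] = x := by
        ext t; fin_cases t <;> simp [h2]
      exact ⟨x 1, by rwa [hx], hx⟩
    · rintro ⟨b, hb, rfl⟩
      exact ⟨hb, rfl⟩
  rw [this, Set.ncard_image_of_injective]
  intro b c h
  simpa using congrFun h 1

theorem sum_existsUnique {ι : Type*} [Fintype ι] [DecidableEq ι] {S : Finset ℤ}
    {T : ι → Finset ℤ} (hT : ∀ i, T i ⊆ S) (F : ι → ℤ → ℤ) {f : ℤ → ℤ}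
    (hf : ∀ a ∈ S, ∃ i, a ∈ T i ∧ f a = F i a ∧ ∀ k, a ∈ T k → k = i) :
    ∑ a ∈ S, f a = ∑ i, ∑ a ∈ T i, F i a := by
  have h1 : ∀ i, ∑ a ∈ T i, F i a = ∑ a ∈ S, if a ∈ T i then F i a else 0 := by
    intro i
    rw [← Finset.sum_filter, Finset.filter_mem_eq_inter, Finset.inter_eq_right.2 (hT i)]
  rw [Finset.sum_congr rfl fun i _ => h1 i, Finset.sum_comm]
  refine Finset.sum_congr rfl fun a ha => ?_
  obtain ⟨i, hi, hfi, hu⟩ := hf a ha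
  rw [Finset.sum_eq_single i, if_pos hi, hfi]
  · intro k _ hk
    rw [if_neg fun h => hk (hu k h)]
  · simp

/-- Twice the width of a polygon is the total variation of the abscissa along its boundary. -/
theorem two_mul_width (hV : IsConvexLatticePolygon V) {l r : Fin N}
    (hl : ∀ i, V l 0 ≤ V i 0) (hr : ∀ i, V i 0 ≤ V r 0) :
    2 * (V r 0 - V l 0) = ∑ i, |edge V i 0| := by
  have hup : ∑ a ∈ Finset.Ico (V l 0) (V r 0), (1 : ℤ) =
      ∑ i, ∑ a ∈ Finset.Ico (V i 0) (V (i + 1) 0), (1 : ℤ) := by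
    refine sum_existsUnique (F := fun _ _ => 1)
      (fun i => Finset.Ico_subset_Ico (hl i) (hr (i + 1))) fun a ha => ?_
    rw [Finset.mem_Ico] at ha
    obtain ⟨i, hi⟩ := exists_up ⟨l, ha.1⟩ ⟨r, ha.2⟩
    exact ⟨i, hi, rfl, fun k hk => up_unique hV hk hi⟩
  have hdown : ∑ a ∈ Finset.Ico (V l 0) (V r 0), (1 : ℤ) =
      ∑ i, ∑ a ∈ Finset.Ico (V (i + 1) 0) (V i 0), (1 : ℤ) := by
    refine sum_existsUnique (F := fun _ _ => 1)
      (fun i => Finset.Ico_subset_Ico (hl (i + 1)) (hr i)) fun a ha => ?_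
    rw [Finset.mem_Ico] at ha
    obtain ⟨i, hi⟩ := exists_down ⟨l, ha.1⟩ ⟨r, ha.2⟩
    exact ⟨i, hi, rfl, fun k hk => down_unique hV hk hi⟩
  have h0 : ∑ a ∈ Finset.Ico (V l 0) (V r 0), (1 : ℤ) = V r 0 - V l 0 := by
    simp [hr l]
  have h1 : 2 * (V r 0 - V l 0) = ∑ i, (((V (i + 1) 0 - V i 0).toNat : ℤ) +
      ((V i 0 - V (i + 1) 0).toNat : ℤ)) := by
    rw [Finset.sum_add_distrib, two_mul]
    nth_rewrite 1 [← h0]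
    rw [← h0, hup]
    congr 1
    · simp
    · rw [← hup, hdown]; simp
  rw [h1]
  refine Finset.sum_congr rfl fun i _ => ?_
  rw [edge_zero, Int.toNat_eq_max, Int.toNat_eq_max]
  rcases le_total (V (i + 1) 0) (V i 0) with h | h
  · rw [abs_of_nonpos (by omega)]; omega
  · rw [abs_of_nonneg (by omega)]; omega

end Columns

/-! ### Pick's theorem -/

theorem ediv_add_neg_ediv {M : ℤ} (hM : 0 < M) (x : ℤ) :
    x / M + (-x) / M = if M ∣ x then 0 else -1 := by
  split_ifs with h
  · rw [Int.neg_ediv_of_dvd h]; ring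
  · have h1 := Int.emod_add_mul_ediv x M
    have h2 := Int.emod_nonneg x hM.ne'
    have h3 := Int.emod_lt_of_pos x hM
    have h4 : x % M ≠ 0 := fun h' => h (Int.dvd_of_emod_eq_zero h')
    have h5 : (-x) / M = -(x / M) - 1 := by
      rw [Int.ediv_eq_iff_of_pos hM]
      constructor
      · nlinarith [lt_of_le_of_ne h2 h4.symm]
      · nlinarith [lt_of_le_of_ne h2 h4.symm]
    rw [h5]; ring

theorem card_dvd_mul {M : ℕ} (hM : 0 < M) (p : ℤ) :
    ((Finset.range M).filter fun t : ℕ => (M : ℤ) ∣ t * p).card = Int.gcd M p := by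
  set g := Int.gcd M p with hg
  have hg0 : 0 < g := Int.gcd_pos_of_ne_zero_left _ (by exact_mod_cast hM.ne')
  obtain ⟨M', hM'⟩ : g ∣ M := by
    have := Int.gcd_dvd_left (M : ℤ) p
    exact_mod_cast this
  obtain ⟨p', hp'⟩ : (g : ℤ) ∣ p := Int.gcd_dvd_right (M : ℤ) p
  have hM'0 : 0 < M' := Nat.pos_of_ne_zero (by rintro rfl; omega)
  have hcop : IsCoprime (M' : ℤ) p' := by
    rw [Int.isCoprime_iff_gcd_eq_one]
    have h1 : Int.gcd ((g : ℤ) * M') ((g : ℤ) * p') = g * Int.gcd M' p' := by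
      rw [Int.gcd_mul_left, Int.natAbs_natCast]
    have h2 : Int.gcd ((g : ℤ) * M') ((g : ℤ) * p') = g := by
      rw [← hp', ← Nat.cast_mul, ← hM']
    rw [h2] at h1
    exact Nat.eq_of_mul_eq_mul_left hg0 (by rw [← h1, mul_one])
  have hdvd : ∀ t : ℕ, (M : ℤ) ∣ t * p ↔ M' ∣ t := by
    intro t
    rw [hM', hp', ← Int.natCast_dvd_natCast]
    push_cast
    rw [show (t : ℤ) * (g * p') = g * (t * p') by ring,
      mul_dvd_mul_iff_left (by exact_mod_cast hg0.ne')]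
    exact ⟨fun h => hcop.dvd_of_dvd_mul_right h, fun h => Dvd.dvd.mul_right h _⟩
  have himg : (Finset.range M).filter (fun t : ℕ => (M : ℤ) ∣ t * p) =
      (Finset.range g).image (· * M') := by
    ext t
    simp only [Finset.mem_filter, Finset.mem_range, hdvd, Finset.mem_image]
    constructor
    · rintro ⟨h1, s, rfl⟩
      refine ⟨s, ?_, by ring⟩
      rw [hM', mul_comm g] at h1
      exact lt_of_mul_lt_mul_left h1 hM'0.le
    · rintro ⟨s, hs, rfl⟩
      refine ⟨?_, Dvd.intro_left s rfl⟩
      calc s * M' < g * M' := Nat.mul_lt_mul_of_pos_right hs hM'0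
        _ = M := hM'.symm
  rw [himg, Finset.card_image_of_injective _ (fun a b h => Nat.eq_of_mul_eq_mul_right hM'0 h),
    Finset.card_range]

/-- The sum of the integer parts of the multiples of a fraction over one period, by pairing `t`
with `M - t`. -/
theorem two_mul_sum_floor {M : ℕ} (hM : 0 < M) (p : ℤ) :
    2 * ∑ t ∈ Finset.range M, ((t : ℤ) * p) / M = (M - 1) * p - M + Int.gcd M p := by
  have hM' : (0 : ℤ) < M := by exact_mod_cast hM
  have h1 : ∑ t ∈ Finset.range M, (((t : ℤ) * p) / M + (-((t : ℤ) * p)) / M) =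
      Int.gcd M p - M := by
    rw [Finset.sum_congr rfl fun (t : ℕ) _ => ediv_add_neg_ediv hM' ((t : ℤ) * p),
      ← card_dvd_mul hM p, Finset.card_filter]
    push_cast
    have : ∀ t : ℕ, (if (M : ℤ) ∣ t * p then (0 : ℤ) else -1) =
        (if (M : ℤ) ∣ t * p then 1 else 0) - 1 := by
      intro t; split_ifs <;> ring
    rw [Finset.sum_congr rfl fun t _ => this t, Finset.sum_sub_distrib]
    simp
  have h2 : ∑ t ∈ Finset.range M, (-((t : ℤ) * p)) / M =
      ∑ t ∈ Finset.range M, ((t : ℤ) * p) / M - (M - 1) * p := by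
    obtain ⟨m, rfl⟩ : ∃ m, M = m + 1 := ⟨M - 1, by omega⟩
    rw [Finset.sum_range_succ', Finset.sum_range_succ']
    rw [← Finset.sum_range_reflect]
    have : ∀ j ∈ Finset.range m, (-(((m - 1 - j + 1 : ℕ) : ℤ) * p)) / ((m + 1 : ℕ) : ℤ) =
        (((j + 1 : ℕ) : ℤ) * p) / ((m + 1 : ℕ) : ℤ) - p := by
      intro j hj
      rw [Finset.mem_range] at hj
      have e : (-(((m - 1 - j + 1 : ℕ) : ℤ) * p)) =
          ((j + 1 : ℕ) : ℤ) * p + ((m + 1 : ℕ) : ℤ) * (-p) := by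
        have : ((m - 1 - j + 1 : ℕ) : ℤ) = (m : ℤ) - j := by omega
        rw [this]; push_cast; ring
      rw [e, Int.add_mul_ediv_left _ _ hM'.ne']; ring
    rw [Finset.sum_congr rfl this, Finset.sum_sub_distrib]
    simp
  rw [Finset.sum_add_distrib, h2] at h1
  linarith

theorem sum_Ico_eq_sum_range (f : ℤ → ℤ) {x y : ℤ} (h : x ≤ y) :
    ∑ a ∈ Finset.Ico x y, f a = ∑ t ∈ Finset.range (y - x).toNat, f (x + t) := by
  refine Finset.sum_nbij' (fun a => (a - x).toNat) (fun t => x + (t : ℤ)) ?_ ?_ ?_ ?_ ?_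
  · intro a ha; rw [Finset.mem_Ico] at ha; rw [Finset.mem_range]; omega
  · intro t ht; rw [Finset.mem_range] at ht; rw [Finset.mem_Ico]; omega
  · intro a ha; rw [Finset.mem_Ico] at ha; omega
  · intro t ht; simp
  · intro a ha
    rw [Finset.mem_Ico] at ha
    congr 1; omega

section Pick

variable {N : ℕ} [NeZero N] {V : Fin N → Lat}

theorem two_mul_sum_colBot {i : Fin N} (hi : V i 0 < V (i + 1) 0) :
    2 * ∑ a ∈ Finset.Ico (V i 0) (V (i + 1) 0), -colBot V i a =
      -edge V i 0 * (V i 1 + V (i + 1) 1) + edge V i 1 - edge V i 0 + latGcd (edge V i) := by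
  have hE : 0 < edge V i 0 := sub_pos.2 hi
  have hE1 : edge V i 1 = V (i + 1) 1 - V i 1 := rfl
  have hn : ((edge V i 0).toNat : ℤ) = edge V i 0 := Int.toNat_of_nonneg hE.le
  have hs := two_mul_sum_floor (M := (edge V i 0).toNat) (by omega) (-edge V i 1)
  rw [hn, Int.gcd_neg] at hs
  rw [sum_Ico_eq_sum_range _ hi.le, ← edge_zero]
  have : ∀ t ∈ Finset.range (edge V i 0).toNat, -colBot V i (V i 0 + t) =
      (t * (-edge V i 1)) / edge V i 0 - V i 1 := by
    intro t _
    rw [colBot, add_sub_cancel_left, mul_comm]; ring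
  rw [Finset.sum_congr rfl this, Finset.sum_sub_distrib, mul_sub, hs]
  simp only [Finset.sum_const, Finset.card_range, nsmul_eq_mul, hn, latGcd, hE1]
  ring

theorem two_mul_sum_colTop {j : Fin N} (hj : V (j + 1) 0 < V j 0) :
    2 * ∑ a ∈ Finset.Ico (V (j + 1) 0) (V j 0), colTop V j a =
      -edge V j 0 * (V j 1 + V (j + 1) 1) + edge V j 1 + edge V j 0 + latGcd (edge V j) := by
  have hE : 0 < -edge V j 0 := neg_pos.2 (sub_neg.2 hj)
  have hE1 : edge V j 1 = V (j + 1) 1 - V j 1 := rfl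
  have hn : ((-edge V j 0).toNat : ℤ) = -edge V j 0 := Int.toNat_of_nonneg hE.le
  have hs := two_mul_sum_floor (M := (-edge V j 0).toNat) (by omega) (-edge V j 1)
  rw [hn, Int.gcd_neg, Int.neg_gcd] at hs
  rw [sum_Ico_eq_sum_range _ hj.le, show V j 0 - V (j + 1) 0 = -edge V j 0 by
    rw [edge_zero]; ring]
  have : ∀ t ∈ Finset.range (-edge V j 0).toNat, colTop V j (V (j + 1) 0 + t) =
      (t * (-edge V j 1)) / (-edge V j 0) + V (j + 1) 1 := by
    intro t _
    rw [colTop, add_sub_cancel_left, mul_comm]; ring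
  rw [Finset.sum_congr rfl this, Finset.sum_add_distrib, mul_add, hs]
  simp only [Finset.sum_const, Finset.card_range, nsmul_eq_mul, hn, latGcd, hE1]
  ring

/-- The number of lattice points of the polygon. -/
def pointCount (V : Fin N → Lat) : ℕ := {x | Inside V x}.ncard

theorem sum_edge (V : Fin N → Lat) (k : Fin 2) : ∑ i, edge V i k = 0 := by
  simp only [edge, Pi.sub_apply, Finset.sum_sub_distrib]
  rw [sub_eq_zero]
  exact Equiv.sum_comp (Equiv.addRight (1 : Fin N)) fun i => V i k

theorem pointCount_eq_sum (hV : IsConvexLatticePolygon V) {l r : Fin N}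
    (hl : ∀ i, V l 0 ≤ V i 0) (hr : ∀ i, V i 0 ≤ V r 0) :
    pointCount V = ∑ a ∈ Finset.Icc (V l 0) (V r 0), colCount V a := by
  refine ncard_eq_sum_column (inside_finite hV) fun x hx => ?_
  obtain ⟨i, hi⟩ := exists_le_abscissa hV hx
  obtain ⟨j, hj⟩ := exists_abscissa_le hV hx
  exact Finset.mem_Icc.2 ⟨(hl i).trans hi, hj.trans (hr j)⟩

/-- The only point of the polygon in the column of a vertex that is a strict extremum of the
abscissa is the vertex. -/
theorem column_extreme (hV : IsConvexLatticePolygon V) {i : Fin N}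
    (h : edge V (i - 1) 0 * edge V i 0 < 0) : column V (V i 0) = {V i 1} := by
  ext b
  rw [Set.mem_singleton_iff]
  constructor
  · intro hb
    have e1 := inside_side hb i
    have e2 := inside_side hb (i - 1)
    have hD : (0 : ℝ) < crs (edge V (i - 1)) (edge V i) := by exact_mod_cast hV.turn_pos i
    have t1 := turn_mul_lin V i 1 0 (V i 0) b
    have t2 := turn_mul_lin V i 0 1 (V i 0) b
    simp only [Matrix.cons_val_zero, Matrix.cons_val_one] at e1 e2
    simp only [lin, one_mul, zero_mul, add_zero, sub_self, mul_zero, zero_add] at t1 t2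
    have h' : ((edge V (i - 1) 0 : ℝ)) * (edge V i 0 : ℝ) < 0 := by exact_mod_cast h
    have z : side V i (V i 0) b = 0 ∧ side V (i - 1) (V i 0) b = 0 := by
      rcases mul_neg_iff.1 h' with ⟨u1, u2⟩ | ⟨u1, u2⟩
      · have v1 := mul_nonneg e1 u1.le
        have v2 := mul_nonneg e2 (neg_pos.2 u2).le
        exact ⟨(mul_eq_zero.1 (by linarith)).resolve_right u1.ne',
          (mul_eq_zero.1 (by linarith)).resolve_right u2.ne⟩
      · have v1 := mul_nonneg e1 (neg_pos.2 u1).le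
        have v2 := mul_nonneg e2 u2.le
        exact ⟨(mul_eq_zero.1 (by linarith)).resolve_right u1.ne,
          (mul_eq_zero.1 (by linarith)).resolve_right u2.ne'⟩
    rw [z.1, z.2, zero_mul, zero_mul, sub_self] at t2
    have := (mul_eq_zero.1 t2).resolve_left hD.ne'
    have : (b : ℝ) = V i 1 := by linarith
    exact_mod_cast this
  · rintro rfl
    have : ![V i 0, V i 1] = V i := by ext t; fin_cases t <;> rfl
    rw [column, Set.mem_ofPred_eq, this]
    exact hV.inside_vertex i

/-- Pick's theorem for a polygon without vertical edges. Every column but the last, a single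
vertex, lies between one edge running to the right and one running to the left, so the points are
counted by sums of integer parts along the edges. -/
theorem pick_of_edge_ne (hV : IsConvexLatticePolygon V) (hne : ∀ i, edge V i 0 ≠ 0) :
    2 * (pointCount V : ℤ) =
      ∑ i, crs (V i) (V (i + 1)) + ∑ i, (latGcd (edge V i) : ℤ) + 2 := by
  obtain ⟨l, hl⟩ := Finite.exists_min fun i => V i 0
  obtain ⟨r, hr⟩ := Finite.exists_max fun i => V i 0
  have hwidth := two_mul_width hV hl hr
  have hr0 : 0 < edge V (r - 1) 0 := by
    have := hr (r - 1)
    have h1 := hne (r - 1)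
    rw [edge_pred] at h1 ⊢
    simp only [Pi.sub_apply] at h1 ⊢
    omega
  have hr1 : edge V r 0 < 0 := by
    have := hr (r + 1)
    have h1 := hne r
    rw [edge_zero] at h1 ⊢
    omega
  have hlast : colCount V (V r 0) = 1 := by
    rw [colCount, column_extreme hV (mul_neg_of_pos_of_neg hr0 hr1), Set.ncard_singleton]
  have hcols : ∑ a ∈ Finset.Ico (V l 0) (V r 0), (colCount V a : ℤ) =
      ∑ i, ∑ a ∈ Finset.Ico (V i 0) (V (i + 1) 0), -colBot V i a +
      ∑ j, ∑ a ∈ Finset.Ico (V (j + 1) 0) (V j 0), colTop V j a + (V r 0 - V l 0) := by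
    classical
    have hup : ∀ a ∈ Finset.Ico (V l 0) (V r 0), ∃ i, a ∈ Finset.Ico (V i 0) (V (i + 1) 0) :=
      fun a ha => exists_up ⟨l, (Finset.mem_Ico.1 ha).1⟩ ⟨r, (Finset.mem_Ico.1 ha).2⟩
    have hdn : ∀ a ∈ Finset.Ico (V l 0) (V r 0), ∃ i, a ∈ Finset.Ico (V (i + 1) 0) (V i 0) :=
      fun a ha => exists_down ⟨l, (Finset.mem_Ico.1 ha).1⟩ ⟨r, (Finset.mem_Ico.1 ha).2⟩
    choose! u hu using hup
    choose! w hw using hdn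
    rw [← sum_existsUnique (S := Finset.Ico (V l 0) (V r 0))
        (F := fun i a => -colBot V i a) (f := fun a => -colBot V (u a) a)
        (fun i => Finset.Ico_subset_Ico (hl i) (hr (i + 1)))
        (fun a ha => ⟨u a, hu a ha, rfl, fun k hk => up_unique hV hk (hu a ha)⟩),
      ← sum_existsUnique (S := Finset.Ico (V l 0) (V r 0))
        (F := fun j a => colTop V j a) (f := fun a => colTop V (w a) a)
        (fun i => Finset.Ico_subset_Ico (hl (i + 1)) (hr i))
        (fun a ha => ⟨w a, hw a ha, rfl, fun k hk => down_unique hV hk (hw a ha)⟩)]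
    have hc : V r 0 - V l 0 = ∑ a ∈ Finset.Ico (V l 0) (V r 0), (1 : ℤ) := by simp [hr l]
    rw [hc, ← Finset.sum_add_distrib, ← Finset.sum_add_distrib]
    refine Finset.sum_congr rfl fun a ha => ?_
    have h1 := Finset.mem_Ico.1 (hu a ha)
    have h2 := Finset.mem_Ico.1 (hw a ha)
    rw [colCount_eq hV (h1.1.trans_lt h1.2) (h2.1.trans_lt h2.2)
      (Finset.mem_Icc.2 ⟨h1.1, h1.2.le⟩) (Finset.mem_Icc.2 ⟨h2.1, h2.2.le⟩)]
    ring
  have hedge : ∀ i, 2 * (∑ a ∈ Finset.Ico (V i 0) (V (i + 1) 0), -colBot V i a +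
      ∑ a ∈ Finset.Ico (V (i + 1) 0) (V i 0), colTop V i a) =
      (crs (V i) (V (i + 1)) + (V i 0 * V i 1 - V (i + 1) 0 * V (i + 1) 1)) +
        edge V i 1 - |edge V i 0| + latGcd (edge V i) := by
    intro i
    rcases lt_or_gt_of_ne (hne i) with h | h
    · have h' : V (i + 1) 0 < V i 0 := sub_neg.1 h
      rw [Finset.Ico_eq_empty (by omega), Finset.sum_empty, zero_add, two_mul_sum_colTop h',
        abs_of_neg h]
      simp only [edge, crs, Pi.sub_apply]; ring
    · have h' : V i 0 < V (i + 1) 0 := sub_pos.1 h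
      rw [Finset.Ico_eq_empty (a := V (i + 1) 0) (by omega), Finset.sum_empty, add_zero,
        two_mul_sum_colBot h', abs_of_pos h]
      simp only [edge, crs, Pi.sub_apply]; ring
  -- the terms `V i 0 * V i 1` telescope around the boundary
  have hsum := Finset.sum_congr (rfl : (Finset.univ : Finset (Fin N)) = _) fun i _ => hedge i
  have htel : ∑ i, (V i 0 * V i 1 - V (i + 1) 0 * V (i + 1) 1) = 0 := by
    rw [Finset.sum_sub_distrib, sub_eq_zero]
    exact (Equiv.sum_comp (Equiv.addRight (1 : Fin N)) fun i => V i 0 * V i 1).symm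
  rw [← Finset.mul_sum] at hsum
  simp only [Finset.sum_add_distrib, Finset.sum_sub_distrib (f := fun i => _ + _),
    htel, sum_edge] at hsum
  rw [pointCount_eq_sum hV hl hr, ← Finset.Ico_insert_right (hl r),
    Finset.sum_insert (by simp), hlast]
  push_cast
  rw [hcols]
  linarith

end Pick

/-! ### Unimodular changes of coordinates -/

/-- The integral linear map with rows `(p, q)` and `(r, s)`. -/
def slMap (p q r s : ℤ) (x : Lat) : Lat := ![p * x 0 + q * x 1, r * x 0 + s * x 1]

section Unimodular

variable {p q r s : ℤ}

@[simp] theorem slMap_zero (x : Lat) : slMap p q r s x 0 = p * x 0 + q * x 1 := rfl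

@[simp] theorem slMap_one (x : Lat) : slMap p q r s x 1 = r * x 0 + s * x 1 := rfl

theorem crs_slMap (h : p * s - q * r = 1) (x y : Lat) :
    crs (slMap p q r s x) (slMap p q r s y) = crs x y := by
  simp only [crs, slMap_zero, slMap_one]
  linear_combination (x 0 * y 1 - x 1 * y 0) * h

theorem slMap_sub (x y : Lat) : slMap p q r s (x - y) = slMap p q r s x - slMap p q r s y := by
  ext t; fin_cases t <;> simp [slMap] <;> ring

theorem slMap_add (x y : Lat) : slMap p q r s (x + y) = slMap p q r s x + slMap p q r s y := by
  ext t; fin_cases t <;> simp [slMap] <;> ring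

theorem slMap_bijective (h : p * s - q * r = 1) : Function.Bijective (slMap p q r s) := by
  refine Function.bijective_iff_has_inverse.2 ⟨slMap s (-q) (-r) p, fun x => ?_, fun x => ?_⟩
  · ext t
    fin_cases t
    · simp only [slMap, Fin.zero_eta, Matrix.cons_val_zero, Matrix.cons_val_one]
      linear_combination x 0 * h
    · simp only [slMap, Fin.mk_one, Matrix.cons_val_zero, Matrix.cons_val_one]
      linear_combination x 1 * h
  · ext t
    fin_cases t
    · simp only [slMap, Fin.zero_eta, Matrix.cons_val_zero, Matrix.cons_val_one]
      linear_combination x 0 * h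
    · simp only [slMap, Fin.mk_one, Matrix.cons_val_zero, Matrix.cons_val_one]
      linear_combination x 1 * h

variable {N : ℕ} [NeZero N] {V : Fin N → Lat}

theorem edge_slMap (V : Fin N → Lat) (i : Fin N) :
    edge (slMap p q r s ∘ V) i = slMap p q r s (edge V i) := by
  simp only [edge, Function.comp_apply, slMap_sub]

theorem IsConvexLatticePolygon.slMap (hV : IsConvexLatticePolygon V) (h : p * s - q * r = 1) :
    IsConvexLatticePolygon (slMap p q r s ∘ V) where
  three_le := hV.three_le
  left_of_edge i j h1 h2 := by
    have := hV.crs_pos h1 h2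
    rw [← crs_slMap h, slMap_sub, ← edge_slMap] at this
    exact this

theorem inside_slMap (h : p * s - q * r = 1) (x : Lat) :
    Inside (slMap p q r s ∘ V) (slMap p q r s x) ↔ Inside V x := by
  simp only [Inside, edge_slMap, Function.comp_apply, ← slMap_sub, crs_slMap h]

/-- The number of lattice points `x` such that both ends of the bond from `x` to `x + w` lie in the
polygon. -/
def bondCount (V : Fin N → Lat) (w : Lat) : ℕ := {x | Inside V x ∧ Inside V (x + w)}.ncard

theorem bondCount_slMap (h : p * s - q * r = 1) (w : Lat) :
    bondCount (slMap p q r s ∘ V) (slMap p q r s w) = bondCount V w := by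
  have : {x | Inside (slMap p q r s ∘ V) x ∧
      Inside (slMap p q r s ∘ V) (x + slMap p q r s w)} =
      slMap p q r s '' {x | Inside V x ∧ Inside V (x + w)} := by
    ext y
    obtain ⟨x, rfl⟩ := (slMap_bijective h).2 y
    rw [(slMap_bijective h).1.mem_set_image, Set.mem_ofPred_eq, Set.mem_ofPred_eq, ← slMap_add,
      inside_slMap h, inside_slMap h]
  rw [bondCount, this, Set.ncard_image_of_injective _ (slMap_bijective h).1, bondCount]

theorem bondCount_zero (V : Fin N → Lat) : bondCount V 0 = pointCount V := by
  simp [bondCount, pointCount]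

theorem pointCount_slMap (h : p * s - q * r = 1) :
    pointCount (slMap p q r s ∘ V) = pointCount V := by
  have h0 : slMap p q r s 0 = 0 := by ext t; fin_cases t <;> simp [LatticeCrystal.slMap]
  rw [← bondCount_zero, ← bondCount_zero]
  nth_rewrite 1 [← h0]
  exact bondCount_slMap h 0

/-- Pick's theorem. -/
theorem pick (hV : IsConvexLatticePolygon V) :
    2 * (pointCount V : ℤ) =
      ∑ i, crs (V i) (V (i + 1)) + ∑ i, (latGcd (edge V i) : ℤ) + 2 := by
  -- a shear that leaves no vertical edge
  obtain ⟨m, hm⟩ : ∃ m : ℤ, ∀ i, 1 * edge V i 0 + m * edge V i 1 ≠ 0 := by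
    obtain ⟨k, hk⟩ := Finite.exists_max fun i => |edge V i 0|
    refine ⟨|edge V k 0| + 1, fun i h => ?_⟩
    by_cases h1 : edge V i 1 = 0
    · apply hV.edge_ne_zero i
      rw [h1, mul_zero, add_zero, one_mul] at h
      ext t; fin_cases t
      · exact h
      · exact h1
    · have h2 : |edge V i 0| = (|edge V k 0| + 1) * |edge V i 1| := by
        rw [← abs_of_nonneg (show 0 ≤ |edge V k 0| + 1 by positivity), ← abs_mul, ← abs_neg]
        congr 1
        linarith
      have h3 : 1 ≤ |edge V i 1| := Int.one_le_abs h1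
      have h4 := hk i
      have h5 : 0 ≤ |edge V k 0| := abs_nonneg _
      nlinarith
  have hdet : (1 : ℤ) * 1 - m * 0 = 1 := by ring
  have h := pick_of_edge_ne (hV.slMap hdet) fun i => by
    rw [edge_slMap, slMap_zero]; exact hm i
  rw [pointCount_slMap hdet] at h
  rw [h]
  congr 2
  · exact Finset.sum_congr rfl fun i _ => crs_slMap hdet _ _
  · refine Finset.sum_congr rfl fun i _ => ?_
    rw [edge_slMap]
    simp only [latGcd, slMap_zero, slMap_one, one_mul, zero_mul, zero_add]
    rw [Int.gcd_add_mul_right_left]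

end Unimodular

/-! ### Bonds in a vertical direction -/

theorem floor_intCast_div_intCast {b : ℤ} (hb : 0 < b) (a : ℤ) :
    ⌊(a : ℝ) / (b : ℝ)⌋ = a / b := by
  rw [Int.floor_div_cast_of_nonneg hb.le, Int.floor_intCast]

section Vertical

variable {N : ℕ} [NeZero N] {V : Fin N → Lat}

/-- The polygon with vertices `-V i`, that is, the polygon rotated by a half-turn. -/
theorem IsConvexLatticePolygon.neg (hV : IsConvexLatticePolygon V) :
    IsConvexLatticePolygon (-V) where
  three_le := hV.three_le
  left_of_edge i j h1 h2 := by
    have := hV.left_of_edge i j h1 h2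
    simp only [Pi.neg_apply]
    linarith

theorem edge_neg (V : Fin N → Lat) (i : Fin N) : edge (-V) i = -edge V i := by
  simp only [edge, Pi.neg_apply]; abel

theorem crs_neg_neg (x y : Lat) : crs (-x) (-y) = crs x y := by
  simp [crs]

theorem inside_neg (x : Lat) : Inside (-V) (-x) ↔ Inside V x := by
  simp only [Inside, edge_neg, Pi.neg_apply]
  refine forall_congr' fun i => ?_
  rw [show -x - -V i = -(x - V i) by abel, crs_neg_neg]

theorem side_neg (i : Fin N) (x y : ℝ) : side (-V) i (-x) (-y) = side V i x y := by
  simp only [side, edge_neg, Pi.neg_apply]; push_cast; ring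

theorem colCount_neg (V : Fin N → Lat) (a : ℤ) : colCount (-V) (-a) = colCount V a := by
  have : column (-V) (-a) = (fun b => -b) '' column V a := by
    ext b
    constructor
    · intro hb
      refine ⟨-b, ?_, neg_neg b⟩
      rw [column, Set.mem_ofPred_eq, ← inside_neg]
      have : -![a, -b] = ![-a, b] := by ext t; fin_cases t <;> simp
      rw [this]; exact hb
    · rintro ⟨c, hc, rfl⟩
      have : -![a, c] = ![-a, -c] := by ext t; fin_cases t <;> simp
      change Inside (-V) ![-a, -c]
      rw [← this, inside_neg]; exact hc
  rw [colCount, this, Set.ncard_image_of_injective _ neg_injective, colCount]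

theorem side_combo (i : Fin N) {s t : ℝ} (hst : s + t = 1) (x y x' y' : ℝ) :
    side V i (s * x + t * x') (s * y + t * y') = s * side V i x y + t * side V i x' y' := by
  obtain rfl : t = 1 - s := by linarith
  simp only [side]; ring

theorem le_colCount (hV : IsConvexLatticePolygon V) {a : ℤ} {g : ℕ} {y : ℝ}
    (h1 : ∀ i, 0 ≤ side V i a y) (h2 : ∀ i, 0 ≤ side V i a (y + g)) : g ≤ colCount V a := by
  have hsub : Set.Icc ⌈y⌉ (⌈y⌉ + g - 1) ⊆ column V a := by
    rintro b ⟨hb1, hb2⟩ i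
    have c1 : y ≤ b := Int.ceil_le.1 hb1
    have c2 : (b : ℝ) ≤ y + g := by
      have : (b : ℝ) ≤ (⌈y⌉ : ℝ) + g - 1 := by exact_mod_cast hb2
      linarith [Int.ceil_lt_add_one y]
    have key : 0 ≤ side V i a b := by
      have h1 := h1 i
      have h2 := h2 i
      simp only [side] at h1 h2 ⊢
      rcases le_total 0 (edge V i 0 : ℝ) with h | h <;> nlinarith
    have := side_lattice V i ![a, b]
    simp only [Matrix.cons_val_zero, Matrix.cons_val_one] at this
    rw [this] at key
    exact_mod_cast key
  have := Set.ncard_le_ncard hsub (column_finite hV a)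
  rw [ncard_Icc_int] at this
  rw [colCount]; omega

theorem exists_column_eq_Icc (hV : IsConvexLatticePolygon V) (a : ℤ) :
    ∃ l u, column V a = Set.Icc l u := by
  rcases (column V a).eq_empty_or_nonempty with h | h
  · exact ⟨1, 0, by simp [h]⟩
  obtain ⟨l, hl, hl'⟩ := Set.exists_min_image _ id (column_finite hV a) h
  obtain ⟨u, hu, hu'⟩ := Set.exists_max_image _ id (column_finite hV a) h
  refine ⟨l, u, Set.Subset.antisymm (fun b hb => ⟨hl' b hb, hu' b hb⟩) ?_⟩
  rintro b ⟨h1, h2⟩ i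
  have h3 := hl i
  have h4 := hu i
  simp only [crs, Pi.sub_apply, Matrix.cons_val_zero, Matrix.cons_val_one] at h3 h4 ⊢
  rcases le_total 0 (edge V i 0) with h | h <;> nlinarith

theorem bondCount_eq_sum (hV : IsConvexLatticePolygon V) {l r : Fin N}
    (hl : ∀ i, V l 0 ≤ V i 0) (hr : ∀ i, V i 0 ≤ V r 0) (g : ℕ) :
    bondCount V ![0, g] = ∑ a ∈ Finset.Icc (V l 0) (V r 0), (colCount V a - g) := by
  rw [bondCount, ncard_eq_sum_column (A := Finset.Icc (V l 0) (V r 0))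
    ((inside_finite hV).subset fun x hx => hx.1)]
  · refine Finset.sum_congr rfl fun a _ => ?_
    obtain ⟨L, U, hLU⟩ := exists_column_eq_Icc hV a
    have : {b : ℤ | ![a, b] ∈ {x | Inside V x ∧ Inside V (x + ![0, (g : ℤ)])}} =
        Set.Icc L (U - g) := by
      ext b
      have h1 : ∀ c, Inside V ![a, c] ↔ c ∈ Set.Icc L U := fun c => by rw [← hLU]; rfl
      simp only [Set.mem_ofPred_eq]
      have h2 : ![a, b] + ![0, (g : ℤ)] = ![a, b + g] := by ext t; fin_cases t <;> simp
      rw [h2, h1, h1, Set.mem_Icc, Set.mem_Icc, Set.mem_Icc]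
      omega
    rw [this, colCount, hLU, ncard_Icc_int, ncard_Icc_int]
    omega
  · intro x hx
    obtain ⟨i, hi⟩ := exists_le_abscissa hV hx.1
    obtain ⟨j, hj⟩ := exists_abscissa_le hV hx.1
    exact Finset.mem_Icc.2 ⟨(hl i).trans hi, hj.trans (hr j)⟩

/-- The abscissa of the apex of the triangle with base `[0, (0, g)]` and sides parallel to the
two edges at a vertex. -/
def apexX (V : Fin N → Lat) (g : ℕ) (i : Fin N) : ℝ :=
  g * edge V (i - 1) 0 * edge V i 0 / crs (edge V (i - 1)) (edge V i)

/-- The ordinate of the apex of the triangle with base `[0, (0, g)]` and sides parallel to the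
two edges at a vertex. -/
def apexY (V : Fin N → Lat) (g : ℕ) (i : Fin N) : ℝ :=
  g * edge V (i - 1) 0 * edge V i 1 / crs (edge V (i - 1)) (edge V i)

theorem apexX_neg (V : Fin N → Lat) (g : ℕ) (i : Fin N) : apexX (-V) g i = apexX V g i := by
  simp only [apexX, edge_neg, crs_neg_neg, Pi.neg_apply]; push_cast; ring

theorem apexY_neg (V : Fin N → Lat) (g : ℕ) (i : Fin N) : apexY (-V) g i = apexY V g i := by
  simp only [apexY, edge_neg, crs_neg_neg, Pi.neg_apply]; push_cast; ring

/-- Near a leftmost vertex the polygon contains a vertical segment of length `g` at the distance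
`|apexX|` from the vertex. -/
theorem exists_slice (hV : IsConvexLatticePolygon V) {g : ℕ} {i : Fin N}
    (h1 : edge V (i - 1) 0 < 0) (h2 : 0 ≤ edge V i 0)
    (hs1 : 2 * (g : ℤ) * |edge V (i - 1) 0| ≤ crs (edge V (i - 1)) (edge V i))
    (hs2 : 2 * (g : ℤ) * |edge V i 0| ≤ crs (edge V (i - 1)) (edge V i)) :
    ∃ y : ℝ, (∀ k, 0 ≤ side V k (V i 0 + |apexX V g i|) y) ∧
      ∀ k, 0 ≤ side V k (V i 0 + |apexX V g i|) (y + g) := by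
  have hD : (0 : ℝ) < crs (edge V (i - 1)) (edge V i) := by exact_mod_cast hV.turn_pos i
  rw [abs_of_neg h1] at hs1
  rw [abs_of_nonneg h2] at hs2
  have h1' : (edge V (i - 1) 0 : ℝ) < 0 := by exact_mod_cast h1
  have h2' : (0 : ℝ) ≤ edge V i 0 := by exact_mod_cast h2
  have hs1' : 2 * (g : ℝ) * -edge V (i - 1) 0 ≤ crs (edge V (i - 1)) (edge V i) := by
    exact_mod_cast hs1
  have hs2' : 2 * (g : ℝ) * edge V i 0 ≤ crs (edge V (i - 1)) (edge V i) := by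
    exact_mod_cast hs2
  have hDe : (crs (edge V (i - 1)) (edge V i) : ℝ) =
      edge V (i - 1) 0 * edge V i 1 - edge V (i - 1) 1 * edge V i 0 := by
    simp only [crs]; push_cast; ring
  have hg : (0 : ℝ) ≤ g := Nat.cast_nonneg g
  have hα : |apexX V g i| =
      (g * -edge V (i - 1) 0 / crs (edge V (i - 1)) (edge V i)) * edge V i 0 := by
    rw [apexX, abs_of_nonpos]
    · ring
    · apply div_nonpos_of_nonpos_of_nonneg _ hD.le
      have := mul_nonneg (mul_nonneg hg (neg_pos.2 h1').le) h2'
      nlinarith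
  rw [hα]
  set D : ℝ := ((crs (edge V (i - 1)) (edge V i) : ℤ) : ℝ) with hDdef
  set lam : ℝ := g * -edge V (i - 1) 0 / D with hlam
  set mu : ℝ := g * edge V i 0 / D with hmu
  have hlam0 : 0 ≤ lam := div_nonneg (mul_nonneg hg (neg_pos.2 h1').le) hD.le
  have hmu0 : 0 ≤ mu := div_nonneg (mul_nonneg hg h2') hD.le
  have hlam1 : lam ≤ 1 := by rw [hlam, div_le_one hD]; nlinarith
  have hmu1 : mu ≤ 1 := by rw [hmu, div_le_one hD]; nlinarith
  have hlD : lam * D = g * -edge V (i - 1) 0 := div_mul_cancel₀ _ hD.ne'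
  have hmD : mu * D = g * edge V i 0 := div_mul_cancel₀ _ hD.ne'
  have ei : ∀ t, (edge V i t : ℝ) = V (i + 1) t - V i t := fun t => by
    simp [edge]
  have ep : ∀ t, (edge V (i - 1) t : ℝ) = V i t - V (i - 1) t := fun t => by
    simp [edge]
  refine ⟨V i 1 + lam * edge V i 1, fun k => ?_, fun k => ?_⟩
  · have h := side_combo (V := V) k (s := 1 - lam) (t := lam) (by ring) (V i 0) (V i 1)
      (V (i + 1) 0) (V (i + 1) 1)
    have e0 : (V i 0 : ℝ) + lam * edge V i 0 = (1 - lam) * V i 0 + lam * V (i + 1) 0 := by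
      rw [ei]; ring
    have e1 : (V i 1 : ℝ) + lam * edge V i 1 = (1 - lam) * V i 1 + lam * V (i + 1) 1 := by
      rw [ei]; ring
    rw [e0, e1, h]
    have := mul_nonneg (sub_nonneg.2 hlam1) (hV.side_vertex_nonneg k i)
    have := mul_nonneg hlam0 (hV.side_vertex_nonneg k (i + 1))
    linarith
  · have h := side_combo (V := V) k (s := 1 - mu) (t := mu) (by ring) (V i 0) (V i 1)
      (V (i - 1) 0) (V (i - 1) 1)
    have e0 : (V i 0 : ℝ) + lam * edge V i 0 = (1 - mu) * V i 0 + mu * V (i - 1) 0 := by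
      have : lam * edge V i 0 = -(mu * edge V (i - 1) 0) := by
        apply mul_right_cancel₀ hD.ne'
        linear_combination (edge V i 0 : ℝ) * hlD + (edge V (i - 1) 0 : ℝ) * hmD
      rw [this, ep]; ring
    have e1 : (V i 1 : ℝ) + lam * edge V i 1 + g = (1 - mu) * V i 1 + mu * V (i - 1) 1 := by
      have : lam * edge V i 1 + g = -(mu * edge V (i - 1) 1) := by
        apply mul_right_cancel₀ hD.ne'
        linear_combination (edge V i 1 : ℝ) * hlD + (edge V (i - 1) 1 : ℝ) * hmD +
          (g : ℝ) * hDe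
      rw [add_assoc, this, ep]; ring
    rw [e0, e1, h]
    have := mul_nonneg (sub_nonneg.2 hmu1) (hV.side_vertex_nonneg k i)
    have := mul_nonneg hmu0 (hV.side_vertex_nonneg k (i - 1))
    linarith

theorem two_mul_abs_apexX_le (hV : IsConvexLatticePolygon V) {g : ℕ} {i : Fin N}
    (hs1 : 2 * (g : ℤ) * |edge V (i - 1) 0| ≤ crs (edge V (i - 1)) (edge V i)) :
    2 * |apexX V g i| ≤ |edge V i 0| := by
  have hD : (0 : ℝ) < crs (edge V (i - 1)) (edge V i) := by exact_mod_cast hV.turn_pos i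
  have hs1' : 2 * (g : ℝ) * |(edge V (i - 1) 0 : ℝ)| ≤ crs (edge V (i - 1)) (edge V i) := by
    exact_mod_cast hs1
  rw [apexX, abs_div, abs_of_pos hD, abs_mul, abs_mul, Nat.abs_cast, ← mul_div_assoc,
    div_le_iff₀ hD]
  push_cast
  nlinarith [mul_le_mul_of_nonneg_right hs1' (abs_nonneg (edge V i 0 : ℝ))]

theorem two_mul_abs_apexX_le' (hV : IsConvexLatticePolygon V) {g : ℕ} {i : Fin N}
    (hs2 : 2 * (g : ℤ) * |edge V i 0| ≤ crs (edge V (i - 1)) (edge V i)) :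
    2 * |apexX V g i| ≤ |edge V (i - 1) 0| := by
  have hD : (0 : ℝ) < crs (edge V (i - 1)) (edge V i) := by exact_mod_cast hV.turn_pos i
  have hs2' : 2 * (g : ℝ) * |(edge V i 0 : ℝ)| ≤ crs (edge V (i - 1)) (edge V i) := by
    exact_mod_cast hs2
  rw [apexX, abs_div, abs_of_pos hD, abs_mul, abs_mul, Nat.abs_cast, ← mul_div_assoc,
    div_le_iff₀ hD]
  push_cast
  nlinarith [mul_le_mul_of_nonneg_right hs2' (abs_nonneg (edge V (i - 1) 0 : ℝ))]

/-- Near a strictly leftmost vertex the numbers of lattice points missing from the columns shorter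
than `g` add up to the number of lattice points interior to the triangle with base `[0, (0, g)]`
and sides parallel to the edges at the vertex, or interior to its base. -/
theorem sum_deficit_left (hV : IsConvexLatticePolygon V) {g : ℕ} (hg : 0 < g) {i : Fin N}
    (h1 : edge V (i - 1) 0 < 0) (h2 : 0 ≤ edge V i 0)
    (hs1 : 2 * (g : ℤ) * |edge V (i - 1) 0| ≤ crs (edge V (i - 1)) (edge V i))
    (hs2 : 2 * (g : ℤ) * |edge V i 0| ≤ crs (edge V (i - 1)) (edge V i)) :
    ∑ a ∈ Finset.Ico (V i 0) (V i 0 + ⌈|apexX V g i|⌉), ((g - colCount V a : ℕ) : ℤ) =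
      if edge V (i - 1) 0 * edge V i 0 < 0 then
        (g : ℤ) - 1 + triangleSum (apexX V g i) (apexY V g i) g else 0 := by
  have hD : (0 : ℝ) < crs (edge V (i - 1)) (edge V i) := by exact_mod_cast hV.turn_pos i
  rcases h2.eq_or_lt with h2 | h2
  · rw [← h2]
    simp [apexX, ← h2]
  rw [if_pos (mul_neg_of_neg_of_pos h1 h2)]
  have hle1 := two_mul_abs_apexX_le hV hs1
  have hle2 := two_mul_abs_apexX_le' hV hs2
  have h1' : (edge V (i - 1) 0 : ℝ) < 0 := by exact_mod_cast h1
  have h2' : (0 : ℝ) < edge V i 0 := by exact_mod_cast h2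
  have hg' : (0 : ℝ) < g := by exact_mod_cast hg
  have hDe : (crs (edge V (i - 1)) (edge V i) : ℝ) =
      edge V (i - 1) 0 * edge V i 1 - edge V (i - 1) 1 * edge V i 0 := by
    simp only [crs]; push_cast; ring
  have hneg : apexX V g i < 0 := by
    rw [apexX]
    exact div_neg_of_neg_of_pos (mul_neg_of_neg_of_pos (mul_neg_of_pos_of_neg hg' h1') h2') hD
  have habs : |apexX V g i| = -apexX V g i := abs_of_neg hneg
  have hpos : 0 < |apexX V g i| := abs_pos.2 hneg.ne
  have hc1 : 1 ≤ ⌈|apexX V g i|⌉ := Int.one_le_ceil_iff.2 hpos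
  have h1n := h1'.ne
  -- the slopes of the two sides of the triangle are those of the edges
  have hβ : apexY V g i / |apexX V g i| = -edge V i 1 / edge V i 0 := by
    rw [habs, apexY, apexX]
    field_simp
  have hβ' : (apexY V g i - g) / |apexX V g i| = -(-edge V (i - 1) 1 / -edge V (i - 1) 0) := by
    rw [habs, div_eq_iff (neg_pos.2 hneg).ne', apexY, apexX]
    field_simp
    rw [hDe]; ring
  rw [triangleSum, if_neg hneg.ne, Int.cast_natCast, hβ, hβ']
  have hins : Finset.Ico (V i 0) (V i 0 + ⌈|apexX V g i|⌉) =
      insert (V i 0) (Finset.Ioo (V i 0) (V i 0 + ⌈|apexX V g i|⌉)) := by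
    rw [Finset.Ioo_insert_left (by omega)]
  rw [hins, Finset.sum_insert (by simp)]
  have h0 : colCount V (V i 0) = 1 := by
    rw [colCount, column_extreme hV (mul_neg_of_neg_of_pos h1 h2), Set.ncard_singleton]
  have hcol : ∀ j ∈ Finset.Icc (1 : ℤ) (⌈|apexX V g i|⌉ - 1),
      ((g - colCount V (V i 0 + j) : ℕ) : ℤ) =
        (g - 1) + (⌈-(-(edge V (i - 1) 1 : ℝ) / -edge V (i - 1) 0) * (j : ℝ)⌉ -
          ⌊-(edge V i 1 : ℝ) / edge V i 0 * j⌋) := by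
    intro j hj
    rw [Finset.mem_Icc] at hj
    have hj1 : (j : ℝ) < |apexX V g i| := by
      apply Int.lt_ceil.1; omega
    have hj0 : (0 : ℝ) < j := by exact_mod_cast hj.1
    have hji : j ≤ edge V i 0 := by
      have : (j : ℝ) ≤ |edge V i 0| := by linarith
      rw [abs_of_pos h2] at this
      exact_mod_cast this
    have hjp : j ≤ -edge V (i - 1) 0 := by
      have : (j : ℝ) ≤ |edge V (i - 1) 0| := by linarith
      rw [abs_of_neg h1] at this
      exact_mod_cast this
    have hV1 : V i 0 < V (i + 1) 0 := sub_pos.1 h2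
    have hV2 : V (i - 1 + 1) 0 < V (i - 1) 0 := sub_neg.1 h1
    have hcc := colCount_eq hV (a := V i 0 + j) hV1 hV2
      (Finset.mem_Icc.2 ⟨by omega, by rw [edge_zero] at hji; omega⟩)
      (Finset.mem_Icc.2 ⟨by rw [sub_add_cancel]; omega,
        by rw [edge_zero, sub_add_cancel] at hjp; omega⟩)
    have e1 : ⌈-(-(edge V (i - 1) 1 : ℝ) / -edge V (i - 1) 0) * (j : ℝ)⌉ =
        -((-edge V (i - 1) 1 * j) / (-edge V (i - 1) 0)) := by
      rw [neg_mul, Int.ceil_neg, ← floor_intCast_div_intCast (by omega)]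
      push_cast
      congr 2; ring
    have e2 : ⌊-(edge V i 1 : ℝ) / edge V i 0 * j⌋ = (-edge V i 1 * j) / edge V i 0 := by
      rw [← floor_intCast_div_intCast h2]
      push_cast
      congr 1; ring
    have hf1 : (((-edge V (i - 1) 1 * j) / (-edge V (i - 1) 0) : ℤ) : ℝ) ≤
        -(edge V (i - 1) 1 : ℝ) / -edge V (i - 1) 0 * j := by
      rw [← floor_intCast_div_intCast (by omega)]
      refine (Int.floor_le _).trans (le_of_eq ?_)
      push_cast; ring
    have hf2 : (((-edge V i 1 * j) / edge V i 0 : ℤ) : ℝ) ≤ -(edge V i 1 : ℝ) / edge V i 0 * j := by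
      rw [← e2]; exact Int.floor_le _
    -- the slice at the distance `j` is shorter than `g`
    have hlen : -(edge V (i - 1) 1 : ℝ) / -edge V (i - 1) 0 * j +
        -(edge V i 1 : ℝ) / edge V i 0 * j < g := by
      have h3 : -(edge V (i - 1) 1 : ℝ) / -edge V (i - 1) 0 + -(edge V i 1 : ℝ) / edge V i 0 =
          g / |apexX V g i| := by
        rw [sub_div] at hβ'
        linarith
      rw [← add_mul, h3, div_mul_eq_mul_div, div_lt_iff₀ hpos]
      exact mul_lt_mul_of_pos_left hj1 hg'
    have hlt : (-edge V (i - 1) 1 * j) / (-edge V (i - 1) 0) + (-edge V i 1 * j) / edge V i 0 <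
        (g : ℤ) := by
      have : (((-edge V (i - 1) 1 * j) / (-edge V (i - 1) 0) +
          (-edge V i 1 * j) / edge V i 0 : ℤ) : ℝ) < ((g : ℤ) : ℝ) := by
        push_cast
        linarith
      exact_mod_cast this
    rw [e1, e2]
    rw [colTop, colBot, sub_add_cancel, add_sub_cancel_left] at hcc
    omega
  have hshift : Finset.Ioo (V i 0) (V i 0 + ⌈|apexX V g i|⌉) =
      (Finset.Icc (1 : ℤ) (⌈|apexX V g i|⌉ - 1)).image fun j => V i 0 + j := by
    ext a
    simp only [Finset.mem_Ioo, Finset.mem_image, Finset.mem_Icc]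
    constructor
    · intro h; exact ⟨a - V i 0, by omega, by omega⟩
    · rintro ⟨j, hj, rfl⟩; omega
  rw [hshift, Finset.sum_image (fun a _ b _ h => add_left_cancel h),
    Finset.sum_congr rfl hcol, Finset.sum_add_distrib, h0]
  rw [Finset.sum_const, Int.card_Icc, nsmul_eq_mul, Int.toNat_of_nonneg (by omega)]
  push_cast [Nat.cast_sub (show 1 ≤ g from hg)]
  ring

end Vertical

/-! ### The number of bonds of a polygon in a given direction -/

section Count

variable {N : ℕ} [NeZero N] {V : Fin N → Lat}

/-- The number of bonds in the direction `(0, g)`: all lattice points minus one column of height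
`g` for each abscissa, corrected at the columns that are shorter than `g`. The smallness of `g` keeps
the short columns at the two ends apart, and inside the range of the edges at the extreme vertices. -/
theorem bondCount_vertical (hV : IsConvexLatticePolygon V) {g : ℕ} (hg : 0 < g)
    (hs1 : ∀ i, 2 * (g : ℤ) * |edge V (i - 1) 0| ≤ crs (edge V (i - 1)) (edge V i))
    (hs2 : ∀ i, 2 * (g : ℤ) * |edge V i 0| ≤ crs (edge V (i - 1)) (edge V i)) :
    2 * (bondCount V ![0, g] : ℤ) = 2 * pointCount V - ∑ i, (g : ℤ) * |edge V i 0| - 2 * g +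
      2 * ∑ i, if edge V (i - 1) 0 * edge V i 0 < 0 then
        (g : ℤ) - 1 + triangleSum (apexX V g i) (apexY V g i) g else 0 := by
  have hlin : ∀ x : Lat, lin 1 0 x = (x 0 : ℝ) := fun x => by simp [lin]
  have hlin' : ∀ x : Lat, lin (-1) 0 x = -(x 0 : ℝ) := fun x => by simp [lin]
  obtain ⟨l, ⟨hl1, hl2⟩, hlu⟩ := existsUnique_lower hV (p := 1) (q := 0) (Or.inl one_ne_zero)
  obtain ⟨r, ⟨hr1, hr2⟩, hru⟩ := existsUnique_lower hV (p := -1) (q := 0)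
    (Or.inl (by norm_num))
  have hl : ∀ i, V l 0 ≤ V i 0 := by
    intro i
    have := lin_vertex_le hV hl1.le hl2 (fun j => hV.side_vertex_nonneg j i)
    rw [hlin] at this
    have : (V l 0 : ℝ) ≤ V i 0 := by linarith
    exact_mod_cast this
  have hr : ∀ i, V i 0 ≤ V r 0 := by
    intro i
    have := lin_vertex_le hV hr1.le hr2 (fun j => hV.side_vertex_nonneg j i)
    rw [hlin'] at this
    have : (V i 0 : ℝ) ≤ V r 0 := by linarith
    exact_mod_cast this
  simp only [hlin, hlin'] at hl1 hl2 hr1 hr2 hlu hru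
  norm_cast at hl1 hl2
  have hr1 : 0 < edge V (r - 1) 0 := by exact_mod_cast neg_lt_zero.1 hr1
  have hr2 : edge V r 0 ≤ 0 := by exact_mod_cast neg_nonneg.1 hr2
  have hlr : l ≠ r := by rintro rfl; omega
  -- the columns at the two ends
  set A := ⌈|apexX V g l|⌉ with hA
  set B := ⌈|apexX V g r|⌉ with hB
  have hleft := sum_deficit_left hV hg hl1 hl2 (hs1 l) (hs2 l)
  have e1 : ∀ i, edge (-V) i 0 = -edge V i 0 := fun i => by rw [edge_neg]; rfl
  have ecrs : crs (edge (-V) (r - 1)) (edge (-V) r) = crs (edge V (r - 1)) (edge V r) := by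
    rw [edge_neg, edge_neg, crs_neg_neg]
  have hright' := sum_deficit_left hV.neg hg (i := r) (by rw [e1]; omega) (by rw [e1]; omega)
    (by rw [e1, abs_neg, ecrs]; exact hs1 r) (by rw [e1, abs_neg, ecrs]; exact hs2 r)
  have hright : ∑ a ∈ Finset.Ioc (V r 0 - B) (V r 0), ((g - colCount V a : ℕ) : ℤ) =
      if edge V (r - 1) 0 * edge V r 0 < 0 then
        (g : ℤ) - 1 + triangleSum (apexX V g r) (apexY V g r) g else 0 := by
    rw [apexX_neg, apexY_neg, e1, e1, neg_mul_neg] at hright'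
    rw [← hright']
    refine Finset.sum_nbij' (fun a => -a) (fun a => -a) ?_ ?_ (by simp) (by simp) ?_
    · intro a ha
      rw [Finset.mem_Ioc] at ha
      rw [Finset.mem_Ico, Pi.neg_apply, Pi.neg_apply]
      constructor <;> omega
    · intro a ha
      rw [Finset.mem_Ico, Pi.neg_apply, Pi.neg_apply] at ha
      rw [Finset.mem_Ioc]
      constructor <;> omega
    · intro a _
      rw [colCount_neg]
  have hwl : (edge V l 0 : ℝ) ≤ V r 0 - V l 0 := by
    rw [edge_zero]
    have := hr (l + 1)
    have : (V (l + 1) 0 : ℝ) ≤ V r 0 := by exact_mod_cast this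
    push_cast; linarith
  have hwr : -(edge V r 0 : ℝ) ≤ V r 0 - V l 0 := by
    rw [edge_zero]
    have := hl (r + 1)
    have : (V l 0 : ℝ) ≤ V (r + 1) 0 := by exact_mod_cast this
    push_cast; linarith
  have hal : 2 * |apexX V g l| ≤ V r 0 - V l 0 := by
    have := two_mul_abs_apexX_le hV (hs1 l)
    rw [abs_of_nonneg hl2] at this
    linarith
  have har : 2 * |apexX V g r| ≤ V r 0 - V l 0 := by
    have := two_mul_abs_apexX_le hV (hs1 r)
    rw [abs_of_nonpos hr2] at this
    push_cast at this
    linarith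
  have hmemA : ∀ a ∈ Finset.Ico (V l 0) (V l 0 + A), (a : ℝ) - V l 0 < |apexX V g l| := by
    intro a ha
    rw [Finset.mem_Ico] at ha
    have : a - V l 0 < A := by omega
    have := Int.lt_ceil.1 this
    push_cast at this; exact this
  have hmemB : ∀ a ∈ Finset.Ioc (V r 0 - B) (V r 0), (V r 0 : ℝ) - a < |apexX V g r| := by
    intro a ha
    rw [Finset.mem_Ioc] at ha
    have : V r 0 - a < B := by omega
    have := Int.lt_ceil.1 this
    push_cast at this; exact this
  have hdisj : Disjoint (Finset.Ico (V l 0) (V l 0 + A)) (Finset.Ioc (V r 0 - B) (V r 0)) := by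
    rw [Finset.disjoint_left]
    intro a ha hb
    have := hmemA a ha
    have := hmemB a hb
    linarith
  have hsub : Finset.Ico (V l 0) (V l 0 + A) ∪ Finset.Ioc (V r 0 - B) (V r 0) ⊆
      Finset.Icc (V l 0) (V r 0) := by
    intro a ha
    rw [Finset.mem_Icc]
    have hw0 := abs_nonneg (apexX V g l)
    have hw1 := abs_nonneg (apexX V g r)
    rcases Finset.mem_union.1 ha with h | h
    · have h' := hmemA a h
      have : (a : ℝ) ≤ V r 0 := by linarith
      exact ⟨(Finset.mem_Ico.1 h).1, by exact_mod_cast this⟩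
    · have h' := hmemB a h
      have : (V l 0 : ℝ) ≤ a := by linarith
      exact ⟨by exact_mod_cast this, (Finset.mem_Ioc.1 h).2⟩
  -- in the columns between the two ends no point is missing, by convexity
  have hmid : ∀ a ∈ Finset.Icc (V l 0) (V r 0),
      a ∉ Finset.Ico (V l 0) (V l 0 + A) ∪ Finset.Ioc (V r 0 - B) (V r 0) →
      ((g - colCount V a : ℕ) : ℤ) = 0 := by
    intro a ha hn
    rw [Finset.mem_Icc] at ha
    rw [Finset.mem_union, not_or, Finset.mem_Ico, Finset.mem_Ioc] at hn
    have h1 : |apexX V g l| ≤ (a : ℝ) - V l 0 := by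
      have : A ≤ a - V l 0 := by omega
      have := Int.ceil_le.1 this
      push_cast at this; exact this
    have h2 : |apexX V g r| ≤ (V r 0 : ℝ) - a := by
      have : B ≤ V r 0 - a := by omega
      have := Int.ceil_le.1 this
      push_cast at this; exact this
    obtain ⟨y, hy1, hy2⟩ := exists_slice hV hl1 hl2 (hs1 l) (hs2 l)
    obtain ⟨z, hz1, hz2⟩ := exists_slice hV.neg (i := r) (g := g) (by rw [e1]; omega)
      (by rw [e1]; omega) (by rw [e1, abs_neg, ecrs]; exact hs1 r)
      (by rw [e1, abs_neg, ecrs]; exact hs2 r)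
    rw [apexX_neg] at hz1 hz2
    have hxr : ((-V) r 0 : ℝ) + |apexX V g r| = -((V r 0 : ℝ) - |apexX V g r|) := by
      simp only [Pi.neg_apply]; push_cast; ring
    have hz1' : ∀ k, 0 ≤ side V k (V r 0 - |apexX V g r|) (-z) := by
      intro k
      have := hz1 k
      rwa [hxr, ← neg_neg z, side_neg] at this
    have hz2' : ∀ k, 0 ≤ side V k (V r 0 - |apexX V g r|) (-(z + g)) := by
      intro k
      have := hz2 k
      rwa [hxr, ← neg_neg (z + (g : ℝ)), side_neg] at this
    set x1 := (V l 0 : ℝ) + |apexX V g l| with hx1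
    set x2 := (V r 0 : ℝ) - |apexX V g r| with hx2
    obtain ⟨s, t, hs, ht, hst, hcomb⟩ : ∃ s t : ℝ, 0 ≤ s ∧ 0 ≤ t ∧ s + t = 1 ∧
        s * x1 + t * x2 = a := by
      have : (a : ℝ) ∈ segment ℝ x1 x2 := by
        rw [segment_eq_Icc (by linarith)]
        exact ⟨by linarith, by linarith⟩
      obtain ⟨s, t, hs, ht, hst, h⟩ := this
      exact ⟨s, t, hs, ht, hst, by simpa using h⟩
    have hge : g ≤ colCount V a := by
      refine le_colCount hV (y := s * y + t * (-(z + g))) (fun k => ?_) (fun k => ?_)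
      · rw [← hcomb, side_combo k hst]
        exact add_nonneg (mul_nonneg hs (hy1 k)) (mul_nonneg ht (hz2' k))
      · have : s * y + t * (-(z + g)) + g = s * (y + g) + t * (-z) := by
          linear_combination (-(g : ℝ)) * hst
        rw [← hcomb, this, side_combo k hst]
        exact add_nonneg (mul_nonneg hs (hy2 k)) (mul_nonneg ht (hz1' k))
    rw [Nat.sub_eq_zero_of_le hge]; rfl
  have hdef : ∑ a ∈ Finset.Icc (V l 0) (V r 0), ((g - colCount V a : ℕ) : ℤ) =
      ∑ a ∈ Finset.Ico (V l 0) (V l 0 + A), ((g - colCount V a : ℕ) : ℤ) +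
      ∑ a ∈ Finset.Ioc (V r 0 - B) (V r 0), ((g - colCount V a : ℕ) : ℤ) := by
    rw [← Finset.sum_union hdisj]
    exact (Finset.sum_subset hsub hmid).symm
  have hcorner : (∑ i, if edge V (i - 1) 0 * edge V i 0 < 0 then
        (g : ℤ) - 1 + triangleSum (apexX V g i) (apexY V g i) g else 0) =
      (if edge V (l - 1) 0 * edge V l 0 < 0 then
        (g : ℤ) - 1 + triangleSum (apexX V g l) (apexY V g l) g else 0) +
      if edge V (r - 1) 0 * edge V r 0 < 0 then
        (g : ℤ) - 1 + triangleSum (apexX V g r) (apexY V g r) g else 0 := by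
    rw [← Finset.sum_pair (f := fun i => if edge V (i - 1) 0 * edge V i 0 < 0 then
      (g : ℤ) - 1 + triangleSum (apexX V g i) (apexY V g i) g else 0) hlr]
    symm
    apply Finset.sum_subset (Finset.subset_univ _)
    intro i _ hi
    rw [if_neg]
    intro hneg
    apply hi
    rw [Finset.mem_insert, Finset.mem_singleton]
    rcases mul_neg_iff.1 hneg with ⟨u1, u2⟩ | ⟨u1, u2⟩
    · right
      apply hru i
      constructor
      · rw [neg_lt_zero]; exact_mod_cast u1
      · rw [neg_nonneg]; exact_mod_cast u2.le
    · left
      apply hlu i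
      exact ⟨by exact_mod_cast u1, by exact_mod_cast u2.le⟩
  rw [hcorner, ← hleft, ← hright, ← hdef, bondCount_eq_sum hV hl hr, pointCount_eq_sum hV hl hr,
    ← Finset.mul_sum, ← two_mul_width hV hl hr]
  have hpt : ∀ a, ((colCount V a - g : ℕ) : ℤ) = colCount V a - g + ((g - colCount V a : ℕ) : ℤ) :=
    fun a => by omega
  rw [Nat.cast_sum, Nat.cast_sum, Finset.sum_congr rfl fun a _ => hpt a]
  rw [Finset.sum_add_distrib, Finset.sum_sub_distrib, Finset.sum_const, Int.card_Icc,
    nsmul_eq_mul, Int.toNat_of_nonneg (by have := hl r; omega)]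
  ring

end Count

/-! ### Bonds of a dilated polygon -/

theorem mul_neg_iff_of_pos {R : Type*} [Ring R] [LinearOrder R] [IsStrictOrderedRing R] {a b : R}
    (ha : 0 < a) : a * b < 0 ↔ b < 0 := by
  rw [mul_neg_iff]
  exact ⟨fun h => h.elim And.right fun h => absurd h.1 ha.not_gt, fun h => Or.inl ⟨ha, h⟩⟩

theorem inner_plane (x y : Plane) : inner ℝ x y = x 0 * y 0 + x 1 * y 1 := by
  rw [PiLp.inner_apply, Fin.sum_univ_two]
  simp only [RCLike.inner_apply, conj_trivial]
  ring

@[simp] theorem toPlane_zero (w : Lat) : toPlane w 0 = w 0 := rfl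

@[simp] theorem toPlane_one (w : Lat) : toPlane w 1 = w 1 := rfl

@[simp] theorem latPerp_zero (w : Lat) : latPerp w 0 = w 1 := rfl

@[simp] theorem latPerp_one (w : Lat) : latPerp w 1 = -w 0 := rfl

theorem latGcd_pos {w : Lat} (hw : w ≠ 0) : 0 < latGcd w := by
  rw [Nat.pos_iff_ne_zero]
  intro h
  rw [latGcd, Int.gcd_eq_zero_iff] at h
  apply hw
  ext t; fin_cases t
  · exact h.1
  · exact h.2

theorem latGcd_mul_prim (w : Lat) (t : Fin 2) : (latGcd w : ℤ) * prim w t = w t := by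
  fin_cases t
  · exact Int.mul_ediv_cancel' (Int.gcd_dvd_left (w 0) (w 1))
  · exact Int.mul_ediv_cancel' (Int.gcd_dvd_right (w 0) (w 1))

theorem norm_toPlane_sq (w : Lat) : ‖toPlane w‖ ^ 2 = (w 0 : ℝ) ^ 2 + (w 1 : ℝ) ^ 2 := by
  rw [← real_inner_self_eq_norm_sq, inner_plane]
  simp only [toPlane_zero, toPlane_one]; ring

theorem toPlane_ne_zero {w : Lat} (hw : w ≠ 0) : toPlane w ≠ 0 := by
  intro h
  apply hw
  ext t
  have := congrFun (congrArg (fun x : Plane => (x : Fin 2 → ℝ)) h) t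
  fin_cases t
  · simpa using this
  · simpa using this

theorem norm_toPlane_latPerp (w : Lat) : ‖toPlane (latPerp w)‖ = ‖toPlane w‖ := by
  rw [← sq_eq_sq₀ (norm_nonneg _) (norm_nonneg _), norm_toPlane_sq, norm_toPlane_sq]
  simp only [latPerp_zero, latPerp_one]; push_cast; ring

section

variable {N : ℕ} [NeZero N] {v : Fin N → Lat}

theorem latGcd_smul_millerNormal (v : Fin N → Lat) (i : Fin N) :
    toPlane (latPerp (edge v i)) = (latGcd (edge v i) : ℝ) • toPlane (millerNormal v i) := by
  have h := latGcd_mul_prim (edge v i)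
  have h0 : (latGcd (edge v i) : ℝ) * prim (edge v i) 0 = edge v i 0 := by exact_mod_cast h 0
  have h1 : (latGcd (edge v i) : ℝ) * prim (edge v i) 1 = edge v i 1 := by exact_mod_cast h 1
  ext t
  fin_cases t
  · simp only [Fin.zero_eta, toPlane_zero, latPerp_zero, PiLp.smul_apply, smul_eq_mul]
    exact h1.symm
  · simp only [Fin.mk_one, toPlane_one, latPerp_one, PiLp.smul_apply, smul_eq_mul]
    change ((-edge v i 0 : ℤ) : ℝ) = _ * ((-prim (edge v i) 0 : ℤ) : ℝ)
    push_cast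
    linarith

theorem unitNormal_eq (hv : IsConvexLatticePolygon v) (i : Fin N) :
    unitNormal v i = ‖toPlane (edge v i)‖⁻¹ • toPlane (latPerp (edge v i)) := by
  have hg : (0 : ℝ) < latGcd (edge v i) := by exact_mod_cast latGcd_pos (hv.edge_ne_zero i)
  rw [← norm_toPlane_latPerp, latGcd_smul_millerNormal, norm_smul, smul_smul, unitNormal]
  congr 1
  rw [Real.norm_eq_abs, abs_of_pos hg]
  field_simp

theorem norm_edge_pos (hv : IsConvexLatticePolygon v) (i : Fin N) : 0 < ‖toPlane (edge v i)‖ :=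
  norm_pos_iff.2 (toPlane_ne_zero (hv.edge_ne_zero i))

theorem inner_unitNormal (hv : IsConvexLatticePolygon v) (i : Fin N) (w : Lat) :
    inner ℝ (toPlane w) (unitNormal v i) = -(‖toPlane (edge v i)‖⁻¹ * crs (edge v i) w) := by
  rw [unitNormal_eq hv, inner_smul_right, inner_plane]
  simp only [toPlane_zero, toPlane_one, latPerp_zero, latPerp_one, crs]
  push_cast; ring

theorem sectorStep_eq (hv : IsConvexLatticePolygon v) (i : Fin N) (w : Lat) :
    sectorStep (unitNormal v i) (unitNormal v (i - 1)) w =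
      if crs (edge v (i - 1)) w * crs (edge v i) w < 0 then 1 else 0 := by
  have h1 := inv_pos.2 (norm_edge_pos hv i)
  have h2 := inv_pos.2 (norm_edge_pos hv (i - 1))
  rw [sectorStep, inner_unitNormal hv, inner_unitNormal hv]
  have : (-(‖toPlane (edge v i)‖⁻¹ * (crs (edge v i) w : ℝ)) *
      -(‖toPlane (edge v (i - 1))‖⁻¹ * (crs (edge v (i - 1)) w : ℝ)) < 0) ↔
      crs (edge v (i - 1)) w * crs (edge v i) w < 0 := by
    rw [show (-(‖toPlane (edge v i)‖⁻¹ * (crs (edge v i) w : ℝ)) *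
      -(‖toPlane (edge v (i - 1))‖⁻¹ * (crs (edge v (i - 1)) w : ℝ))) =
      (‖toPlane (edge v i)‖⁻¹ * ‖toPlane (edge v (i - 1))‖⁻¹) *
        ((crs (edge v (i - 1)) w : ℝ) * crs (edge v i) w) by ring,
      mul_neg_iff_of_pos (mul_pos h1 h2)]
    exact_mod_cast Iff.rfl
  simp only [this]

/-- The apex of the triangle is the intersection of the two lines parallel to the edges. -/
theorem apex_eq (hv : IsConvexLatticePolygon v) (i : Fin N) (w : Lat) :
    apex w (unitNormal v i) (unitNormal v (i - 1)) =
      ((crs (edge v (i - 1)) w : ℝ) / crs (edge v (i - 1)) (edge v i)) • toPlane (edge v i) := by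
  have h1 := norm_edge_pos hv i
  have h2 := norm_edge_pos hv (i - 1)
  have hD : (0 : ℝ) < crs (edge v (i - 1)) (edge v i) := by exact_mod_cast hv.turn_pos i
  have hp : perp (unitNormal v i) = (-‖toPlane (edge v i)‖⁻¹) • toPlane (edge v i) := by
    rw [unitNormal_eq hv]
    ext t
    fin_cases t
    · simp [toPlane, latPerp, perp]
    · simp [toPlane, latPerp, perp]
  have hi : inner ℝ (unitNormal v (i - 1)) (perp (unitNormal v i)) =
      ‖toPlane (edge v i)‖⁻¹ * ‖toPlane (edge v (i - 1))‖⁻¹ * crs (edge v (i - 1)) (edge v i) := by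
    rw [hp, inner_smul_right, real_inner_comm, inner_unitNormal hv]; ring
  rw [apex, hi, hp, real_inner_comm, inner_unitNormal hv, smul_smul]
  congr 1
  field_simp

/-- The coordinates adapted to `w`, in which `w` becomes `(0, gcd w)`. -/
def adapted (w : Lat) : Lat → Lat :=
  slMap (prim w 1) (-prim w 0) (complement w 1) (-complement w 0)

theorem adapted_det {w : Lat} (hw : w ≠ 0) :
    prim w 1 * -complement w 0 - -prim w 0 * complement w 1 = 1 := by
  have h := prim_complement w hw
  simp only [dotProduct, Fin.sum_univ_two, latPerp_zero, latPerp_one] at h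
  linarith

theorem adapted_self {w : Lat} (hw : w ≠ 0) : adapted w w = ![0, (latGcd w : ℤ)] := by
  have h0 := latGcd_mul_prim w 0
  have h1 := latGcd_mul_prim w 1
  have hd := adapted_det hw
  ext t
  fin_cases t
  · simp only [adapted, Fin.zero_eta, slMap_zero, Matrix.cons_val_zero]
    rw [← h0, ← h1]; ring
  · simp only [adapted, Fin.mk_one, slMap_one]
    change _ = (latGcd w : ℤ)
    rw [← h0, ← h1]; linear_combination (latGcd w : ℤ) * hd

theorem latGcd_mul_adapted {w : Lat} (hw : w ≠ 0) (x : Lat) :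
    (latGcd w : ℤ) * adapted w x 0 = crs x w := by
  have h := crs_slMap (adapted_det hw) x w
  rw [← h]
  change _ = crs (adapted w x) (adapted w w)
  rw [adapted_self hw]
  simp only [crs, Matrix.cons_val_zero, Matrix.cons_val_one]; ring

theorem cornerCount_eq (hv : IsConvexLatticePolygon v) {w : Lat} (hw : w ≠ 0) (i : Fin N) :
    cornerCount w (unitNormal v i) (unitNormal v (i - 1)) =
      triangleSum (apexX (adapted w ∘ v) (latGcd w) i) (apexY (adapted w ∘ v) (latGcd w) i)
        (latGcd w) := by
  have hD := crs_slMap (adapted_det hw) (edge v (i - 1)) (edge v i)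
  have hg := latGcd_mul_adapted hw (edge v (i - 1))
  have hg' : (latGcd w : ℝ) * adapted w (edge v (i - 1)) 0 = crs (edge v (i - 1)) w := by
    exact_mod_cast hg
  have he : ∀ j, edge (adapted w ∘ v) j = adapted w (edge v j) := fun j => edge_slMap v j
  rw [cornerCount, apex_eq hv, apexX, apexY, he, he]
  change crs (adapted w _) (adapted w _) = _ at hD
  rw [hD, hg']
  congr 1
  · rw [inner_smul_left, inner_plane, conj_trivial]
    simp only [adapted, toPlane_zero, toPlane_one, latPerp_zero, latPerp_one, slMap_zero]
    push_cast; ring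
  · rw [inner_smul_left, inner_plane, conj_trivial]
    simp only [adapted, toPlane_zero, toPlane_one, latPerp_zero, latPerp_one, slMap_one]
    push_cast; ring

theorem edge_smul (k : ℕ) (v : Fin N → Lat) (i : Fin N) : edge (k • v) i = k • edge v i := by
  simp only [edge, Pi.smul_apply, smul_sub]

theorem crs_smul_left (k : ℕ) (x y : Lat) : crs (k • x) y = k * crs x y := by
  simp only [crs, Pi.smul_apply, nsmul_eq_mul]; ring

theorem crs_smul_right (k : ℕ) (x y : Lat) : crs x (k • y) = k * crs x y := by
  simp only [crs, Pi.smul_apply, nsmul_eq_mul]; ring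

theorem IsConvexLatticePolygon.smul (hv : IsConvexLatticePolygon v) {k : ℕ} (hk : 0 < k) :
    IsConvexLatticePolygon (k • v) where
  three_le := hv.three_le
  left_of_edge i j h1 h2 := by
    have h := hv.crs_pos h1 h2
    have hk' : (0 : ℤ) < k := by exact_mod_cast hk
    have e : crs (edge (k • v) i) ((k • v) j - (k • v) i) =
        k * (k * crs (edge v i) (v j - v i)) := by
      rw [edge_smul, Pi.smul_apply, Pi.smul_apply, ← smul_sub, crs_smul_left, crs_smul_right]
    have : 0 < crs (edge (k • v) i) ((k • v) j - (k • v) i) := by rw [e]; positivity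
    exact this

theorem latGcd_smul (k : ℕ) (w : Lat) : latGcd (k • w) = k * latGcd w := by
  simp only [latGcd, Pi.smul_apply, nsmul_eq_mul]
  rw [Int.gcd_mul_left, Int.natAbs_natCast]

/-- The area of the polygon, by the shoelace formula. -/
def shoelace (v : Fin N → Lat) : ℝ := (∑ i, (crs (v i) (v (i + 1)) : ℝ)) / 2

theorem pointCount_smul (hv : IsConvexLatticePolygon v) {k : ℕ} (hk : 0 < k) :
    (pointCount (k • v) : ℝ) =
      shoelace v * k ^ 2 + k / 2 * ∑ i, (latGcd (edge v i) : ℝ) + 1 := by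
  have h := pick (hv.smul hk)
  have h' : (2 : ℝ) * pointCount (k • v) = ∑ i, (crs ((k • v) i) ((k • v) (i + 1)) : ℝ) +
      ∑ i, (latGcd (edge (k • v) i) : ℝ) + 2 := by exact_mod_cast h
  simp only [Pi.smul_apply, crs_smul_left, crs_smul_right, edge_smul, latGcd_smul] at h'
  push_cast at h'
  rw [← Finset.mul_sum, ← Finset.mul_sum, ← Finset.mul_sum] at h'
  rw [shoelace]; linarith

/-- The number of bonds in the direction `w` in the dilated polygon `k • v`, once the polygon is
large compared with `w`. -/
theorem bondCount_smul (hv : IsConvexLatticePolygon v) {k : ℕ} (hk : 0 < k) {w : Lat} (hw : w ≠ 0)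
    (hs : ∀ i, 2 * |crs (edge v i) w| ≤ k) :
    (bondCount (k • v) w : ℝ) = shoelace v * k ^ 2 +
      k / 2 * ∑ i, ((latGcd (edge v i) : ℝ) - |(crs (edge v i) w : ℝ)|) - ((latGcd w : ℝ) - 1) +
      ∑ i, sectorStep (unitNormal v i) (unitNormal v (i - 1)) w *
        ((latGcd w : ℝ) - 1 + cornerCount w (unitNormal v i) (unitNormal v (i - 1))) := by
  have hg : 0 < latGcd w := latGcd_pos hw
  have hgZ : (0 : ℤ) < latGcd w := by exact_mod_cast hg
  have hdet := adapted_det hw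
  have hkv := hv.smul hk
  have hk' : (0 : ℤ) < k := by exact_mod_cast hk
  have hkR : (0 : ℝ) < k := by exact_mod_cast hk
  have hV : IsConvexLatticePolygon (adapted w ∘ (k • v)) := hkv.slMap hdet
  have hedge : ∀ i, edge (adapted w ∘ (k • v)) i = adapted w (k • edge v i) := fun i => by
    rw [← edge_smul]; exact edge_slMap _ i
  have hcr : ∀ x y, crs (adapted w x) (adapted w y) = crs x y := crs_slMap hdet
  have hcrs : ∀ i, (latGcd w : ℤ) * edge (adapted w ∘ (k • v)) i 0 = k * crs (edge v i) w := by
    intro i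
    rw [hedge, latGcd_mul_adapted hw, crs_smul_left]
  have habs : ∀ i, (latGcd w : ℤ) * |edge (adapted w ∘ (k • v)) i 0| =
      k * |crs (edge v i) w| := by
    intro i
    rw [show (latGcd w : ℤ) * |edge (adapted w ∘ (k • v)) i 0| =
      |(latGcd w : ℤ) * edge (adapted w ∘ (k • v)) i 0| by rw [abs_mul, abs_of_pos hgZ],
      hcrs, abs_mul, abs_of_pos hk']
  have hturn : ∀ i, (k : ℤ) * k ≤ crs (edge (adapted w ∘ (k • v)) (i - 1))
      (edge (adapted w ∘ (k • v)) i) := by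
    intro i
    rw [hedge, hedge, hcr, crs_smul_left, crs_smul_right]
    have : 1 ≤ crs (edge v (i - 1)) (edge v i) := hv.turn_pos i
    nlinarith [mul_pos hk' hk']
  have hsmall : ∀ i, 2 * (latGcd w : ℤ) * |edge (adapted w ∘ (k • v)) i 0| ≤ k * k := by
    intro i
    rw [mul_assoc, habs]
    nlinarith [hs i]
  have h := bondCount_vertical hV hg (fun i => (hsmall (i - 1)).trans (hturn i))
    (fun i => (hsmall i).trans (hturn i))
  rw [← adapted_self hw, adapted, bondCount_slMap hdet, pointCount_slMap hdet, ← adapted] at h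
  have hapex : ∀ i, apexX (adapted w ∘ (k • v)) (latGcd w) i =
        apexX (adapted w ∘ v) (latGcd w) i ∧
      apexY (adapted w ∘ (k • v)) (latGcd w) i = apexY (adapted w ∘ v) (latGcd w) i := by
    intro i
    have e1 : ∀ j, edge (adapted w ∘ v) j = adapted w (edge v j) := fun j => edge_slMap v j
    have e2 : ∀ x t, (adapted w (k • x) t : ℝ) = k * adapted w x t := by
      intro x t
      fin_cases t <;> simp [adapted, slMap] <;> ring
    have hD : (0 : ℝ) < crs (edge v (i - 1)) (edge v i) := by exact_mod_cast hv.turn_pos i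
    constructor
    · simp only [apexX, hedge, e1, hcr, crs_smul_left, crs_smul_right, e2]
      push_cast
      field_simp
    · simp only [apexY, hedge, e1, hcr, crs_smul_left, crs_smul_right, e2]
      push_cast
      field_simp
  have hsign : ∀ i, edge (adapted w ∘ (k • v)) (i - 1) 0 * edge (adapted w ∘ (k • v)) i 0 < 0 ↔
      crs (edge v (i - 1)) w * crs (edge v i) w < 0 := by
    intro i
    have e : ((latGcd w : ℤ) * latGcd w) * (edge (adapted w ∘ (k • v)) (i - 1) 0 *
        edge (adapted w ∘ (k • v)) i 0) =
        ((k : ℤ) * k) * (crs (edge v (i - 1)) w * crs (edge v i) w) := by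
      have h1 := hcrs (i - 1)
      have h2 := hcrs i
      calc _ = ((latGcd w : ℤ) * edge (adapted w ∘ (k • v)) (i - 1) 0) *
            ((latGcd w : ℤ) * edge (adapted w ∘ (k • v)) i 0) := by ring
        _ = _ := by rw [h1, h2]; ring
    rw [← mul_neg_iff_of_pos (mul_pos hgZ hgZ), e,
      mul_neg_iff_of_pos (mul_pos hk' hk')]
  have hterm : ∀ i, ((if edge (adapted w ∘ (k • v)) (i - 1) 0 *
        edge (adapted w ∘ (k • v)) i 0 < 0 then
        (latGcd w : ℤ) - 1 + triangleSum (apexX (adapted w ∘ (k • v)) (latGcd w) i)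
          (apexY (adapted w ∘ (k • v)) (latGcd w) i) (latGcd w) else 0 : ℤ) : ℝ) =
      sectorStep (unitNormal v i) (unitNormal v (i - 1)) w *
        ((latGcd w : ℝ) - 1 + cornerCount w (unitNormal v i) (unitNormal v (i - 1))) := by
    intro i
    rw [sectorStep_eq hv, cornerCount_eq hv hw, (hapex i).1, (hapex i).2]
    simp only [hsign]
    split_ifs
    · push_cast; ring
    · simp
  have hR : (2 : ℝ) * bondCount (k • v) w = 2 * pointCount (k • v) -
      ∑ i, (k : ℝ) * |(crs (edge v i) w : ℝ)| - 2 * latGcd w +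
      2 * ∑ i, sectorStep (unitNormal v i) (unitNormal v (i - 1)) w *
        ((latGcd w : ℝ) - 1 + cornerCount w (unitNormal v i) (unitNormal v (i - 1))) := by
    rw [← Finset.sum_congr rfl fun i _ => hterm i]
    simp only [habs] at h
    exact_mod_cast h
  rw [pointCount_smul hv hk, ← Finset.mul_sum] at hR
  rw [Finset.sum_sub_distrib]
  linarith

end

/-! ### The polygon as a subset of the plane -/

section

variable {N : ℕ} [NeZero N] {v : Fin N → Lat}

theorem side_nonneg_convex (v : Fin N → Lat) (i : Fin N) :
    Convex ℝ {x : Plane | 0 ≤ side v i (x 0) (x 1)} := by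
  intro x hx y hy s t hs ht hst
  have := side_combo (V := v) i hst (x 0) (x 1) (y 0) (y 1)
  change 0 ≤ side v i (s * x 0 + t * y 0) (s * x 1 + t * y 1)
  rw [this]
  exact add_nonneg (mul_nonneg hs hx) (mul_nonneg ht hy)

/-- A convex polygon is the intersection of the half-planes of its edges: a linear functional
that separates a point from the vertices is minimal at some vertex, and there the point is
a nonnegative combination of the two edge directions. -/
theorem mem_polygon (hv : IsConvexLatticePolygon v) (x : Plane) :
    x ∈ polygon v ↔ ∀ i, 0 ≤ side v i (x 0) (x 1) := by
  constructor
  · intro hx i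
    have : polygon v ⊆ {x : Plane | 0 ≤ side v i (x 0) (x 1)} := by
      apply convexHull_min _ (side_nonneg_convex v i)
      rintro _ ⟨j, rfl⟩
      exact hv.side_vertex_nonneg i j
    exact this hx
  · intro hx
    by_contra hn
    have hcl : IsClosed (polygon v) := ((Set.finite_range _).isCompact_convexHull ℝ).isClosed
    obtain ⟨f, u, hfu, hf⟩ := geometric_hahn_banach_point_closed (convex_convexHull ℝ _) hcl hn
    have hfx : ∀ y : Plane, f y = f !₂[1, 0] * y 0 + f !₂[0, 1] * y 1 := by
      intro y
      have : y = y 0 • !₂[(1 : ℝ), 0] + y 1 • !₂[(0 : ℝ), 1] := by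
        ext t; fin_cases t <;> simp
      conv_lhs => rw [this]
      rw [map_add, map_smul, map_smul, smul_eq_mul, smul_eq_mul]; ring
    obtain ⟨i, hi⟩ := exists_lin_le hv (f !₂[1, 0]) (f !₂[0, 1]) hx
    have h1 := hf (toPlane (v i)) (subset_convexHull ℝ _ ⟨i, rfl⟩)
    rw [← hfx] at hi
    have h2 : f (toPlane (v i)) = lin (f !₂[1, 0]) (f !₂[0, 1]) (v i) := hfx _
    linarith

theorem polygon_isCompact {N : ℕ} (v : Fin N → Lat) : IsCompact (polygon v) :=
  (Set.finite_range _).isCompact_convexHull ℝ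

theorem mem_smul_polygon (hv : IsConvexLatticePolygon v) {k : ℕ} (hk : 0 < k) (x : Lat) :
    toPlane x ∈ (k : ℝ) • polygon v ↔ Inside (k • v) x := by
  have hk' : (0 : ℝ) < k := by exact_mod_cast hk
  rw [Set.mem_smul_set_iff_inv_smul_mem₀ hk'.ne', mem_polygon hv]
  refine forall_congr' fun i => ?_
  have : (crs (edge (k • v) i) (x - (k • v) i) : ℝ) =
      (k * k) * side v i (((k : ℝ)⁻¹ • toPlane x) 0) (((k : ℝ)⁻¹ • toPlane x) 1) := by
    rw [edge_smul, crs_smul_left]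
    have e : ∀ t, (k • v) i t = k * v i t := fun t => by
      rw [Pi.smul_apply, Pi.smul_apply, nsmul_eq_mul]
    simp only [crs, side, PiLp.smul_apply, toPlane_zero, toPlane_one, smul_eq_mul, Pi.sub_apply,
      e]
    push_cast
    field_simp
  rw [← Int.cast_nonneg_iff (R := ℝ), this, mul_nonneg_iff_of_pos_left (mul_pos hk' hk')]

theorem side_segment {i : Fin N} {x : Plane}
    (hx : x ∈ segment ℝ (toPlane (v i)) (toPlane (v (i + 1)))) : side v i (x 0) (x 1) = 0 := by
  obtain ⟨s, t, hs, ht, hst, rfl⟩ := hx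
  have := side_combo (V := v) i hst (v i 0) (v i 1) (v (i + 1) 0) (v (i + 1) 1)
  change side v i (s * v i 0 + t * v (i + 1) 0) (s * v i 1 + t * v (i + 1) 1) = 0
  rw [this]
  simp only [side, edge, Pi.sub_apply]; push_cast; ring

theorem mem_segment_of_side_eq_zero (hv : IsConvexLatticePolygon v) {i : Fin N} {x : Plane}
    (hx : x ∈ polygon v) (h0 : side v i (x 0) (x 1) = 0) :
    x ∈ segment ℝ (toPlane (v i)) (toPlane (v (i + 1))) := by
  rw [mem_polygon hv] at hx
  have hD : (0 : ℝ) < crs (edge v (i - 1)) (edge v i) := by exact_mod_cast hv.turn_pos i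
  have hD' : (0 : ℝ) < crs (edge v i) (edge v (i + 1)) := by
    have := hv.turn_pos (i + 1)
    rw [add_sub_cancel_right] at this
    exact_mod_cast this
  set s := side v (i - 1) (x 0) (x 1) / crs (edge v (i - 1)) (edge v i) with hs
  set r := side v (i + 1) (x 0) (x 1) / crs (edge v i) (edge v (i + 1)) with hr
  have hs0 : 0 ≤ s := div_nonneg (hx _) hD.le
  have hr0 : 0 ≤ r := div_nonneg (hx _) hD'.le
  have key : ∀ p q : ℝ, p * (x 0 - v i 0) + q * (x 1 - v i 1) = s * lin p q (edge v i) := by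
    intro p q
    have := turn_mul_lin v i p q (x 0) (x 1)
    rw [h0, zero_mul, sub_zero] at this
    rw [hs, div_mul_eq_mul_div, eq_div_iff hD.ne']
    linarith
  have key' : ∀ p q : ℝ, p * (x 0 - v (i + 1) 0) + q * (x 1 - v (i + 1) 1) =
      -(r * lin p q (edge v i)) := by
    intro p q
    have := turn_mul_lin v (i + 1) p q (x 0) (x 1)
    rw [add_sub_cancel_right, h0, zero_mul, zero_sub] at this
    rw [hr, div_mul_eq_mul_div, eq_comm, neg_eq_iff_eq_neg, div_eq_iff hD'.ne']
    linarith
  have hs1 : s + r = 1 := by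
    have a1 := key 1 0
    have a2 := key 0 1
    have b1 := key' 1 0
    have b2 := key' 0 1
    simp only [lin, edge, Pi.sub_apply, one_mul, zero_mul, add_zero, zero_add] at a1 a2 b1 b2
    push_cast at a1 a2 b1 b2
    by_contra hne
    apply hv.edge_ne_zero i
    have hne' : s + r - 1 ≠ 0 := sub_ne_zero.2 hne
    ext t
    fin_cases t
    · have : ((v (i + 1) 0 : ℝ) - v i 0) = 0 := by
        apply mul_left_cancel₀ hne'
        linear_combination b1 - a1
      simp only [edge, Fin.zero_eta, Pi.sub_apply, Pi.zero_apply]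
      exact_mod_cast this
    · have : ((v (i + 1) 1 : ℝ) - v i 1) = 0 := by
        apply mul_left_cancel₀ hne'
        linear_combination b2 - a2
      simp only [edge, Fin.mk_one, Pi.sub_apply, Pi.zero_apply]
      exact_mod_cast this
  refine ⟨r, s, hr0, hs0, by linarith, ?_⟩
  have a1 := key 1 0
  have a2 := key 0 1
  simp only [lin, edge, Pi.sub_apply, one_mul, zero_mul, add_zero, zero_add] at a1 a2
  push_cast at a1 a2
  have hr1 : r = 1 - s := by linarith
  rw [hr1]
  ext t
  fin_cases t
  · change (1 - s) * (v i 0 : ℝ) + s * v (i + 1) 0 = x 0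
    linarith
  · change (1 - s) * (v i 1 : ℝ) + s * v (i + 1) 1 = x 1
    linarith

theorem continuous_side (v : Fin N → Lat) (i : Fin N) :
    Continuous fun x : Plane => side v i (x 0) (x 1) := by
  unfold side
  fun_prop

theorem segment_subset_polygon (v : Fin N → Lat) (i : Fin N) :
    segment ℝ (toPlane (v i)) (toPlane (v (i + 1))) ⊆ polygon v :=
  segment_subset_convexHull ⟨i, rfl⟩ ⟨i + 1, rfl⟩

theorem frontier_polygon (hv : IsConvexLatticePolygon v) :
    frontier (polygon v) = ⋃ i, segment ℝ (toPlane (v i)) (toPlane (v (i + 1))) := by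
  rw [(polygon_isCompact v).isClosed.frontier_eq]
  ext x
  rw [Set.mem_iUnion]
  constructor
  · rintro ⟨hx, hxi⟩
    have : ∃ i, side v i (x 0) (x 1) = 0 := by
      by_contra! hne
      apply hxi
      rw [mem_interior]
      refine ⟨⋂ i, {x : Plane | 0 < side v i (x 0) (x 1)}, fun y hy => ?_,
        isOpen_iInter_of_finite fun i => isOpen_lt continuous_const (continuous_side v i), ?_⟩
      · rw [mem_polygon hv]
        exact fun i => (Set.mem_iInter.1 hy i).le
      · rw [mem_polygon hv] at hx
        exact Set.mem_iInter.2 fun i => lt_of_le_of_ne (hx i) (hne i).symm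
    obtain ⟨i, hi⟩ := this
    exact ⟨i, mem_segment_of_side_eq_zero hv hx hi⟩
  · rintro ⟨i, hi⟩
    refine ⟨segment_subset_polygon v i hi, fun hint => ?_⟩
    -- move out of the polygon along the outward normal
    set z : Plane := !₂[-(edge v i 1 : ℝ), edge v i 0] with hz
    have hc : Continuous fun t : ℝ => x - t • z := by fun_prop
    have h1 : ∀ᶠ t in nhds (0 : ℝ), x - t • z ∈ interior (polygon v) := by
      apply hc.continuousAt.eventually_mem
      simpa using isOpen_interior.mem_nhds hint
    obtain ⟨t, ht, ht0⟩ := ((h1.filter_mono nhdsWithin_le_nhds).and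
      (self_mem_nhdsWithin : Set.Ioi (0 : ℝ) ∈ nhdsWithin 0 (Set.Ioi 0))).exists
    have h2 := (mem_polygon hv _).1 (interior_subset ht) i
    have h3 : side v i ((x - t • z) 0) ((x - t • z) 1) =
        side v i (x 0) (x 1) - t * ((edge v i 0 : ℝ) ^ 2 + (edge v i 1 : ℝ) ^ 2) := by
      change side v i (x 0 - t * -(edge v i 1 : ℝ)) (x 1 - t * (edge v i 0 : ℝ)) = _
      simp only [side]; ring
    rw [h3, side_segment hi, ← norm_toPlane_sq] at h2
    have := norm_edge_pos hv i
    have : 0 < t * ‖toPlane (edge v i)‖ ^ 2 := mul_pos ht0 (by positivity)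
    linarith

end

/-! ### The boundary integral -/

section Boundary

open MeasureTheory

variable {N : ℕ} [NeZero N] {v : Fin N → Lat}

theorem toPlane_sub (x y : Lat) : toPlane (x - y) = toPlane x - toPlane y := by
  ext t; fin_cases t <;> simp [toPlane]

theorem vertex_ne (hv : IsConvexLatticePolygon v) (i : Fin N) :
    toPlane (v i) ≠ toPlane (v (i + 1)) := by
  intro h
  apply toPlane_ne_zero (hv.edge_ne_zero i)
  rw [edge, toPlane_sub, h, sub_self]

theorem openSegment_disjoint (hv : IsConvexLatticePolygon v) {i j : Fin N} {x : Plane}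
    (hi : x ∈ openSegment ℝ (toPlane (v i)) (toPlane (v (i + 1))))
    (hj : x ∈ openSegment ℝ (toPlane (v j)) (toPlane (v (j + 1)))) : i = j := by
  have h0 := side_segment (openSegment_subset_segment ℝ _ _ hj)
  obtain ⟨s, t, hs, ht, hst, rfl⟩ := hi
  have h1 := side_combo (V := v) j hst (v i 0) (v i 1) (v (i + 1) 0) (v (i + 1) 1)
  change side v j (s * v i 0 + t * v (i + 1) 0) (s * v i 1 + t * v (i + 1) 1) = 0 at h0
  rw [h0] at h1
  have a1 := mul_nonneg hs.le (hv.side_vertex_nonneg j i)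
  have a2 := mul_nonneg ht.le (hv.side_vertex_nonneg j (i + 1))
  have b1 : side v j (v i 0) (v i 1) = 0 :=
    (mul_eq_zero.1 (by linarith)).resolve_left hs.ne'
  have b2 : side v j (v (i + 1) 0) (v (i + 1) 1) = 0 :=
    (mul_eq_zero.1 (by linarith)).resolve_left ht.ne'
  rw [side_lattice] at b1 b2
  rcases hv.eq_of_crs_eq_zero (by exact_mod_cast b1) with h | h
  · exact h
  rcases hv.eq_of_crs_eq_zero (by exact_mod_cast b2) with h' | h'
  · exfalso
    apply hv.two_ne_zero
    rw [h, add_assoc] at h'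
    simpa using h'
  · exact add_right_cancel h'

theorem boundaryNormal_eq (hv : IsConvexLatticePolygon v) {i : Fin N} {x : Plane}
    (hi : x ∈ openSegment ℝ (toPlane (v i)) (toPlane (v (i + 1)))) :
    boundaryNormal v x = millerNormal v i := by
  have h : ∃ i, x ∈ openSegment ℝ (toPlane (v i)) (toPlane (v (i + 1))) := ⟨i, hi⟩
  rw [boundaryNormal, dif_pos h, openSegment_disjoint hv h.choose_spec hi]

theorem openSegment_eq_diff {a b : Plane} (hab : a ≠ b) :
    openSegment ℝ a b = segment ℝ a b \ {a, b} := by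
  ext x
  constructor
  · intro hx
    refine ⟨openSegment_subset_segment ℝ _ _ hx, ?_⟩
    rintro (rfl | rfl)
    · exact hab (left_mem_openSegment_iff.1 hx)
    · exact hab (right_mem_openSegment_iff.1 hx)
  · rintro ⟨hx, hn⟩
    rw [Set.mem_insert_iff, Set.mem_singleton_iff, not_or] at hn
    exact mem_openSegment_of_ne_left_right (Ne.symm hn.1) (Ne.symm hn.2) hx

theorem segment_isCompact (a b : Plane) : IsCompact (segment ℝ a b) := by
  rw [← convexHull_pair]
  exact (Set.toFinite {a, b}).isCompact_convexHull ℝ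

theorem measurableSet_openSegment {a b : Plane} (hab : a ≠ b) :
    MeasurableSet (openSegment ℝ a b) := by
  rw [openSegment_eq_diff hab]
  exact (segment_isCompact a b).isClosed.measurableSet.diff (Set.toFinite _).measurableSet

theorem segment_ae_eq_openSegment (a b : Plane) :
    segment ℝ a b =ᵐ[Measure.hausdorffMeasure 1] openSegment ℝ a b := by
  have : NullSingletonClass (Measure.hausdorffMeasure (1 : ℝ) : Measure Plane) :=
    Measure.nullSingletonClass_hausdorff Plane one_pos
  rw [← insert_endpoints_openSegment]
  exact (insert_ae_eq_self _ _).trans (insert_ae_eq_self _ _)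

theorem frontier_ae_eq (hv : IsConvexLatticePolygon v) :
    frontier (polygon v) =ᵐ[Measure.hausdorffMeasure 1]
      (⋃ i, openSegment ℝ (toPlane (v i)) (toPlane (v (i + 1))) : Set Plane) := by
  rw [frontier_polygon hv]
  exact Filter.EventuallyEq.countable_iUnion fun i => segment_ae_eq_openSegment _ _

theorem hausdorffMeasure_facet (v : Fin N → Lat) (i : Fin N) :
    Measure.hausdorffMeasure (1 : ℝ) (openSegment ℝ (toPlane (v i)) (toPlane (v (i + 1)))) =
      ENNReal.ofReal ‖toPlane (edge v i)‖ := by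
  rw [← measure_congr (segment_ae_eq_openSegment _ _), hausdorffMeasure_segment, edist_dist,
    dist_comm, dist_eq_norm, edge, toPlane_sub]

theorem integrableOn_facet (hv : IsConvexLatticePolygon v) (f : Lat → ℝ) (i : Fin N) :
    IntegrableOn (fun x => f (boundaryNormal v x))
      (openSegment ℝ (toPlane (v i)) (toPlane (v (i + 1)))) (Measure.hausdorffMeasure 1) := by
  rw [integrableOn_congr_fun (g := fun _ => f (millerNormal v i))
    (fun x hx => by simp only [boundaryNormal_eq hv hx]) (measurableSet_openSegment (vertex_ne hv i))]
  refine integrableOn_const ?_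
  rw [hausdorffMeasure_facet]
  exact ENNReal.ofReal_ne_top

theorem integrableOn_frontier (hv : IsConvexLatticePolygon v) (f : Lat → ℝ) :
    IntegrableOn (fun x => f (boundaryNormal v x)) (frontier (polygon v))
      (Measure.hausdorffMeasure 1) := by
  rw [integrableOn_congr_set_ae (frontier_ae_eq hv), integrableOn_finite_iUnion]
  exact integrableOn_facet hv f

/-- The integral over the boundary of a function of the normal. -/
theorem integral_frontier (hv : IsConvexLatticePolygon v) (f : Lat → ℝ) :
    ∫ x in frontier (polygon v), f (boundaryNormal v x) ∂(Measure.hausdorffMeasure 1) =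
      ∑ i, ‖toPlane (edge v i)‖ * f (millerNormal v i) := by
  rw [setIntegral_congr_set (frontier_ae_eq hv), integral_iUnion_fintype
    (fun i => measurableSet_openSegment (vertex_ne hv i)) _ (integrableOn_facet hv f)]
  · refine Finset.sum_congr rfl fun i _ => ?_
    rw [setIntegral_congr_fun (g := fun _ => f (millerNormal v i))
      (measurableSet_openSegment (vertex_ne hv i))
      (fun x hx => by simp only [boundaryNormal_eq hv hx]), setIntegral_const, smul_eq_mul,
      measureReal_def, hausdorffMeasure_facet, ENNReal.toReal_ofReal (norm_nonneg _)]
  · intro i j hij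
    rw [Function.onFun, Set.disjoint_left]
    exact fun x hi hj => hij (openSegment_disjoint hv hi hj)

end Boundary

/-! ### The area -/

section Area

open MeasureTheory Filter Topology

variable {N : ℕ} [NeZero N] {v : Fin N → Lat}

/-- The area of the polygon is the limit of the number of lattice points of its dilates, which
Pick's theorem computes. -/
theorem volume_polygon (hv : IsConvexLatticePolygon v) :
    (volume (polygon v)).toReal = shoelace v := by
  -- lattice points are counted in `Fin 2 → ℝ`, whose volume agrees with that of the plane
  set s : Set (Fin 2 → ℝ) := WithLp.toLp 2 ⁻¹' polygon v with hs
  have hcont : Continuous (WithLp.toLp 2 : (Fin 2 → ℝ) → Plane) := PiLp.continuous_toLp 2 _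
  have hvol : volume s = volume (polygon v) :=
    (PiLp.volume_preserving_toLp (Fin 2)).measure_preimage
      (polygon_isCompact v).isClosed.measurableSet.nullMeasurableSet
  have hmeas : MeasurableSet s := hcont.measurable (polygon_isCompact v).isClosed.measurableSet
  have hconv : Convex ℝ s := by
    intro x hx y hy a b ha hb hab
    exact convex_convexHull ℝ _ hx hy ha hb hab
  have hbdd : Bornology.IsBounded s := by
    have h : s = (WithLp.ofLp : Plane → Fin 2 → ℝ) '' polygon v := by
      ext x
      constructor
      · intro hx; exact ⟨_, hx, rfl⟩
      · rintro ⟨y, hy, rfl⟩; exact hy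
    rw [h]
    exact ((polygon_isCompact v).image (PiLp.continuous_ofLp 2 _)).isBounded
  have hlim := tendsto_card_div_pow_atTop_volume s hbdd hmeas (hconv.addHaar_frontier volume)
  have hcard : ∀ n : ℕ, 0 < n → Nat.card ↑(s ∩ (n : ℝ)⁻¹ •
      (Submodule.span ℤ (Set.range (Pi.basisFun ℝ (Fin 2))) : Set (Fin 2 → ℝ))) =
      pointCount (n • v) := by
    intro n hn
    have hn' : (n : ℝ) ≠ 0 := by exact_mod_cast hn.ne'
    have himg : s ∩ (n : ℝ)⁻¹ •
        (Submodule.span ℤ (Set.range (Pi.basisFun ℝ (Fin 2))) : Set (Fin 2 → ℝ)) =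
        (fun x : Lat => fun t => (n : ℝ)⁻¹ * x t) '' {x | Inside (n • v) x} := by
      ext y
      have hmem : ∀ z : Fin 2 → ℝ,
          z ∈ (Submodule.span ℤ (Set.range (Pi.basisFun ℝ (Fin 2))) : Set (Fin 2 → ℝ)) ↔
          ∃ x : Lat, z = fun t => (x t : ℝ) := by
        intro z
        rw [SetLike.mem_coe, Module.Basis.mem_span_iff_repr_mem]
        constructor
        · intro h
          choose x hx using h
          exact ⟨x, funext fun t => by simpa using (hx t).symm⟩
        · rintro ⟨x, rfl⟩ t
          exact ⟨x t, by simp⟩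
      have hin : ∀ x : Lat, (fun t => (n : ℝ)⁻¹ * (x t : ℝ)) ∈ s ↔ Inside (n • v) x := by
        intro x
        rw [← mem_smul_polygon hv hn, Set.mem_smul_set_iff_inv_smul_mem₀ hn', hs, Set.mem_preimage]
        have : WithLp.toLp 2 (fun t => (n : ℝ)⁻¹ * (x t : ℝ)) = (n : ℝ)⁻¹ • toPlane x := by
          ext t; fin_cases t <;> rfl
        rw [this]
      constructor
      · rintro ⟨hy, z, hz, rfl⟩
        obtain ⟨x, rfl⟩ := (hmem z).1 hz
        exact ⟨x, (hin x).1 hy, rfl⟩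
      · rintro ⟨x, hx, rfl⟩
        exact ⟨(hin x).2 hx, _, (hmem _).2 ⟨x, rfl⟩, rfl⟩
    rw [himg, pointCount, ← Set.ncard_image_of_injective (f := fun x : Lat => fun t =>
      (n : ℝ)⁻¹ * (x t : ℝ)), Nat.card_coe_set_eq]
    intro x y hxy
    ext t
    have := congrFun hxy t
    simpa [hn'] using this
  have hlim2 : Tendsto (fun n : ℕ => shoelace v +
      ((∑ i, (latGcd (edge v i) : ℝ)) / 2) * (n : ℝ)⁻¹ + (n : ℝ)⁻¹ * (n : ℝ)⁻¹) atTop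
      (𝓝 (shoelace v + ((∑ i, (latGcd (edge v i) : ℝ)) / 2) * 0 + 0 * 0)) := by
    have h := tendsto_inv_atTop_nhds_zero_nat (𝕜 := ℝ)
    exact ((tendsto_const_nhds.add (tendsto_const_nhds.mul h))).add (h.mul h)
  rw [mul_zero, mul_zero, add_zero, add_zero] at hlim2
  have heq : (fun n : ℕ => shoelace v +
      ((∑ i, (latGcd (edge v i) : ℝ)) / 2) * (n : ℝ)⁻¹ + (n : ℝ)⁻¹ * (n : ℝ)⁻¹) =ᶠ[atTop]
      fun n : ℕ => (Nat.card ↑(s ∩ (n : ℝ)⁻¹ •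
        (Submodule.span ℤ (Set.range (Pi.basisFun ℝ (Fin 2))) : Set (Fin 2 → ℝ))) : ℝ) /
        (n : ℝ) ^ Fintype.card (Fin 2) := by
    filter_upwards [eventually_gt_atTop 0] with n hn
    have hn' : (n : ℝ) ≠ 0 := by exact_mod_cast hn.ne'
    rw [hcard n hn, pointCount_smul hv hn, Fintype.card_fin]
    field_simp
  have := tendsto_nhds_unique hlim (hlim2.congr' heq)
  rw [← this, measureReal_def, hvol]

end Area

/-! ### The sum of the exterior angles -/

section Angles

variable {N : ℕ} [NeZero N] {v : Fin N → Lat}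

/-- A lattice vector as a complex number. -/
def toComplex (w : Lat) : ℂ := ⟨w 0, w 1⟩

theorem norm_toComplex (w : Lat) : ‖toComplex w‖ = ‖toPlane w‖ := by
  rw [← sq_eq_sq₀ (norm_nonneg _) (norm_nonneg _), norm_toPlane_sq, Complex.sq_norm,
    Complex.normSq_apply]
  simp only [toComplex]; ring

theorem toComplex_ne_zero {w : Lat} (hw : w ≠ 0) : toComplex w ≠ 0 := by
  rw [← norm_pos_iff, norm_toComplex, norm_pos_iff]
  exact toPlane_ne_zero hw

theorem div_toComplex_im (x y : Lat) :
    (toComplex y / toComplex x).im = crs x y / ‖toPlane x‖ ^ 2 := by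
  rw [Complex.div_im, Complex.normSq_eq_norm_sq, norm_toComplex]
  simp only [toComplex, crs]; push_cast; ring

theorem div_toComplex_re (x y : Lat) :
    (toComplex y / toComplex x).re = inner ℝ (toPlane y) (toPlane x) / ‖toPlane x‖ ^ 2 := by
  rw [Complex.div_re, Complex.normSq_eq_norm_sq, norm_toComplex, inner_plane]
  simp only [toComplex, toPlane_zero, toPlane_one]; ring

theorem angle_unitNormal (hv : IsConvexLatticePolygon v) (i : Fin N) :
    InnerProductGeometry.angle (unitNormal v i) (unitNormal v (i - 1)) =
      (toComplex (edge v i) / toComplex (edge v (i - 1))).arg := by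
  have h1 := norm_edge_pos hv i
  have h2 := norm_edge_pos hv (i - 1)
  have hD : (0 : ℝ) < crs (edge v (i - 1)) (edge v i) := by exact_mod_cast hv.turn_pos i
  rw [Complex.arg_of_im_nonneg_of_ne_zero _
    (div_ne_zero (toComplex_ne_zero (hv.edge_ne_zero i)) (toComplex_ne_zero (hv.edge_ne_zero _))),
    unitNormal_eq hv, unitNormal_eq hv, InnerProductGeometry.angle_smul_left_of_pos _ _ (inv_pos.2 h1),
    InnerProductGeometry.angle_smul_right_of_pos _ _ (inv_pos.2 h2), InnerProductGeometry.angle,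
    norm_toPlane_latPerp, norm_toPlane_latPerp, norm_div, norm_toComplex, norm_toComplex,
    div_toComplex_re, inner_plane, inner_plane]
  · congr 1
    simp only [toPlane_zero, toPlane_one, latPerp_zero, latPerp_one]
    push_cast
    field_simp
    ring
  · rw [div_toComplex_im]; positivity

/-- The exterior angles of a convex polygon add up to `2π`: the argument of the edge direction
jumps by `2π` exactly once along the boundary, at the vertex where the direction passes from the
closed upper to the open lower half-plane. -/
theorem sum_angle (hv : IsConvexLatticePolygon v) :
    ∑ i, InnerProductGeometry.angle (unitNormal v i) (unitNormal v (i - 1)) = 2 * Real.pi := by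
  obtain ⟨j, ⟨hj1, hj2⟩, hju⟩ := existsUnique_upper hv (p := 0) (q := 1) (Or.inr one_ne_zero)
  have hlin : ∀ x : Lat, lin 0 1 x = (toComplex x).im := fun x => by simp [lin, toComplex]
  simp only [hlin] at hj1 hj2 hju
  have hstep : ∀ i, InnerProductGeometry.angle (unitNormal v i) (unitNormal v (i - 1)) =
      ((toComplex (edge v i)).arg - (toComplex (edge v (i - 1))).arg) +
        if i = j then 2 * Real.pi else 0 := by
    intro i
    rw [angle_unitNormal hv]
    have hz := toComplex_ne_zero (hv.edge_ne_zero i)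
    have hz' := toComplex_ne_zero (hv.edge_ne_zero (i - 1))
    set z := toComplex (edge v i) with hzdef
    set z' := toComplex (edge v (i - 1)) with hzdef'
    have him : 0 < (z / z').im := by
      rw [div_toComplex_im]
      have hD : (0 : ℝ) < crs (edge v (i - 1)) (edge v i) := by exact_mod_cast hv.turn_pos i
      have := norm_edge_pos hv (i - 1)
      positivity
    have hθ0 : 0 < (z / z').arg := by
      refine lt_of_le_of_ne (Complex.arg_nonneg_iff.2 him.le) fun h => ?_
      rw [eq_comm, Complex.arg_eq_zero_iff] at h
      exact him.ne' h.2
    have hθ1 : (z / z').arg < Real.pi := by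
      refine lt_of_le_of_ne (Complex.arg_le_pi _) fun h => ?_
      rw [Complex.arg_eq_pi_iff] at h
      exact him.ne' h.2
    have hcoe := Complex.arg_div_coe_angle hz hz'
    rw [← Real.Angle.coe_sub, Real.Angle.angle_eq_iff_two_pi_dvd_sub] at hcoe
    obtain ⟨n, hn⟩ := hcoe
    have hpi := Real.pi_pos
    have a1 := Complex.neg_pi_lt_arg z
    have a2 := Complex.arg_le_pi z
    have b1 := Complex.neg_pi_lt_arg z'
    have b2 := Complex.arg_le_pi z'
    -- `n` is the number of turns by which the arguments differ from the angle
    have hnz : (n = if i = j then 1 else 0) := by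
      have hiff : i = j ↔ 0 ≤ z'.im ∧ z.im < 0 := by
        constructor
        · rintro rfl; exact ⟨hj1, hj2⟩
        · exact fun h => hju i h
      have bound : ∀ c d : ℤ, (c : ℝ) * Real.pi < 2 * Real.pi * n → 2 * Real.pi * n < d * Real.pi →
          c < 2 * n ∧ 2 * n < d := by
        intro c d h1 h2
        constructor
        · have : (c : ℝ) < 2 * n := lt_of_mul_lt_mul_right (by linarith) hpi.le
          exact_mod_cast this
        · have : (2 : ℝ) * n < d := lt_of_mul_lt_mul_right (by linarith) hpi.le
          exact_mod_cast this
      by_cases h1 : 0 ≤ z'.im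
      · have c1 := Complex.arg_nonneg_iff.2 h1
        by_cases h2 : z.im < 0
        · have c2 := Complex.arg_neg_iff.2 h2
          rw [if_pos (hiff.2 ⟨h1, h2⟩)]
          have := bound 0 3 (by push_cast; linarith) (by push_cast; linarith)
          omega
        · have c2 := Complex.arg_nonneg_iff.2 (not_lt.1 h2)
          rw [if_neg fun h => h2 (hiff.1 h).2]
          have := bound (-1) 2 (by push_cast; linarith) (by push_cast; linarith)
          omega
      · have c1 := Complex.arg_neg_iff.2 (not_le.1 h1)
        rw [if_neg fun h => h1 (hiff.1 h).1]
        have := bound (-2) 2 (by push_cast; linarith) (by push_cast; linarith)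
        omega
    have : (if i = j then 2 * Real.pi else 0) = 2 * Real.pi * n := by
      rw [hnz]; split_ifs <;> simp
    rw [this]; linarith
  rw [Finset.sum_congr rfl fun i _ => hstep i, Finset.sum_add_distrib, Finset.sum_sub_distrib]
  have : ∑ i, (toComplex (edge v (i - 1))).arg = ∑ i, (toComplex (edge v i)).arg :=
    Equiv.sum_comp (Equiv.subRight (1 : Fin N)) fun i => (toComplex (edge v i)).arg
  rw [this]
  simp

end Angles

/-! ### Sums over the lattice -/

section Bounds

theorem abs_coord_le (w : Lat) (t : Fin 2) : |(w t : ℝ)| ≤ ‖w‖ := by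
  have := norm_le_pi_norm w t
  rwa [Int.norm_eq_abs] at this

theorem norm_lat_le {w : Lat} {r : ℝ} (h0 : |(w 0 : ℝ)| ≤ r) (h1 : |(w 1 : ℝ)| ≤ r) : ‖w‖ ≤ r := by
  rw [pi_norm_le_iff_of_nonneg ((abs_nonneg _).trans h0)]
  intro t
  rw [Int.norm_eq_abs]
  fin_cases t
  · exact h0
  · exact h1

theorem one_le_norm_lat {w : Lat} (hw : w ≠ 0) : 1 ≤ ‖w‖ := by
  obtain ⟨t, ht⟩ := Function.ne_iff.1 hw
  refine le_trans ?_ (abs_coord_le w t)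
  exact_mod_cast Int.one_le_abs ht

theorem latGcd_le_norm {w : Lat} (hw : w ≠ 0) : (latGcd w : ℝ) ≤ ‖w‖ := by
  obtain ⟨t, ht⟩ := Function.ne_iff.1 hw
  refine le_trans ?_ (abs_coord_le w t)
  have h := latGcd_mul_prim w t
  have hp : prim w t ≠ 0 := fun h0 => ht (by rw [← h, h0, mul_zero]; rfl)
  have h1 : (latGcd w : ℤ) ≤ |w t| := by
    rw [← h, abs_mul, Nat.abs_cast]
    exact le_mul_of_one_le_right (Nat.cast_nonneg _) (Int.one_le_abs hp)
  exact_mod_cast h1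

theorem abs_crs_le (x y : Lat) : |(crs x y : ℝ)| ≤ 2 * ‖x‖ * ‖y‖ := by
  simp only [crs]
  push_cast
  refine (abs_sub _ _).trans ?_
  rw [abs_mul, abs_mul]
  have h1 := mul_le_mul (abs_coord_le x 0) (abs_coord_le y 1) (abs_nonneg _) (norm_nonneg _)
  have h2 := mul_le_mul (abs_coord_le x 1) (abs_coord_le y 0) (abs_nonneg _) (norm_nonneg _)
  linarith

theorem abs_triangleSum_le (α β : ℝ) {k : ℕ} (hk : 0 < k) :
    |(triangleSum α β k : ℝ)| ≤ 2 * k * |α| := by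
  rw [triangleSum]
  split_ifs with h
  · simp [h]
  have hk1 : (1 : ℝ) ≤ k := by exact_mod_cast hk
  have hα : 0 < |α| := abs_pos.2 h
  have hc : 1 ≤ ⌈|α|⌉ := Int.one_le_ceil_iff.2 hα
  have hcr : ((⌈|α|⌉ : ℤ) : ℝ) - 1 ≤ |α| := by linarith [Int.ceil_lt_add_one |α|]
  have hcard : (((Finset.Icc (1 : ℤ) (⌈|α|⌉ - 1)).card : ℕ) : ℤ) = ⌈|α|⌉ - 1 := by
    rw [Int.card_Icc, Int.toNat_of_nonneg (by omega)]; ring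
  have hcardR : (((Finset.Icc (1 : ℤ) (⌈|α|⌉ - 1)).card : ℕ) : ℝ) = ((⌈|α|⌉ : ℤ) : ℝ) - 1 := by
    exact_mod_cast hcard
  have hsum : (⌈|α|⌉ - 1) * ((k : ℤ) - 1) + ∑ j ∈ Finset.Icc (1 : ℤ) (⌈|α|⌉ - 1),
      (⌈(β - (k : ℤ)) / |α| * j⌉ - ⌊β / |α| * j⌋) =
      ∑ j ∈ Finset.Icc (1 : ℤ) (⌈|α|⌉ - 1),
        ((k : ℤ) - 1 + (⌈(β - (k : ℤ)) / |α| * j⌉ - ⌊β / |α| * j⌋)) := by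
    rw [Finset.sum_add_distrib, Finset.sum_const, nsmul_eq_mul, hcard]
  rw [hsum]
  push_cast
  refine (Finset.abs_sum_le_sum_abs _ _).trans ?_
  calc _ ≤ ∑ j ∈ Finset.Icc (1 : ℤ) (⌈|α|⌉ - 1), (2 * (k : ℝ)) := by
        refine Finset.sum_le_sum fun j hj => ?_
        rw [Finset.mem_Icc] at hj
        have hj1 : (j : ℝ) < |α| := Int.lt_ceil.1 (by omega)
        have hj0 : (0 : ℝ) < j := by exact_mod_cast hj.1
        have e : (β - k) / |α| * j = β / |α| * j - k * (j / |α|) := by ring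
        have f0 : 0 < (j : ℝ) / |α| := div_pos hj0 hα
        have f1 : (j : ℝ) / |α| < 1 := (div_lt_one hα).2 hj1
        have f2 : (k : ℝ) * (j / |α|) < k := by nlinarith
        have f3 : 0 < (k : ℝ) * (j / |α|) := by positivity
        have g1 := Int.le_ceil ((β - k) / |α| * j)
        have g2 := Int.ceil_lt_add_one ((β - k) / |α| * j)
        have g3 := Int.floor_le (β / |α| * j)
        have g4 := Int.lt_floor_add_one (β / |α| * j)
        rw [abs_le]
        constructor <;> linarith
    _ = (((⌈|α|⌉ : ℤ) : ℝ) - 1) * (2 * k) := by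
        rw [Finset.sum_const, nsmul_eq_mul, hcardR]
    _ ≤ 2 * k * |α| := by nlinarith

theorem abs_cornerCount_le {N : ℕ} [NeZero N] {v : Fin N → Lat} (hv : IsConvexLatticePolygon v)
    (i : Fin N) {w : Lat} (hw : w ≠ 0) :
    |(cornerCount w (unitNormal v i) (unitNormal v (i - 1)) : ℝ)| ≤
      8 * ‖edge v (i - 1)‖ * ‖edge v i‖ * ‖w‖ ^ 2 := by
  have hg := latGcd_pos hw
  have hgR : (0 : ℝ) < latGcd w := by exact_mod_cast hg
  have hD : (1 : ℝ) ≤ crs (edge v (i - 1)) (edge v i) := by exact_mod_cast hv.turn_pos i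
  rw [cornerCount_eq hv hw]
  refine (abs_triangleSum_le _ _ hg).trans ?_
  have he : ∀ j, edge (adapted w ∘ v) j = adapted w (edge v j) := fun j => edge_slMap v j
  have hcr : crs (adapted w (edge v (i - 1))) (adapted w (edge v i)) =
      crs (edge v (i - 1)) (edge v i) := crs_slMap (adapted_det hw) _ _
  have h1 : (latGcd w : ℝ) * adapted w (edge v (i - 1)) 0 = crs (edge v (i - 1)) w := by
    exact_mod_cast latGcd_mul_adapted hw (edge v (i - 1))
  have h2 : (latGcd w : ℝ) * adapted w (edge v i) 0 = crs (edge v i) w := by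
    exact_mod_cast latGcd_mul_adapted hw (edge v i)
  have key : (latGcd w : ℝ) * |apexX (adapted w ∘ v) (latGcd w) i| =
      |(crs (edge v (i - 1)) w : ℝ)| * |(crs (edge v i) w : ℝ)| /
        crs (edge v (i - 1)) (edge v i) := by
    rw [apexX, he, he, hcr, h1, abs_div, abs_mul, abs_of_pos (lt_of_lt_of_le one_pos hD), ← h2,
      abs_mul, abs_of_pos hgR]
    ring
  have hle : |(crs (edge v (i - 1)) w : ℝ)| * |(crs (edge v i) w : ℝ)| /
        crs (edge v (i - 1)) (edge v i) ≤
      |(crs (edge v (i - 1)) w : ℝ)| * |(crs (edge v i) w : ℝ)| :=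
    div_le_self (by positivity) hD
  have h3 := mul_le_mul (abs_crs_le (edge v (i - 1)) w) (abs_crs_le (edge v i) w) (abs_nonneg _)
    (by positivity)
  calc 2 * (latGcd w : ℝ) * |apexX (adapted w ∘ v) (latGcd w) i|
      = 2 * ((latGcd w : ℝ) * |apexX (adapted w ∘ v) (latGcd w) i|) := by ring
    _ ≤ 2 * ((2 * ‖edge v (i - 1)‖ * ‖w‖) * (2 * ‖edge v i‖ * ‖w‖)) := by rw [key]; linarith
    _ = _ := by ring

/-- An invertible matrix does not shrink lattice vectors by more than a constant factor. -/
theorem exists_le_bondLength {F : Matrix (Fin 2) (Fin 2) ℝ} (hF : 0 < F.det) :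
    ∃ c : ℝ, 0 < c ∧ ∀ w : Lat, c * ‖w‖ ≤ bondLength F w := by
  set M : ℝ := |F 0 0| + |F 0 1| + |F 1 0| + |F 1 1| + 1 with hM
  have hM0 : 0 < M := by positivity
  refine ⟨F.det / M, div_pos hF hM0, fun w => ?_⟩
  set y := Matrix.toEuclideanLin F (toPlane w) with hy
  have hy0 : y 0 = F 0 0 * w 0 + F 0 1 * w 1 := by
    simp [hy, Matrix.toLpLin_apply]
  have hy1 : y 1 = F 1 0 * w 0 + F 1 1 * w 1 := by
    simp [hy, Matrix.toLpLin_apply]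
  have hn0 : |y 0| ≤ ‖y‖ := by simpa using PiLp.norm_apply_le y 0
  have hn1 : |y 1| ≤ ‖y‖ := by simpa using PiLp.norm_apply_le y 1
  rw [div_mul_eq_mul_div, div_le_iff₀ hM0, bondLength, ← hy]
  have hdet := Matrix.det_fin_two F
  have e0 : F.det * w 0 = F 1 1 * y 0 - F 0 1 * y 1 := by rw [hdet, hy0, hy1]; ring
  have e1 : F.det * w 1 = F 0 0 * y 1 - F 1 0 * y 0 := by rw [hdet, hy0, hy1]; ring
  have hny := norm_nonneg y
  have key : ∀ p q a b : ℝ, |a| ≤ ‖y‖ → |b| ≤ ‖y‖ → |p| + |q| ≤ M → |p * a - q * b| ≤ ‖y‖ * M := by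
    intro p q a b ha hb hpq
    refine (abs_sub _ _).trans ?_
    rw [abs_mul, abs_mul]
    have := mul_le_mul_of_nonneg_left ha (abs_nonneg p)
    have := mul_le_mul_of_nonneg_left hb (abs_nonneg q)
    nlinarith
  have k0 : |F.det * w 0| ≤ ‖y‖ * M := by
    rw [e0]
    refine key _ _ _ _ hn0 hn1 ?_
    rw [hM]; linarith [abs_nonneg (F 0 0), abs_nonneg (F 1 0)]
  have k1 : |F.det * w 1| ≤ ‖y‖ * M := by
    rw [e1]
    refine key _ _ _ _ hn1 hn0 ?_
    rw [hM]; linarith [abs_nonneg (F 1 1), abs_nonneg (F 0 1)]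
  rw [abs_mul, abs_of_pos hF] at k0 k1
  have : ‖w‖ ≤ ‖y‖ * M / F.det := norm_lat_le
    (by rw [le_div_iff₀ hF]; linarith) (by rw [le_div_iff₀ hF]; linarith)
  rw [le_div_iff₀ hF] at this
  linarith

/-- As `|F w| ≥ c ‖w‖ ≥ c` for every bond, the decay hypothesis is needed at the single radius
`c`. -/
theorem exists_potential_bound {φ : ℝ → ℝ} {d : ℝ} (hd : 2 < d)
    (hφ : ∀ r₀ : ℝ, 0 < r₀ → ∃ C : ℝ, ∀ r : ℝ, r₀ ≤ r → |φ r| < C * r ^ (-(2 + d)))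
    {F : Matrix (Fin 2) (Fin 2) ℝ} (hF : 0 < F.det) :
    ∃ C : ℝ, 0 ≤ C ∧ ∀ w : Bond, |φ (bondLength F w.1)| ≤ C * ‖w.1‖ ^ (-(2 + d)) := by
  obtain ⟨c, hc, hcw⟩ := exists_le_bondLength hF
  obtain ⟨C, hC⟩ := hφ c hc
  have hC0 : 0 ≤ C := by
    have h := (abs_nonneg _).trans (hC c le_rfl).le
    exact nonneg_of_mul_nonneg_left h (Real.rpow_pos_of_pos hc _)
  refine ⟨C * c ^ (-(2 + d)), by positivity, fun w => ?_⟩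
  have h1 := one_le_norm_lat w.2
  have h2 : c ≤ bondLength F w.1 := by
    refine le_trans ?_ (hcw w.1)
    nlinarith
  refine (hC _ h2).le.trans ?_
  rw [mul_assoc, ← Real.mul_rpow hc.le (norm_nonneg _)]
  refine mul_le_mul_of_nonneg_left ?_ hC0
  exact Real.rpow_le_rpow_of_nonpos (by positivity) (hcw w.1) (by linarith)

theorem summable_norm_rpow {d : ℝ} (hd : 2 < d) : Summable fun w : Lat => ‖w‖ ^ (-d) :=
  EisensteinSeries.summable_one_div_norm_rpow hd

theorem sq_mul_rpow {r d : ℝ} (hr : 0 < r) : r ^ 2 * r ^ (-(2 + d)) = r ^ (-d) := by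
  rw [← Real.rpow_natCast, ← Real.rpow_add hr]
  congr 1; push_cast; ring

/-- Factors that grow at most quadratically keep the sums over the bonds absolutely convergent. -/
theorem summable_mul_of_sq_bound {a T : Bond → ℝ} {C K d : ℝ} (hd : 2 < d)
    (ha : ∀ w, |a w| ≤ C * ‖w.1‖ ^ (-(2 + d))) (hT : ∀ w, |T w| ≤ K * ‖w.1‖ ^ 2) :
    Summable fun w => T w * a w := by
  refine Summable.of_norm_bounded
    (((summable_norm_rpow hd).subtype {w : Lat | w ≠ 0}).mul_left (K * C)) fun w => ?_
  have hw : 0 < ‖w.1‖ := lt_of_lt_of_le one_pos (one_le_norm_lat w.2)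
  rw [norm_mul, Real.norm_eq_abs, Real.norm_eq_abs]
  calc |T w| * |a w| ≤ (K * ‖w.1‖ ^ 2) * (C * ‖w.1‖ ^ (-(2 + d))) :=
        mul_le_mul (hT w) (ha w) (abs_nonneg _) ((abs_nonneg _).trans (hT w))
    _ = K * C * (‖w.1‖ ^ 2 * ‖w.1‖ ^ (-(2 + d))) := by ring
    _ = _ := by rw [sq_mul_rpow hw]; rfl

theorem summable_max_norm_rpow {d : ℝ} (hd : 2 < d) :
    Summable fun w : Lat => (max 1 ‖w‖) ^ (-d) := by
  refine Summable.of_nonneg_of_le (fun w => by positivity) (fun w => ?_)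
    ((summable_norm_rpow hd).add (hasSum_ite_eq (0 : Lat) (1 : ℝ)).summable)
  by_cases hw : w = 0
  · subst hw
    simp only [norm_zero, if_pos]
    rw [max_eq_left zero_le_one, Real.one_rpow, Real.zero_rpow (by linarith)]
    simp
  · rw [if_neg hw, max_eq_right (one_le_norm_lat hw), add_zero]

/-- Division with remainder of the coordinates of a lattice vector. -/
def latDivMod (k : ℕ) [NeZero k] : Lat ≃ Lat × (Fin 2 → Fin k) :=
  (Equiv.piCongrRight fun _ => Int.divModEquiv k).trans (Equiv.arrowProdEquivProdArrow _ _ _)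

theorem latDivMod_fst (k : ℕ) [NeZero k] (w : Lat) (t : Fin 2) :
    (latDivMod k w).1 t = w t / k := rfl

/-- The tail of the lattice sum. Writing `w = k q + r` with `r` in a period cell, one has
`‖w‖ ≥ c k max(1, ‖q‖)` in the tail, and each `q` occurs `k ^ 2` times. -/
theorem exists_tail_bound {d K : ℝ} (hd : 2 < d) (hK : 1 ≤ K) :
    ∃ C : ℝ, ∀ k : ℕ, 0 < k →
      (Summable fun w : Lat => if (k : ℝ) < K * ‖w‖ then ‖w‖ ^ (-d) else 0) ∧
      ∑' w : Lat, (if (k : ℝ) < K * ‖w‖ then ‖w‖ ^ (-d) else 0) ≤ C * (k : ℝ) ^ (2 - d) := by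
  have hS := summable_max_norm_rpow hd
  refine ⟨(K + 1) ^ d * ∑' q : Lat, (max 1 ‖q‖) ^ (-d), fun k hk => ?_⟩
  have : NeZero k := ⟨hk.ne'⟩
  have hkR : (0 : ℝ) < k := by exact_mod_cast hk
  -- for `k < K ‖w‖`, both `k / (K + 1)` and `‖q‖ k / (K + 1)` are at most `‖w‖`
  have hcell : 0 < (k : ℝ) / (K + 1) := by positivity
  have hsum1 : Summable fun w : Lat => if (k : ℝ) < K * ‖w‖ then ‖w‖ ^ (-d) else 0 := by
    refine Summable.of_nonneg_of_le (fun w => ?_) (fun w => ?_) (summable_norm_rpow hd)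
    · split_ifs <;> positivity
    · split_ifs
      · exact le_rfl
      · positivity
  refine ⟨hsum1, ?_⟩
  set H : Lat × (Fin 2 → Fin k) → ℝ := fun x => (k / (K + 1)) ^ (-d) * (max 1 ‖x.1‖) ^ (-d) with hH
  have hHs : Summable H := by
    have h := (hS.mul_left ((k / (K + 1)) ^ (-d))).mul_of_nonneg
      (summable_of_hasFiniteSupport (f := fun _ : Fin 2 → Fin k => (1 : ℝ)) (Set.toFinite _))
      (fun q => by positivity) (fun _ => zero_le_one)
    simpa [hH] using h
  have hle : ∀ w : Lat, (if (k : ℝ) < K * ‖w‖ then ‖w‖ ^ (-d) else 0) ≤ H (latDivMod k w) := by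
    intro w
    split_ifs with hw
    · rw [hH]
      simp only
      rw [← Real.mul_rpow hcell.le (by positivity)]
      refine Real.rpow_le_rpow_of_nonpos (by positivity) ?_ (by linarith)
      have hwk : (k : ℝ) ≤ (K + 1) * ‖w‖ := by nlinarith [norm_nonneg w]
      have hq : ‖(latDivMod k w).1‖ ≤ (K + 1) * ‖w‖ / k := by
        have hcoord : ∀ t, |(((latDivMod k w).1 t : ℤ) : ℝ)| ≤ (K + 1) * ‖w‖ / k := by
          intro t
          rw [latDivMod_fst]
          have hkZ : (0 : ℤ) < k := by exact_mod_cast hk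
          have e : (((w t / (k : ℤ) : ℤ)) : ℝ) = ⌊(w t : ℝ) / k⌋ := by
            have := floor_intCast_div_intCast hkZ (w t)
            rw [← this]; simp
          rw [e]
          have h1 := Int.floor_le ((w t : ℝ) / k)
          have h2 := Int.lt_floor_add_one ((w t : ℝ) / k)
          have h3 := abs_le.1 (abs_coord_le w t)
          have h4 : |(w t : ℝ) / k| ≤ ‖w‖ / k := by
            rw [abs_div, abs_of_pos hkR]
            exact div_le_div_of_nonneg_right (abs_coord_le w t) hkR.le
          have h5 := abs_le.1 h4
          have h6 : 1 ≤ K * ‖w‖ / k := by rw [le_div_iff₀ hkR]; linarith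
          have h7 : (K + 1) * ‖w‖ / k = K * ‖w‖ / k + ‖w‖ / k := by ring
          rw [abs_le, h7]
          constructor <;> linarith
        exact norm_lat_le (hcoord 0) (hcoord 1)
      rw [div_mul_eq_mul_div, div_le_iff₀ (by positivity)]
      rcases max_choice 1 ‖(latDivMod k w).1‖ with h | h
      · rw [h]; linarith
      · rw [h]
        rw [le_div_iff₀ hkR] at hq
        linarith
    · rw [hH]; positivity
  calc ∑' w : Lat, (if (k : ℝ) < K * ‖w‖ then ‖w‖ ^ (-d) else 0)
      ≤ ∑' w : Lat, H (latDivMod k w) :=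
        hsum1.tsum_le_tsum hle ((latDivMod k).summable_iff.2 hHs)
    _ = ∑' x, H x := (latDivMod k).tsum_eq H
    _ = ∑' q : Lat, ∑' _ : Fin 2 → Fin k, (k / (K + 1)) ^ (-d) * (max 1 ‖q‖) ^ (-d) :=
        hHs.tsum_prod
    _ = ∑' q : Lat, ((k : ℝ) ^ 2 * (k / (K + 1)) ^ (-d)) * (max 1 ‖q‖) ^ (-d) := by
        refine tsum_congr fun q => ?_
        rw [tsum_fintype, Finset.sum_const, Finset.card_univ, Fintype.card_fun, Fintype.card_fin,
          Fintype.card_fin, nsmul_eq_mul]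
        push_cast; ring
    _ = ((k : ℝ) ^ 2 * (k / (K + 1)) ^ (-d)) * ∑' q : Lat, (max 1 ‖q‖) ^ (-d) := tsum_mul_left
    _ = (K + 1) ^ d * (∑' q : Lat, (max 1 ‖q‖) ^ (-d)) * (k : ℝ) ^ (2 - d) := by
        have h1 : ((k : ℝ) / (K + 1)) ^ (-d) = (k : ℝ) ^ (-d) * (K + 1) ^ d := by
          rw [Real.div_rpow hkR.le (by positivity), Real.rpow_neg (by positivity) (y := d),
            Real.rpow_neg (x := K + 1) (by positivity), div_inv_eq_mul]
        have h2 : (k : ℝ) ^ 2 * (k : ℝ) ^ (-d) = (k : ℝ) ^ (2 - d) := by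
          rw [← Real.rpow_natCast, ← Real.rpow_add hkR]
          congr 1
        rw [h1, ← h2]; ring

end Bounds

/-! ### The energy as a sum over bonds -/

section Energy

/-- Interchanging the sums over points and bonds. -/
theorem tsum_bonds {S : Set Lat} (hS : S.Finite) (f : Lat → ℝ) :
    (Summable fun w : Bond => ({x | x ∈ S ∧ x + w.1 ∈ S}.ncard : ℝ) * f w.1) ∧
    ∑' x : {x : Lat // x ∈ S}, ∑' w : {w : Lat // w ≠ 0 ∧ x.1 + w ∈ S}, f w.1 =
      ∑' w : Bond, ({x | x ∈ S ∧ x + w.1 ∈ S}.ncard : ℝ) * f w.1 := by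
  classical
  have hinner : ∀ x : Lat, ∑' w : {w : Lat // w ≠ 0 ∧ x + w ∈ S}, f w.1 =
      ∑' w : Bond, if x + w.1 ∈ S then f w.1 else 0 := by
    intro x
    have h1 := tsum_subtype {w : Lat | w ≠ 0 ∧ x + w ∈ S} f
    have h2 := tsum_subtype {w : Lat | w ≠ 0} fun w => if x + w ∈ S then f w else 0
    refine h1.trans (Eq.trans ?_ h2.symm)
    refine tsum_congr fun w => ?_
    simp only [Set.indicator_apply, Set.mem_ofPred_eq]
    by_cases hw : w ≠ 0 <;> by_cases hx : x + w ∈ S <;> simp [hw, hx]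
  have hfin : ∀ x : Lat, Summable fun w : Bond => if x + w.1 ∈ S then f w.1 else 0 := by
    intro x
    refine summable_of_hasFiniteSupport ?_
    have : (fun w : Bond => x + w.1) ⁻¹' S |>.Finite := by
      refine hS.preimage fun a _ b _ h => ?_
      exact Subtype.ext (add_left_cancel h)
    refine this.subset fun w hw => ?_
    by_contra hn
    exact hw (if_neg hn)
  have hcard : ∀ w : Bond, ({x | x ∈ S ∧ x + w.1 ∈ S}.ncard : ℝ) * f w.1 =
      ∑ x ∈ hS.toFinset, if x + w.1 ∈ S then f w.1 else 0 := by
    intro w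
    rw [← Finset.sum_filter, Finset.sum_const, nsmul_eq_mul]
    congr 2
    rw [← Set.ncard_coe_finset]
    congr 1
    ext x
    simp
  constructor
  · simp only [hcard]
    exact summable_sum fun x _ => hfin x
  · simp only [hcard]
    rw [Summable.tsum_finsetSum fun x _ => hfin x]
    simp only [hinner]
    rw [← Finset.tsum_subtype]
    exact ((Equiv.subtypeEquivRight fun x => hS.mem_toFinset).tsum_eq
      fun x : {x // x ∈ S} => ∑' w : Bond, if x.1 + w.1 ∈ S then f w.1 else 0).symm

theorem energy_eq {N : ℕ} [NeZero N] {v : Fin N → Lat} (hv : IsConvexLatticePolygon v)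
    (φ : ℝ → ℝ) (F : Matrix (Fin 2) (Fin 2) ℝ) {k : ℕ} (hk : 0 < k) :
    (Summable fun w : Bond => (bondCount (k • v) w.1 : ℝ) * φ (bondLength F w.1)) ∧
    energy φ F ((k : ℝ) • polygon v) =
      (1 / 2) * ∑' w : Bond, (bondCount (k • v) w.1 : ℝ) * φ (bondLength F w.1) := by
  have h := tsum_bonds (inside_finite (hv.smul hk)) fun w => φ (bondLength F w)
  refine ⟨h.1, ?_⟩
  have hset : {x : Lat | toPlane x ∈ (k : ℝ) • polygon v} = {x | Inside (k • v) x} :=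
    Set.ext fun x => mem_smul_polygon hv hk x
  have h2 := h.2
  rw [← hset] at h2
  rw [energy]
  congr 1
  refine Eq.trans h2 ?_
  rw [hset]
  rfl

theorem bondCount_le_pointCount {N : ℕ} [NeZero N] {V : Fin N → Lat}
    (hV : IsConvexLatticePolygon V) (w : Lat) : bondCount V w ≤ pointCount V :=
  Set.ncard_le_ncard (fun _ hx => hx.1) (inside_finite hV)

end Energy

/-! ### The summands of the three energy densities -/

section Factors

variable {N : ℕ} [NeZero N] {v : Fin N → Lat}

/-- The coefficient of the potential in the summand of the surface energy density. -/
def surfaceFactor (m w : Lat) : ℝ := 1 / ‖toPlane m‖ * (|inner ℝ (toPlane w) (toPlane m)| - 1)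

/-- The coefficient of the potential in the summand of the vertex energy function. -/
def cornerFactor (n m : Plane) (w : Lat) : ℝ :=
  (sectorStep n m w - 1 / (2 * Real.pi) * InnerProductGeometry.angle n m) *
      ((latGcd w : ℝ) - 1) + sectorStep n m w * (cornerCount w n m : ℝ)

theorem surfaceTerm_eq (φ : ℝ → ℝ) (F : Matrix (Fin 2) (Fin 2) ℝ) (m : Lat) :
    surfaceTerm φ F m = fun w => surfaceFactor m w.1 * φ (bondLength F w.1) := rfl

theorem cornerTerm_eq (φ : ℝ → ℝ) (F : Matrix (Fin 2) (Fin 2) ℝ) (n m : Plane) :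
    cornerTerm φ F n m = fun w => cornerFactor n m w.1 * φ (bondLength F w.1) := rfl

theorem one_le_norm_sq {w : Lat} (hw : w ≠ 0) : 1 ≤ ‖w‖ ^ 2 := one_le_pow₀ (one_le_norm_lat hw)

theorem norm_le_norm_sq {w : Lat} (hw : w ≠ 0) : ‖w‖ ≤ ‖w‖ ^ 2 := by
  have := one_le_norm_lat hw
  nlinarith

theorem abs_surfaceFactor_le (m : Lat) {w : Lat} (hw : w ≠ 0) :
    |surfaceFactor m w| ≤ (1 / ‖toPlane m‖ * (2 * ‖m‖ + 1)) * ‖w‖ ^ 2 := by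
  rw [surfaceFactor, abs_mul, abs_of_nonneg (by positivity : 0 ≤ 1 / ‖toPlane m‖), mul_assoc]
  refine mul_le_mul_of_nonneg_left ?_ (by positivity)
  have h1 : |inner ℝ (toPlane w) (toPlane m)| ≤ 2 * ‖m‖ * ‖w‖ := by
    rw [inner_plane]
    refine (abs_add_le _ _).trans ?_
    rw [abs_mul, abs_mul]
    have h1 := mul_le_mul (abs_coord_le w 0) (abs_coord_le m 0) (abs_nonneg _) (norm_nonneg _)
    have h2 := mul_le_mul (abs_coord_le w 1) (abs_coord_le m 1) (abs_nonneg _) (norm_nonneg _)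
    simp only [toPlane_zero, toPlane_one]
    linarith
  have h2 := norm_le_norm_sq hw
  have h3 := one_le_norm_sq hw
  have h4 := mul_le_mul_of_nonneg_left h2 (by positivity : 0 ≤ 2 * ‖m‖)
  have h5 := abs_nonneg (inner ℝ (toPlane w) (toPlane m))
  rw [abs_le]
  constructor <;> nlinarith [norm_nonneg m]

theorem abs_cornerFactor_le (hv : IsConvexLatticePolygon v) (i : Fin N) {w : Lat} (hw : w ≠ 0) :
    |cornerFactor (unitNormal v i) (unitNormal v (i - 1)) w| ≤
      (1 + 8 * ‖edge v (i - 1)‖ * ‖edge v i‖) * ‖w‖ ^ 2 := by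
  have hstep : 0 ≤ sectorStep (unitNormal v i) (unitNormal v (i - 1)) w ∧
      sectorStep (unitNormal v i) (unitNormal v (i - 1)) w ≤ 1 := by
    rw [sectorStep]; split_ifs <;> norm_num
  have hang : 0 ≤ 1 / (2 * Real.pi) * InnerProductGeometry.angle (unitNormal v i)
        (unitNormal v (i - 1)) ∧
      1 / (2 * Real.pi) * InnerProductGeometry.angle (unitNormal v i) (unitNormal v (i - 1)) ≤ 1 := by
    have h1 := InnerProductGeometry.angle_nonneg (unitNormal v i) (unitNormal v (i - 1))
    have h2 := InnerProductGeometry.angle_le_pi (unitNormal v i) (unitNormal v (i - 1))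
    have h3 := Real.pi_pos
    refine ⟨by positivity, ?_⟩
    rw [one_div, inv_mul_le_iff₀ (by positivity)]
    linarith
  have hcc := abs_cornerCount_le hv i hw
  have hg := latGcd_le_norm hw
  have hg1 : (1 : ℝ) ≤ latGcd w := by exact_mod_cast latGcd_pos hw
  have hn := norm_le_norm_sq hw
  rw [cornerFactor]
  refine (abs_add_le _ _).trans ?_
  rw [abs_mul, abs_mul, abs_of_nonneg hstep.1, abs_of_nonneg (sub_nonneg.2 hg1)]
  have h1 : |sectorStep (unitNormal v i) (unitNormal v (i - 1)) w - 1 / (2 * Real.pi) *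
      InnerProductGeometry.angle (unitNormal v i) (unitNormal v (i - 1))| ≤ 1 := by
    rw [abs_le]; constructor <;> linarith [hstep.1, hstep.2, hang.1, hang.2]
  have h2 := mul_le_mul h1 (by linarith : (latGcd w : ℝ) - 1 ≤ ‖w‖ ^ 2) (by linarith) zero_le_one
  have h3 := mul_le_mul hstep.2 hcc (abs_nonneg _) zero_le_one
  linarith

/-- The coefficient of the bond `w` in the three leading terms of the expansion. -/
def expansionCount (v : Fin N → Lat) (k : ℕ) (w : Lat) : ℝ :=
  shoelace v * k ^ 2 +
    ∑ i, (-(k / 2) * ‖toPlane (edge v i)‖) * surfaceFactor (millerNormal v i) w +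
    ∑ i, cornerFactor (unitNormal v i) (unitNormal v (i - 1)) w

theorem norm_mul_surfaceFactor (hv : IsConvexLatticePolygon v) (i : Fin N) (w : Lat) :
    ‖toPlane (edge v i)‖ * surfaceFactor (millerNormal v i) w =
      |(crs (edge v i) w : ℝ)| - latGcd (edge v i) := by
  have hg : (0 : ℝ) < latGcd (edge v i) := by exact_mod_cast latGcd_pos (hv.edge_ne_zero i)
  have h := latGcd_smul_millerNormal v i
  have hm : toPlane (millerNormal v i) ≠ 0 := by
    intro h0
    rw [h0, smul_zero] at h
    have := norm_edge_pos hv i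
    rw [← norm_toPlane_latPerp, h, norm_zero] at this
    exact lt_irrefl _ this
  have hm' := norm_pos_iff.2 hm
  have hin : (latGcd (edge v i) : ℝ) * |inner ℝ (toPlane w) (toPlane (millerNormal v i))| =
      |(crs (edge v i) w : ℝ)| := by
    rw [show (latGcd (edge v i) : ℝ) * |inner ℝ (toPlane w) (toPlane (millerNormal v i))| =
        |(latGcd (edge v i) : ℝ) * inner ℝ (toPlane w) (toPlane (millerNormal v i))| by
        rw [abs_mul, abs_of_pos hg], ← inner_smul_right, ← h, inner_plane, ← abs_neg]
    congr 1
    simp only [toPlane_zero, toPlane_one, latPerp_zero, latPerp_one, crs]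
    push_cast; ring
  rw [surfaceFactor, ← norm_toPlane_latPerp, h, norm_smul, Real.norm_eq_abs, abs_of_pos hg, ← hin]
  field_simp

/-- As the exterior angles add up to `2π`, the angular parts of the vertex terms together
contribute `-(gcd w - 1)`. -/
theorem sum_cornerFactor (hv : IsConvexLatticePolygon v) (w : Lat) :
    ∑ i, cornerFactor (unitNormal v i) (unitNormal v (i - 1)) w = -((latGcd w : ℝ) - 1) +
      ∑ i, sectorStep (unitNormal v i) (unitNormal v (i - 1)) w *
        ((latGcd w : ℝ) - 1 + cornerCount w (unitNormal v i) (unitNormal v (i - 1))) := by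
  have h : ∀ i, cornerFactor (unitNormal v i) (unitNormal v (i - 1)) w =
      (-(((latGcd w : ℝ) - 1) / (2 * Real.pi))) *
        InnerProductGeometry.angle (unitNormal v i) (unitNormal v (i - 1)) +
      sectorStep (unitNormal v i) (unitNormal v (i - 1)) w *
        ((latGcd w : ℝ) - 1 + cornerCount w (unitNormal v i) (unitNormal v (i - 1))) := by
    intro i; rw [cornerFactor]; ring
  rw [Finset.sum_congr rfl fun i _ => h i, Finset.sum_add_distrib, ← Finset.mul_sum, sum_angle hv]
  congr 1
  have := Real.pi_pos
  field_simp

theorem sum_surfaceFactor (hv : IsConvexLatticePolygon v) (k : ℕ) (w : Lat) :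
    ∑ i, (-(k / 2 : ℝ) * ‖toPlane (edge v i)‖) * surfaceFactor (millerNormal v i) w =
      k / 2 * ∑ i, ((latGcd (edge v i) : ℝ) - |(crs (edge v i) w : ℝ)|) := by
  rw [Finset.mul_sum]
  refine Finset.sum_congr rfl fun i _ => ?_
  rw [mul_assoc, norm_mul_surfaceFactor hv]; ring

/-- The expansion is exact for bonds that are short compared with the polygon. -/
theorem bondCount_eq_expansionCount (hv : IsConvexLatticePolygon v) {k : ℕ} (hk : 0 < k) {w : Lat}
    (hw : w ≠ 0) (hs : ∀ i, 2 * |crs (edge v i) w| ≤ k) :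
    (bondCount (k • v) w : ℝ) = expansionCount v k w := by
  rw [bondCount_smul hv hk hw hs, expansionCount, sum_surfaceFactor hv, sum_cornerFactor hv]
  ring

theorem exists_bondCount_le (hv : IsConvexLatticePolygon v) :
    ∃ A : ℝ, 0 ≤ A ∧ ∀ k : ℕ, 0 < k → ∀ w : Lat, (bondCount (k • v) w : ℝ) ≤ A * k ^ 2 := by
  have hL0 : 0 ≤ ∑ i, (latGcd (edge v i) : ℝ) := Finset.sum_nonneg fun i _ => Nat.cast_nonneg _
  refine ⟨|shoelace v| + ∑ i, (latGcd (edge v i) : ℝ) + 1,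
    add_nonneg (add_nonneg (abs_nonneg _) hL0) zero_le_one, fun k hk w => ?_⟩
  have hkR : (1 : ℝ) ≤ k := by exact_mod_cast hk
  have h : (bondCount (k • v) w : ℝ) ≤ pointCount (k • v) := by
    exact_mod_cast bondCount_le_pointCount (hv.smul hk) w
  rw [pointCount_smul hv hk] at h
  have e1 : shoelace v * (k : ℝ) ^ 2 ≤ |shoelace v| * k ^ 2 :=
    mul_le_mul_of_nonneg_right (le_abs_self _) (sq_nonneg _)
  have e2 := mul_le_mul_of_nonneg_right (by nlinarith : (k : ℝ) / 2 ≤ k ^ 2) hL0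
  have e3 : (1 : ℝ) ≤ k ^ 2 := one_le_pow₀ hkR
  linarith

theorem exists_abs_surface_sum_le (v : Fin N → Lat) :
    ∃ A : ℝ, 0 ≤ A ∧ ∀ w : Lat, w ≠ 0 →
      abs (∑ i, ((latGcd (edge v i) : ℝ) - |(crs (edge v i) w : ℝ)|)) ≤ A * ‖w‖ := by
  refine ⟨∑ i, (latGcd (edge v i) + 2 * ‖edge v i‖), Finset.sum_nonneg fun i _ => by positivity,
    fun w hw => ?_⟩
  refine (Finset.abs_sum_le_sum_abs _ _).trans ?_
  rw [Finset.sum_mul]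
  refine Finset.sum_le_sum fun i _ => ?_
  have a1 := abs_crs_le (edge v i) w
  have a2 := abs_nonneg (crs (edge v i) w : ℝ)
  have a4 : (0 : ℝ) ≤ latGcd (edge v i) := Nat.cast_nonneg _
  have a3 := le_mul_of_one_le_right a4 (one_le_norm_lat hw)
  rw [abs_le]
  constructor <;> linarith

theorem exists_abs_expansionCount_le (hv : IsConvexLatticePolygon v) :
    ∃ A : ℝ, 0 ≤ A ∧ ∀ (k : ℕ) (w : Lat), w ≠ 0 →
      |expansionCount v k w| ≤ A * (k + ‖w‖) ^ 2 := by
  obtain ⟨A, hA, hs⟩ := exists_abs_surface_sum_le v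
  have hR0 : 0 ≤ ∑ i, (1 + 8 * ‖edge v (i - 1)‖ * ‖edge v i‖) :=
    Finset.sum_nonneg fun i _ => by positivity
  refine ⟨|shoelace v| + A + ∑ i, (1 + 8 * ‖edge v (i - 1)‖ * ‖edge v i‖),
    add_nonneg (add_nonneg (abs_nonneg _) hA) hR0, fun k w hw => ?_⟩
  have hk0 : (0 : ℝ) ≤ k := Nat.cast_nonneg k
  have hw0 := norm_nonneg w
  have hkw := mul_nonneg hk0 hw0
  rw [expansionCount, sum_surfaceFactor hv, add_mul, add_mul]
  refine (abs_add_three _ _ _).trans (add_le_add (add_le_add ?_ ?_) ?_)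
  · rw [abs_mul, abs_of_nonneg (sq_nonneg (k : ℝ))]
    exact mul_le_mul_of_nonneg_left (by nlinarith) (abs_nonneg _)
  · rw [abs_mul, abs_of_nonneg (by positivity : (0 : ℝ) ≤ (k : ℝ) / 2)]
    refine (mul_le_mul_of_nonneg_left (hs w hw) (by positivity)).trans ?_
    rw [mul_left_comm]
    exact mul_le_mul_of_nonneg_left (by nlinarith) hA
  · refine (Finset.abs_sum_le_sum_abs _ _).trans ?_
    rw [Finset.sum_mul]
    refine Finset.sum_le_sum fun i _ => (abs_cornerFactor_le hv i hw).trans ?_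
    exact mul_le_mul_of_nonneg_left (by nlinarith) (by positivity)

/-- The deviation of the bond count from its expansion vanishes for bonds short compared with `k`,
and is at most quadratic in the length of the others. -/
theorem exists_deviation_bound (hv : IsConvexLatticePolygon v) :
    ∃ K B : ℝ, 1 ≤ K ∧ 0 ≤ B ∧ ∀ k : ℕ, 0 < k → ∀ w : Lat, w ≠ 0 →
      |(bondCount (k • v) w : ℝ) - expansionCount v k w| ≤
        if (k : ℝ) < K * ‖w‖ then B * ‖w‖ ^ 2 else 0 := by
  obtain ⟨A, hA, hb⟩ := exists_bondCount_le hv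
  obtain ⟨A', hA', he⟩ := exists_abs_expansionCount_le hv
  have hK0 : 0 ≤ ∑ i, 4 * ‖edge v i‖ := Finset.sum_nonneg fun i _ => by positivity
  refine ⟨1 + ∑ i, 4 * ‖edge v i‖, A * (1 + ∑ i, 4 * ‖edge v i‖) ^ 2 +
    A' * (1 + ∑ i, 4 * ‖edge v i‖ + 1) ^ 2, by linarith, by positivity, fun k hk w hw => ?_⟩
  split_ifs with hlong
  · have h1 := (hb k hk w).trans (mul_le_mul_of_nonneg_left
      (pow_le_pow_left₀ (Nat.cast_nonneg k) hlong.le 2) hA)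
    have h2 := (he k w hw).trans (mul_le_mul_of_nonneg_left
      (pow_le_pow_left₀ (by positivity) (add_le_add_left hlong.le ‖w‖) 2) hA')
    refine (abs_sub _ _).trans ?_
    rw [Nat.abs_cast]
    linarith
  · rw [bondCount_eq_expansionCount hv hk hw, sub_self, abs_zero]
    intro i
    -- `2 |E × w| ≤ 4 ‖E‖ ‖w‖` for every edge `E`
    have h1 := abs_crs_le (edge v i) w
    have h2 : 4 * ‖edge v i‖ ≤ ∑ i, 4 * ‖edge v i‖ :=
      Finset.single_le_sum (f := fun i => 4 * ‖edge v i‖) (fun i _ => by positivity)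
        (Finset.mem_univ i)
    have h3 := mul_le_mul_of_nonneg_right h2 (norm_nonneg w)
    have h4 : 2 * |(crs (edge v i) w : ℝ)| ≤ k := by linarith [not_lt.1 hlong, norm_nonneg w]
    exact_mod_cast h4

end Factors

/-! ### The expansion of the energy -/

section Expansion

variable {N : ℕ} [NeZero N] {v : Fin N → Lat} {φ : ℝ → ℝ} {F : Matrix (Fin 2) (Fin 2) ℝ} {d C : ℝ}

theorem summable_bulkTerm (hd : 2 < d)
    (hC : ∀ w : Bond, |φ (bondLength F w.1)| ≤ C * ‖w.1‖ ^ (-(2 + d))) :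
    Summable (bulkTerm φ F) := by
  have h := summable_mul_of_sq_bound (T := fun _ => 1) (K := 1) hd hC
    fun w => by rw [abs_one, one_mul]; exact one_le_norm_sq w.2
  simp only [one_mul] at h
  exact h

theorem summable_surfaceTerm (hd : 2 < d)
    (hC : ∀ w : Bond, |φ (bondLength F w.1)| ≤ C * ‖w.1‖ ^ (-(2 + d))) (m : Lat) :
    Summable (surfaceTerm φ F m) :=
  summable_mul_of_sq_bound (T := fun w : Bond => surfaceFactor m w.1) hd hC
    fun w => abs_surfaceFactor_le m w.2

theorem summable_cornerTerm (hv : IsConvexLatticePolygon v) (hd : 2 < d)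
    (hC : ∀ w : Bond, |φ (bondLength F w.1)| ≤ C * ‖w.1‖ ^ (-(2 + d))) (i : Fin N) :
    Summable (cornerTerm φ F (unitNormal v i) (unitNormal v (i - 1))) :=
  summable_mul_of_sq_bound
    (T := fun w : Bond => cornerFactor (unitNormal v i) (unitNormal v (i - 1)) w.1) hd hC
    fun w => abs_cornerFactor_le hv i w.2

/-- The three leading terms of the expansion, as a single sum over the bonds. -/
theorem leading_terms_eq (hv : IsConvexLatticePolygon v) (hd : 2 < d)
    (hC : ∀ w : Bond, |φ (bondLength F w.1)| ≤ C * ‖w.1‖ ^ (-(2 + d))) (k : ℕ) :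
    (Summable fun w : Bond => expansionCount v k w.1 * φ (bondLength F w.1)) ∧
    (k : ℝ) ^ 2 * (∫ _ in polygon v, storedEnergy φ F) +
      (k : ℝ) * (∫ x in frontier (polygon v), surfaceDensity φ F (boundaryNormal v x)
        ∂(MeasureTheory.Measure.hausdorffMeasure 1)) +
      ∑ i, vertexEnergy φ F (unitNormal v i) (unitNormal v (i - 1)) =
    (1 / 2) * ∑' w : Bond, expansionCount v k w.1 * φ (bondLength F w.1) := by
  have hb := summable_bulkTerm hd hC
  have hs := summable_surfaceTerm hd hC
  have hc := summable_cornerTerm hv hd hC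
  have hb' := hb.mul_left (shoelace v * (k : ℝ) ^ 2)
  have hs' : ∀ i, Summable fun w : Bond => (-(k / 2) * ‖toPlane (edge v i)‖) *
      surfaceTerm φ F (millerNormal v i) w := fun i => (hs _).mul_left _
  have hs'' := summable_sum fun i (_ : i ∈ Finset.univ) => hs' i
  have hc'' := summable_sum fun i (_ : i ∈ Finset.univ) => hc i
  have hterm : (fun w : Bond => expansionCount v k w.1 * φ (bondLength F w.1)) = fun w =>
      shoelace v * (k : ℝ) ^ 2 * bulkTerm φ F w +
      ∑ i, (-(k / 2) * ‖toPlane (edge v i)‖) * surfaceTerm φ F (millerNormal v i) w +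
      ∑ i, cornerTerm φ F (unitNormal v i) (unitNormal v (i - 1)) w := by
    funext w
    rw [expansionCount, add_mul, add_mul, Finset.sum_mul, Finset.sum_mul]
    simp only [surfaceTerm_eq, cornerTerm_eq, mul_assoc]
    rfl
  rw [hterm]
  refine ⟨(hb'.add hs'').add hc'', ?_⟩
  rw [(hb'.add hs'').tsum_add hc'', hb'.tsum_add hs'', tsum_mul_left,
    Summable.tsum_finsetSum fun i _ => hs' i, Summable.tsum_finsetSum fun i _ => hc i,
    integral_frontier hv fun m => surfaceDensity φ F m, MeasureTheory.setIntegral_const,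
    MeasureTheory.measureReal_def, volume_polygon hv, smul_eq_mul, mul_add, mul_add,
    Finset.mul_sum, Finset.mul_sum, Finset.mul_sum]
  refine congrArg₂ _ (congrArg₂ _ ?_ ?_) rfl
  · rw [storedEnergy]; ring
  · refine Finset.sum_congr rfl fun i _ => ?_
    rw [tsum_mul_left, surfaceDensity]; ring

/-- Only the bonds that are long compared with `k` contribute to the remainder, so the tail of the
lattice sum bounds it. -/
theorem energy_sub_leading_isBigO (hv : IsConvexLatticePolygon v) (hd : 2 < d)
    (hC0 : 0 ≤ C) (hC : ∀ w : Bond, |φ (bondLength F w.1)| ≤ C * ‖w.1‖ ^ (-(2 + d))) :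
    (fun k : ℕ => energy φ F ((k : ℝ) • polygon v) -
      (1 / 2) * ∑' w : Bond, expansionCount v k w.1 * φ (bondLength F w.1))
      =O[Filter.atTop] fun k : ℕ => (k : ℝ) ^ (2 - d) := by
  obtain ⟨K, B, hK, hB, hdev⟩ := exists_deviation_bound hv
  obtain ⟨T, hT⟩ := exists_tail_bound hd hK
  refine Asymptotics.IsBigO.of_bound (1 / 2 * (B * C * T))
    ((Filter.eventually_gt_atTop 0).mono fun k hk => ?_)
  obtain ⟨hsum, hE⟩ := energy_eq hv φ F hk
  have hM := (leading_terms_eq hv hd hC k).1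
  obtain ⟨htail, hle⟩ := hT k hk
  have hpt : ∀ w : Bond, ‖(bondCount (k • v) w.1 : ℝ) * φ (bondLength F w.1) -
      expansionCount v k w.1 * φ (bondLength F w.1)‖ ≤
      B * C * (if (k : ℝ) < K * ‖w.1‖ then ‖w.1‖ ^ (-d) else 0) := by
    intro w
    have hw : 0 < ‖w.1‖ := lt_of_lt_of_le one_pos (one_le_norm_lat w.2)
    rw [← sub_mul, Real.norm_eq_abs, abs_mul]
    have h := mul_le_mul (hdev k hk w.1 w.2) (hC w) (abs_nonneg _)
      ((abs_nonneg _).trans (hdev k hk w.1 w.2))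
    refine h.trans (le_of_eq ?_)
    split_ifs
    · rw [← sq_mul_rpow (d := d) hw]; ring
    · ring
  have htail' := (htail.subtype {w : Lat | w ≠ 0}).mul_left (B * C)
  have h1 := tsum_of_norm_bounded htail'.hasSum hpt
  rw [tsum_mul_left] at h1
  have h2 : ∑' w : Bond, (if (k : ℝ) < K * ‖w.1‖ then ‖w.1‖ ^ (-d) else 0) ≤
      ∑' w : Lat, (if (k : ℝ) < K * ‖w‖ then ‖w‖ ^ (-d) else 0) :=
    htail.tsum_subtype_le _ {w : Lat | w ≠ 0} fun w => by positivity
  have hk0 : (0 : ℝ) ≤ (k : ℝ) ^ (2 - d) := Real.rpow_nonneg (Nat.cast_nonneg k) _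
  rw [hE, ← mul_sub, ← hsum.tsum_sub hM, norm_mul, Real.norm_of_nonneg hk0,
    Real.norm_of_nonneg (by norm_num : (0 : ℝ) ≤ 1 / 2), mul_assoc, mul_assoc (B * C)]
  refine mul_le_mul_of_nonneg_left (h1.trans ?_) (by norm_num)
  exact mul_le_mul_of_nonneg_left (h2.trans hle) (mul_nonneg hB hC0)

end Expansion

end LatticeCrystal

end

theorem proposition2
    (φ : ℝ → ℝ) (d : ℝ) (hd : 2 < d)
    (hφ : ∀ r₀ : ℝ, 0 < r₀ → ∃ C : ℝ, ∀ r : ℝ, r₀ ≤ r → |φ r| < C * r ^ (-(2 + d)))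
    (F : Matrix (Fin 2) (Fin 2) ℝ) (hF : 0 < F.det)
    {N : ℕ} [NeZero N] (v : Fin N → LatticeCrystal.Lat)
    (hv : LatticeCrystal.IsConvexLatticePolygon v) :
    Summable (LatticeCrystal.bulkTerm φ F) ∧
    (∀ i, Summable (LatticeCrystal.surfaceTerm φ F (LatticeCrystal.millerNormal v i))) ∧
    (∀ i, Summable (LatticeCrystal.cornerTerm φ F
      (LatticeCrystal.unitNormal v i) (LatticeCrystal.unitNormal v (i - 1)))) ∧
    MeasureTheory.IntegrableOn
      (fun x => LatticeCrystal.surfaceDensity φ F (LatticeCrystal.boundaryNormal v x))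
      (frontier (LatticeCrystal.polygon v)) (MeasureTheory.Measure.hausdorffMeasure 1) ∧
    (fun k : ℕ =>
      LatticeCrystal.energy φ F ((k : ℝ) • LatticeCrystal.polygon v) -
        ((k : ℝ) ^ 2 * (∫ _ in LatticeCrystal.polygon v, LatticeCrystal.storedEnergy φ F) +
          (k : ℝ) * (∫ x in frontier (LatticeCrystal.polygon v),
            LatticeCrystal.surfaceDensity φ F (LatticeCrystal.boundaryNormal v x)
              ∂(MeasureTheory.Measure.hausdorffMeasure 1)) +
          ∑ i, LatticeCrystal.vertexEnergy φ F
            (LatticeCrystal.unitNormal v i) (LatticeCrystal.unitNormal v (i - 1))))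
      =O[Filter.atTop] (fun k : ℕ => (k : ℝ) ^ (2 - d)) := by
  obtain ⟨C, hC0, hC⟩ := LatticeCrystal.exists_potential_bound hd hφ hF
  refine ⟨LatticeCrystal.summable_bulkTerm hd hC,
    fun i => LatticeCrystal.summable_surfaceTerm hd hC _,
    LatticeCrystal.summable_cornerTerm hv hd hC,
    LatticeCrystal.integrableOn_frontier hv fun m => LatticeCrystal.surfaceDensity φ F m, ?_⟩
  simp only [(LatticeCrystal.leading_terms_eq hv hd hC _).2]
  exact LatticeCrystal.energy_sub_leading_isBigO hv hd hC0 hC
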